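/- Work on $\mathbb R^3$ with $\mathbb C^4$-valued functions and tempered distributions. Put $\langle x\rangle=(1+|x|^2)^{1/2}$, $\langle D\rangle=(1-\Delta)^{1/2}$, $\mathcal L^2=[L^2(\mathbb R^3)]^4$, $\mathcal S=[S(\mathbb R^3)]^4$ (Schwartz functions), and for $\mu,s\in\mathbb R$ let $\mathcal H^{\mu,s}=\{u\in\mathcal S' : \langle x\rangle^{s}\langle D\rangle^{\mu}u\in\mathcal L^2\}$ with norm $\|\langle x\rangle^{s}\langle D\rangle^{\mu}u\|_{\mathcal L^2}$; thus $\mathcal H^{0,s}=\mathcal L^{2,s}$ is the weighted $L^2$ space. Let $\mathcal B(\mu,s;\nu,t)$ be the Banach space of bounded linear operators $\mathcal H^{\mu,s}\to\mathcal H^{\nu,t}$ with the operator norm. Let $\alpha_j=\begin{pmatrix}0&\sigma_j\\ \sigma_j&0\end{pmatrix}$, $j=1,2,3$, with the Pauli matrices $\sigma_j$, and $H_0=\sum_{j=1}^3\alpha_j\,\frac1i\partial_j$, which acts on $\mathcal S'$ and, with domain $\mathcal H^{1,0}$, as an operator in $\mathcal L^2$. For $\operatorname{Im}z\ne0$ let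 $R_0(z)=(H_0-z)^{-1}$ and for $z\in\mathbb C\setminus[0,\infty)$ let $\Gamma_0(z)=(-\Delta-z)^{-1}$ (componentwise, with domain $\mathcal H^{2,0}$) be the bounded resolvents in $\mathcal L^2$, which exist. For a Schwartz function $f$ let $$Af(x)=\int_{\mathbb R^3} i\,\frac{\alpha\cdot(x-y)}{4\pi|x-y|^3}\,f(y)\,dy ,\qquad \alpha\cdot(x-y)=\sum_{j=1}^3\alpha_j(x_j-y_j).$$ Write $\mathbb C_\pm=\{z\in\mathbb C:\pm\operatorname{Im}z>0\}$ and $\overline{\mathbb C}_\pm$ for their closures. Let $s,s'>1/2$ with $s+s'>2$. Then: (1) For $z\in\mathbb C_\pm$, the operator $\Gamma_0(z^2)$, restricted to $\mathcal L^2\cap\mathcal H^{-1,s}$, has a unique bounded extension in $\mathcal B(-1,s;1,-s')$, and these extensions form a function on $\mathbb C_\pm$ that extends to a norm-continuous function $\Omega_0^\pm:\overline{\mathbb C}_\pm\to\mathcal B(-1,s;1,-s')$. For $f\in\mathcal S$ and $z\in\overline{\mathbb C}_\pm$, $$\Omega_0^\pm(z)f(x)=\int_{\mathbb R^3}\frac{e^{\pm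 iz|x-y|}}{4\pi|x-y|}\,f(y)\,dy .$$ (2) For $z\in\mathbb C_\pm$, the operator $R_0(z)$, restricted to $\mathcal L^2\cap\mathcal H^{-1,s}$, has a unique bounded extension in $\mathcal B(-1,s;0,-s')$. As a function of $z$ it is norm-continuous on $\mathbb C_\pm$ and extends to a norm-continuous function $R_0^\pm:\overline{\mathbb C}_\pm\to\mathcal B(-1,s;0,-s')$, and, with $H_0$ acting in the sense of distributions, $$R_0^\pm(z)=(H_0+z)\,\Omega_0^\pm(z),\qquad z\in\overline{\mathbb C}_\pm .$$ (3) At $z=0$, $\Omega_0^+(0)=\Omega_0^-(0)$ and $R_0^+(0)=R_0^-(0)=H_0\,\Omega_0^\pm(0)$. For every $f\in\mathcal S$ the integral $Af(x)$ converges absolutely for every $x$, and $R_0^+(0)f=R_0^-(0)f=Af$. Moreover $R_0^\pm(0)$ is the unique operator in $\mathcal B(-1,s;0,-s')$ that agrees with $A$ on $\mathcal S$. -/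

import Mathlib

open MeasureTheory
open scoped SchwartzMap ENNReal LineDeriv Laplacian

noncomputable section

namespace MasslessDirac

/-- Physical space `ℝ³` with its Euclidean norm. -/
abbrev R3 := EuclideanSpace ℝ (Fin 3)

/-- The spinor space `ℂ⁴` with its Hermitian norm. -/
abbrev C4 := EuclideanSpace ℂ (Fin 4)

/-- `[L²(ℝ³)]⁴`, realised as the space of `ℂ⁴`-valued square integrable functions. -/
abbrev L2 := Lp C4 2 (volume : Measure R3)

/-- `[S'(ℝ³)]⁴`, realised as the space of `ℂ⁴`-valued tempered distributions. -/
abbrev Distr := 𝓢'(R3, C4)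

/-- The embedding of `L²` into tempered distributions. -/
def ofL2 : L2 →ₗ[ℂ] Distr :=
  (Lp.toTemperedDistributionCLM C4 (volume : Measure R3) 2 : L2 →L[ℂ] Distr)

/-- The embedding of Schwartz functions into tempered distributions. -/
def ofSchwartz : 𝓢(R3, C4) →ₗ[ℂ] Distr :=
  (SchwartzMap.toTemperedDistributionCLM R3 C4 volume : 𝓢(R3, C4) →L[ℂ] Distr)

/-- The tempered distribution `T` is given by the function `g`. -/
def RepresentedBy (T : Distr) (g : R3 → C4) : Prop :=
  ∀ φ : 𝓢(R3, ℂ), Integrable (fun x => φ x • g x) volume ∧ T φ = ∫ x, φ x • g x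

theorem ofL2_injective : Function.Injective ofL2 :=
  LinearMap.ker_eq_bot.mp (Lp.ker_toTemperedDistributionCLM_eq_bot (F := C4)
    (μ := (volume : Measure R3)) (p := 2))

/-! ### Weighted Sobolev spaces -/

/-- The weight `⟨x⟩ ^ s`, where `⟨x⟩ = (1 + |x|²) ^ (1/2)`. -/
def weight (s : ℝ) (x : R3) : ℂ := (((1 + ‖x‖ ^ 2) ^ (s / 2) : ℝ) : ℂ)

/-- The symbol of `⟨D⟩ ^ μ = (1 - Δ) ^ (μ/2)`. Since Mathlib's Fourier transform has the kernel
`exp (-2πi x·ξ)`, the operator `1 - Δ` has the symbol `1 + |2πξ|²`. -/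
def besselSymbol (μ : ℝ) (ξ : R3) : ℂ := weight μ ((2 * Real.pi) • ξ)

theorem weight_hasTemperateGrowth (s : ℝ) : (weight s).HasTemperateGrowth := by
  unfold weight
  fun_prop

theorem besselSymbol_hasTemperateGrowth (μ : ℝ) : (besselSymbol μ).HasTemperateGrowth :=
  (weight_hasTemperateGrowth μ).comp
    (((2 * Real.pi) • ContinuousLinearMap.id ℝ R3).hasTemperateGrowth)

theorem weight_mul (s t : ℝ) : weight s * weight t = weight (s + t) := by
  ext x
  simp only [weight, Pi.mul_apply]
  rw [← Complex.ofReal_mul, ← Real.rpow_add (by positivity)]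
  congr 2
  ring

theorem weight_zero : weight 0 = fun _ => 1 := by
  ext x
  simp [weight]

theorem besselSymbol_mul (s t : ℝ) : besselSymbol s * besselSymbol t = besselSymbol (s + t) := by
  ext ξ
  exact congrFun (weight_mul s t) _

theorem besselSymbol_zero : besselSymbol 0 = fun _ => 1 := by
  ext ξ
  exact congrFun weight_zero _

/-- The operator `⟨x⟩ ^ s` on tempered distributions. -/
def mulWeight (s : ℝ) : Distr →ₗ[ℂ] Distr :=
  (TemperedDistribution.smulLeftCLM C4 (weight s) : Distr →L[ℂ] Distr)

/-- The operator `⟨D⟩ ^ μ` on tempered distributions. -/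
def bessel (μ : ℝ) : Distr →ₗ[ℂ] Distr :=
  (TemperedDistribution.fourierMultiplierCLM C4 (besselSymbol μ) : Distr →L[ℂ] Distr)

theorem mulWeight_mulWeight (s t : ℝ) (u : Distr) :
    mulWeight t (mulWeight s u) = mulWeight (s + t) u := by
  have := TemperedDistribution.smulLeftCLM_smulLeftCLM_apply (weight_hasTemperateGrowth s)
    (weight_hasTemperateGrowth t) u
  rw [weight_mul] at this
  exact this

theorem mulWeight_zero (u : Distr) : mulWeight 0 u = u := by
  simp [mulWeight, weight_zero]

theorem bessel_bessel (s t : ℝ) (u : Distr) : bessel t (bessel s u) = bessel (s + t) u := by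
  have := TemperedDistribution.fourierMultiplierCLM_fourierMultiplierCLM_apply
    (besselSymbol_hasTemperateGrowth s) (besselSymbol_hasTemperateGrowth t) u
  rw [besselSymbol_mul] at this
  exact this

theorem bessel_zero (u : Distr) : bessel 0 u = u := by
  have := TemperedDistribution.fourierMultiplierCLM_const (E := R3) (F := C4) (1 : ℂ)
  rw [one_smul] at this
  simp [bessel, besselSymbol_zero, this]

/-- The operator `⟨x⟩ ^ s ⟨D⟩ ^ μ` on tempered distributions. -/
def weightedBessel (μ s : ℝ) : Distr →ₗ[ℂ] Distr := mulWeight s ∘ₗ bessel μ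

theorem weightedBessel_injective (μ s : ℝ) : Function.Injective (weightedBessel μ s) := by
  apply Function.LeftInverse.injective (g := fun v => bessel (-μ) (mulWeight (-s) v))
  intro u
  simp [weightedBessel, mulWeight_mulWeight, bessel_bessel, mulWeight_zero, bessel_zero]

/-- The weighted Sobolev space `{u ∈ S' | ⟨x⟩ ^ s ⟨D⟩ ^ μ u ∈ L²}` of `ℂ⁴`-valued distributions,
as a subspace of the space of tempered distributions. -/
def weightedSobolev (μ s : ℝ) : Submodule ℂ Distr :=
  (LinearMap.range ofL2).comap (weightedBessel μ s)

/-- For `μ = 0` the weighted Sobolev space is the weighted space `L^{2,s}`. -/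
theorem mem_weightedSobolev_zero {s : ℝ} {u : Distr} :
    u ∈ weightedSobolev 0 s ↔ ∃ g : L2, ofL2 g = mulWeight s u := by
  simp [weightedSobolev, weightedBessel, bessel_zero]

/-- The weighted Sobolev space `H^{μ,s}` as a type of its own; its topology is the one of
the norm below, not the one induced by the space of tempered distributions. -/
def HSob (μ s : ℝ) : Type := weightedSobolev μ s

instance (μ s : ℝ) : AddCommGroup (HSob μ s) :=
  inferInstanceAs (AddCommGroup (weightedSobolev μ s))

instance (μ s : ℝ) : Module ℂ (HSob μ s) :=
  inferInstanceAs (Module ℂ (weightedSobolev μ s))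

/-- The inclusion of `H^{μ,s}` into the tempered distributions. -/
def HSob.toDistr {μ s : ℝ} : HSob μ s →ₗ[ℂ] Distr := (weightedSobolev μ s).subtype

/-- The map `u ↦ ⟨x⟩ ^ s ⟨D⟩ ^ μ u` from `H^{μ,s}` to `L²`. -/
def HSob.toL2 {μ s : ℝ} : HSob μ s →ₗ[ℂ] L2 :=
  (LinearEquiv.ofInjective ofL2 ofL2_injective).symm.toLinearMap ∘ₗ
    (weightedBessel μ s ∘ₗ HSob.toDistr).codRestrict (LinearMap.range ofL2)
      (fun u : weightedSobolev μ s => u.2)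

theorem HSob.ofL2_toL2 {μ s : ℝ} (u : HSob μ s) :
    ofL2 u.toL2 = weightedBessel μ s u.toDistr := by
  have := LinearEquiv.apply_symm_apply (LinearEquiv.ofInjective ofL2 ofL2_injective)
    ((weightedBessel μ s ∘ₗ HSob.toDistr).codRestrict (LinearMap.range ofL2)
      (fun u : weightedSobolev μ s => u.2) u)
  exact congrArg Subtype.val this

theorem HSob.toL2_injective {μ s : ℝ} : Function.Injective (HSob.toL2 (μ := μ) (s := s)) := by
  intro u v h
  apply Subtype.val_injective
  apply weightedBessel_injective μ s
  exact (HSob.ofL2_toL2 u).symm.trans ((congrArg ofL2 h).trans (HSob.ofL2_toL2 v))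

/-- The norm `‖⟨x⟩ ^ s ⟨D⟩ ^ μ u‖_{L²}` of `H^{μ,s}`. -/
instance (μ s : ℝ) : NormedAddCommGroup (HSob μ s) :=
  NormedAddCommGroup.induced (HSob μ s) L2 HSob.toL2 HSob.toL2_injective

/-- The inner product `(⟨x⟩ ^ s ⟨D⟩ ^ μ u, ⟨x⟩ ^ s ⟨D⟩ ^ μ v)_{L²}` of `H^{μ,s}`. -/
instance (μ s : ℝ) : InnerProductSpace ℂ (HSob μ s) where
  toNormedSpace := NormedSpace.induced ℂ (HSob μ s) L2 HSob.toL2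
  inner u v := inner ℂ u.toL2 v.toL2
  norm_sq_eq_re_inner u := norm_sq_eq_re_inner (𝕜 := ℂ) u.toL2
  conj_inner_symm u v := inner_conj_symm (𝕜 := ℂ) u.toL2 v.toL2
  add_left u v w := by simp [inner_add_left]
  smul_left u v r := by simp [inner_smul_left]

/-- Schwartz functions belong to every `H^{μ,s}`. -/
theorem ofSchwartz_mem (μ s : ℝ) (f : 𝓢(R3, C4)) : ofSchwartz f ∈ weightedSobolev μ s := by
  set g : 𝓢(R3, C4) := SchwartzMap.smulLeftCLM C4 (weight s)
    (SchwartzMap.fourierMultiplierCLM C4 (besselSymbol μ) f) with hg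
  refine ⟨g.toLp 2, ?_⟩
  have h1 : bessel μ (ofSchwartz f)
      = ofSchwartz (SchwartzMap.fourierMultiplierCLM C4 (besselSymbol μ) f) :=
    TemperedDistribution.fourierMultiplierCLM_toTemperedDistributionCLM_eq
      (besselSymbol_hasTemperateGrowth μ) f
  have h2 : mulWeight s (ofSchwartz (SchwartzMap.fourierMultiplierCLM C4 (besselSymbol μ) f))
      = ofSchwartz g := by
    ext1 φ
    simp [mulWeight, ofSchwartz, hg, SchwartzMap.smulLeftCLM_apply_apply,
      weight_hasTemperateGrowth, smul_smul, mul_comm]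
  have h3 : ofL2 (g.toLp 2) = ofSchwartz g := Lp.toTemperedDistribution_toLp_eq g
  simp [weightedBessel, h1, h2, h3]

/-- A Schwartz function as an element of `H^{μ,s}`. -/
def schwartzToHSob (μ s : ℝ) : 𝓢(R3, C4) →ₗ[ℂ] HSob μ s :=
  ofSchwartz.codRestrict (weightedSobolev μ s) (ofSchwartz_mem μ s)

/-! ### The free Dirac operator and the negative Laplacian -/

/-- The Pauli matrices `σ₁, σ₂, σ₃`. -/
def pauli : Fin 3 → Matrix (Fin 2) (Fin 2) ℂ :=
  ![!![0, 1; 1, 0], !![0, -Complex.I; Complex.I, 0], !![1, 0; 0, -1]]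

/-- The Dirac matrices `αⱼ`, with the blocks `0, σⱼ, σⱼ, 0`. -/
def diracAlpha (j : Fin 3) : Matrix (Fin 4) (Fin 4) ℂ :=
  Matrix.reindex finSumFinEquiv finSumFinEquiv (Matrix.fromBlocks 0 (pauli j) (pauli j) 0)

/-- `αⱼ` as an operator on `ℂ⁴`. -/
def alphaOp (j : Fin 3) : C4 →L[ℂ] C4 := Matrix.toEuclideanCLM (𝕜 := ℂ) (diracAlpha j)

/-- The operator `u ↦ (1/i) ∂ⱼ u` on tempered distributions. -/
def momentum (j : Fin 3) : Distr →ₗ[ℂ] Distr :=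
  (-Complex.I) •
    (LineDeriv.lineDerivOpCLM ℂ Distr (EuclideanSpace.single j (1 : ℝ) : R3) : Distr →L[ℂ] Distr)

/-- The operator `u ↦ αⱼ u` on tempered distributions. -/
def alphaDistr (j : Fin 3) : Distr →ₗ[ℂ] Distr :=
  (PointwiseConvergenceCLM.postcomp 𝓢(R3, ℂ) (alphaOp j) : Distr →L[ℂ] Distr)

/-- The free massless Dirac operator `H₀ = α · D` on tempered distributions. -/
def diracDistr : Distr →ₗ[ℂ] Distr := ∑ j, alphaDistr j ∘ₗ momentum j

/-- The negative Laplacian on tempered distributions. -/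
def negLaplaceDistr : Distr →ₗ[ℂ] Distr :=
  -(LineDeriv.laplacianCLM ℂ R3 Distr : Distr →L[ℂ] Distr)

theorem memSobolev_of_mem {μ : ℝ} (hμ : 0 ≤ μ) {u : Distr} (hu : u ∈ weightedSobolev μ 0) :
    TemperedDistribution.MemSobolev μ 2 u := by
  obtain ⟨g, hg⟩ := hu
  have hg' : TemperedDistribution.MemSobolev 0 2 (bessel μ u) := by
    rw [TemperedDistribution.memSobolev_zero_iff]
    refine ⟨g, ?_⟩
    rw [weightedBessel, LinearMap.comp_apply, mulWeight_zero] at hg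
    exact hg.symm
  have hr := hg'.fourierMultiplierCLM_of_bounded (g := weight μ * besselSymbol (-μ))
    ((weight_hasTemperateGrowth μ).mul (besselSymbol_hasTemperateGrowth (-μ))) ⟨1, by
      intro ξ
      have h1 : (1 : ℝ) ≤ 2 * Real.pi := by nlinarith [Real.pi_gt_three]
      have h2 : ‖ξ‖ ≤ ‖(2 * Real.pi) • ξ‖ := by
        rw [norm_smul, Real.norm_of_nonneg (by positivity)]
        nlinarith [norm_nonneg ξ]
      have h3 : (1 + ‖ξ‖ ^ 2) ^ (μ / 2) ≤ (1 + ‖(2 * Real.pi) • ξ‖ ^ 2) ^ (μ / 2) := by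
        gcongr
      simp only [Pi.mul_apply, besselSymbol, weight, ← Complex.ofReal_mul, Complex.norm_real]
      rw [Real.norm_of_nonneg (by positivity), neg_div, Real.rpow_neg (by positivity),
        mul_inv_le_iff₀ (by positivity), one_mul]
      exact h3⟩
  have hs : (weight μ * besselSymbol (-μ)) = besselSymbol (-μ) * weight μ := mul_comm _ _
  have hb : TemperedDistribution.besselPotential R3 C4 μ u
      = TemperedDistribution.fourierMultiplierCLM C4 (weight μ * besselSymbol (-μ))
        (bessel μ u) := by
    rw [hs, ← TemperedDistribution.fourierMultiplierCLM_fourierMultiplierCLM_apply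
      (besselSymbol_hasTemperateGrowth (-μ)) (weight_hasTemperateGrowth μ)]
    have := bessel_bessel μ (-μ) u
    rw [add_neg_cancel, bessel_zero] at this
    exact congrArg (TemperedDistribution.fourierMultiplierCLM C4 (weight μ)) this.symm
  obtain ⟨w, hw⟩ := TemperedDistribution.memSobolev_zero_iff.mp hr
  exact ⟨w, hb.trans hw⟩

/-- `H₀` maps the Sobolev space `H¹` to `L²`. -/
theorem diracDistr_mem {u : Distr} (hu : u ∈ weightedSobolev 1 0) :
    diracDistr u ∈ LinearMap.range ofL2 := by
  have hm := memSobolev_of_mem zero_le_one hu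
  have key : ∀ j, alphaDistr j (momentum j u) ∈ LinearMap.range ofL2 := by
    intro j
    have hd := hm.lineDerivOp (m := (EuclideanSpace.single j (1 : ℝ) : R3))
    rw [sub_self, TemperedDistribution.memSobolev_zero_iff] at hd
    obtain ⟨w, hw⟩ := hd
    refine ⟨(alphaOp j).compLp ((-Complex.I) • w), ?_⟩
    have h1 : momentum j u = ofL2 ((-Complex.I) • w) := by
      rw [map_smul]
      exact congrArg (fun v : Distr => (-Complex.I) • v) hw
    rw [h1]
    ext1 φ
    have hi : Integrable (fun x => φ x • ((-Complex.I) • w : L2) x) volume := by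
      have h2 := (Lp.memLp ((-Complex.I) • w : L2)).smul (φ.memLp 2 (volume : Measure R3))
        (r := 1)
      exact memLp_one_iff_integrable.mp h2
    have h3 : ofL2 ((alphaOp j).compLp ((-Complex.I) • w)) φ
        = ∫ x, φ x • ((alphaOp j).compLp ((-Complex.I) • w)) x :=
      Lp.toTemperedDistribution_apply _ φ
    have h4 : alphaDistr j (ofL2 ((-Complex.I) • w)) φ
        = alphaOp j (∫ x, φ x • ((-Complex.I) • w : L2) x) :=
      congrArg (alphaOp j) (Lp.toTemperedDistribution_apply _ φ)
    rw [h3, h4, ← ContinuousLinearMap.integral_comp_comm _ hi]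
    apply integral_congr_ae
    filter_upwards [(alphaOp j).coeFn_compLp ((-Complex.I) • w : L2)] with x hx
    rw [hx, map_smul]
  rw [diracDistr, LinearMap.sum_apply]
  exact Submodule.sum_mem _ fun j _ => key j

/-- `-Δ` maps the Sobolev space `H²` to `L²`. -/
theorem negLaplaceDistr_mem {u : Distr} (hu : u ∈ weightedSobolev 2 0) :
    negLaplaceDistr u ∈ LinearMap.range ofL2 := by
  have hm := (memSobolev_of_mem zero_le_two hu).laplacian
  rw [sub_self, TemperedDistribution.memSobolev_zero_iff] at hm
  obtain ⟨w, hw⟩ := hm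
  refine ⟨-w, ?_⟩
  rw [map_neg]
  exact congrArg (fun v : Distr => -v) (hw.symm.trans
    (TemperedDistribution.laplacianCLM_apply u).symm)

/-- The operator in `L²` with domain `H^μ` that acts as `T` in the sense of distributions. -/
def l2Realization (T : Distr →ₗ[ℂ] Distr) (μ : ℝ)
    (hT : ∀ u ∈ weightedSobolev μ 0, T u ∈ LinearMap.range ofL2) : L2 →ₗ.[ℂ] L2 where
  domain := (weightedSobolev μ 0).comap ofL2
  toFun := (LinearEquiv.ofInjective ofL2 ofL2_injective).symm.toLinearMap ∘ₗ
    (T ∘ₗ ofL2 ∘ₗ ((weightedSobolev μ 0).comap ofL2).subtype).codRestrict (LinearMap.range ofL2)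
      (fun f => hT _ f.2)

theorem ofL2_l2Realization (T : Distr →ₗ[ℂ] Distr) (μ : ℝ)
    (hT : ∀ u ∈ weightedSobolev μ 0, T u ∈ LinearMap.range ofL2)
    (f : (l2Realization T μ hT).domain) :
    ofL2 (l2Realization T μ hT f) = T (ofL2 f) :=
  congrArg Subtype.val (LinearEquiv.apply_symm_apply (LinearEquiv.ofInjective ofL2 ofL2_injective)
    ((T ∘ₗ ofL2 ∘ₗ ((weightedSobolev μ 0).comap ofL2).subtype).codRestrict (LinearMap.range ofL2)
      (fun f => hT _ f.2) f))

/-- The free massless Dirac operator `H₀` in `L²`, with domain `H¹`. -/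
def diracOp : L2 →ₗ.[ℂ] L2 := l2Realization diracDistr 1 fun _ => diracDistr_mem

/-- The operator `-Δ` in `L²` (acting on each of the four components), with domain `H²`. -/
def negLaplaceOp : L2 →ₗ.[ℂ] L2 := l2Realization negLaplaceDistr 2 fun _ => negLaplaceDistr_mem

/-! ### Resolvents and their extensions -/

/-- `R` is a bounded two-sided inverse of `T - z`. -/
def IsResolvent (T : L2 →ₗ.[ℂ] L2) (z : ℂ) (R : L2 →L[ℂ] L2) : Prop :=
  (∀ f, ∃ h : R f ∈ T.domain, T ⟨R f, h⟩ - z • R f = f) ∧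
    ∀ g : T.domain, R (T g - z • (g : L2)) = g

open Classical in
/-- The resolvent `(T - z)⁻¹` (with the value `0` if `z` is in the spectrum of `T`). -/
def resolventOp (T : L2 →ₗ.[ℂ] L2) (z : ℂ) : L2 →L[ℂ] L2 :=
  if h : ∃ R, IsResolvent T z R then h.choose else 0

/-- The resolvent `R₀(z) = (H₀ - z)⁻¹` in `L²`. -/
def diracResolvent (z : ℂ) : L2 →L[ℂ] L2 := resolventOp diracOp z

/-- The resolvent `Γ₀(z) = (-Δ - z)⁻¹` in `L²`. -/
def laplaceResolvent (z : ℂ) : L2 →L[ℂ] L2 := resolventOp negLaplaceOp z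

/-- The bounded operator `T : H^{μ,s} → H^{ν,t}` agrees with the operator `B` of `L²`
on `L² ∩ H^{μ,s}`. -/
def Extends {μ s ν t : ℝ} (T : HSob μ s →L[ℂ] HSob ν t) (B : L2 →L[ℂ] L2) : Prop :=
  ∀ (f : L2) (u : HSob μ s), u.toDistr = ofL2 f → (T u).toDistr = ofL2 (B f)

/-! ### Integral operators -/

/-- The integrand `e^{ik|x-y|} / (4π|x-y|) f(y)`. -/
def helmholtzIntegrand (k : ℂ) (f : R3 → C4) (x y : R3) : C4 :=
  (Complex.exp (Complex.I * k * ‖x - y‖) / (4 * Real.pi * ‖x - y‖)) • f y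

/-- The integrand `i α·(x-y) / (4π|x-y|³) f(y)`. -/
def singularIntegrand (f : R3 → C4) (x y : R3) : C4 :=
  (Complex.I / (4 * Real.pi * ‖x - y‖ ^ 3)) • ∑ j, alphaOp j ((((x - y) j : ℝ) : ℂ) • f y)

/-- The singular integral operator `A f(x) = ∫ i α·(x-y) / (4π|x-y|³) f(y) dy`. -/
def singularOp (f : R3 → C4) (x : R3) : C4 := ∫ y, singularIntegrand f x y

end MasslessDirac

end

open MasslessDirac

noncomputable section

namespace MasslessDirac

open Filter Topology FourierTransform

/-! ### Multiplication operators and Fourier multipliers on `L²` -/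

/-! The map u ↦ ⟨x⟩^s⟨D⟩^μ u identifies H^{μ,s} isometrically with L², so every statement about
operators between weighted Sobolev spaces becomes one about operators in L². Under this
identification Γ₀(z²) : H^{-1,s} → H^{1,-s'} is ⟨x⟩^{-s'} ⟨D⟩²(-Δ-z²)⁻¹ ⟨x⟩^{-s}, and ⟨D⟩²(-Δ-z²)⁻¹
= 1 + (1+z²)(-Δ-z²)⁻¹. Hence the gain of two derivatives costs nothing, and only the norm limits of
⟨x⟩^{-s'}(-Δ-z²)⁻¹⟨x⟩^{-s} on L² are needed.

For Im z > 0 this operator has the kernel ⟨x⟩^{-s'} e^{iz|x-y|}/(4π|x-y|) ⟨y⟩^{-s}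
(`fourier_helmholtzRadial`, `multOp_fourier_toLp`). The kernel is dominated, uniformly in z, by a
multiple of ⟨x⟩^{-s'}|x-y|⁻¹⟨y⟩^{-s}, which is square integrable exactly because s, s' > 1/2 and s +
s' > 2 (`lintegral_inv_norm_sq_mul_weight_lt_top`). Dominated convergence makes the family Cauchy in
the Hilbert–Schmidt norm at every point of the closed half plane, so the limits exist without being
computed.

For the Dirac operator one also needs limits of ⟨x⟩^{-s'} m(D)(-Δ-z²)⁻¹⟨x⟩^{-s} with m(ξ) = ξⱼ/⟨ξ⟩,
and m(D) does not commute with the weight. A frequency cutoff splits m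
(`exists_tendsto_weightedMult_mul_resSymbol`): the low part has a Schwartz symbol, hence is bounded
on L^{2,-s'} by Peetre's inequality; on the high part the resolvent symbol is Lipschitz in z² and
the weights play no role.

Since H₀² = -Δ, one has R₀(z) = (H₀+z)Γ₀(z²) off the real line. Identities in the open half plane
pass to the real line because H^{ν,t} embeds continuously into S' and H₀ is continuous on S'. The
lower half plane is the upper one at -z, since (-z)² = z²; this also makes the two limits at 0
equal. At 0 the kernel is 1/(4π|x-y|), and integration by parts turns H₀ of it into the kernel of A.
All uniqueness claims follow from the density of Schwartz functions in H^{-1,s}. -/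

/-- Bounded measurable symbols. -/
def IsBddMeas (b : R3 → ℂ) : Prop := Measurable b ∧ ∃ C, ∀ ξ, ‖b ξ‖ ≤ C

theorem IsBddMeas.memLp {b : R3 → ℂ} (hb : IsBddMeas b) : MemLp b ∞ volume := by
  obtain ⟨C, hC⟩ := hb.2
  exact memLp_top_of_bound hb.1.aestronglyMeasurable C (.of_forall hC)

theorem IsBddMeas.mul {a b : R3 → ℂ} (ha : IsBddMeas a) (hb : IsBddMeas b) :
    IsBddMeas (fun ξ => a ξ * b ξ) := by
  obtain ⟨C, hC⟩ := ha.2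
  obtain ⟨D, hD⟩ := hb.2
  refine ⟨ha.1.mul hb.1, C * D, fun ξ => ?_⟩
  rw [norm_mul]
  exact mul_le_mul (hC ξ) (hD ξ) (norm_nonneg _) ((norm_nonneg _).trans (hC ξ))

theorem IsBddMeas.add {a b : R3 → ℂ} (ha : IsBddMeas a) (hb : IsBddMeas b) :
    IsBddMeas (fun ξ => a ξ + b ξ) := by
  obtain ⟨C, hC⟩ := ha.2
  obtain ⟨D, hD⟩ := hb.2
  exact ⟨ha.1.add hb.1, C + D, fun ξ => (norm_add_le _ _).trans (add_le_add (hC ξ) (hD ξ))⟩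

theorem IsBddMeas.sub {a b : R3 → ℂ} (ha : IsBddMeas a) (hb : IsBddMeas b) :
    IsBddMeas (fun ξ => a ξ - b ξ) := by
  obtain ⟨C, hC⟩ := ha.2
  obtain ⟨D, hD⟩ := hb.2
  exact ⟨ha.1.sub hb.1, C + D, fun ξ => (norm_sub_le _ _).trans (add_le_add (hC ξ) (hD ξ))⟩

theorem IsBddMeas.const (c : ℂ) : IsBddMeas (fun _ => c) :=
  ⟨measurable_const, ‖c‖, fun _ => le_rfl⟩

theorem IsBddMeas.const_mul {b : R3 → ℂ} (c : ℂ) (hb : IsBddMeas b) :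
    IsBddMeas (fun ξ => c * b ξ) := (IsBddMeas.const c).mul hb

open Classical in
/-- Multiplication by a bounded measurable function on `L²`. -/
def mulOp (b : R3 → ℂ) : L2 →L[ℂ] L2 :=
  if h : IsBddMeas b then
    (ContinuousLinearMap.lsmul ℂ ℂ : ℂ →L[ℂ] C4 →L[ℂ] C4).holderL volume ∞ 2 2 h.memLp.toLp
  else 0

theorem mulOp_coeFn {b : R3 → ℂ} (hb : IsBddMeas b) (f : L2) :
    mulOp b f =ᵐ[volume] fun x => b x • f x := by
  rw [mulOp, dif_pos hb, ContinuousLinearMap.holderL_apply_apply]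
  filter_upwards [ContinuousLinearMap.coeFn_holder (r := 2)
    (ContinuousLinearMap.lsmul ℂ ℂ : ℂ →L[ℂ] C4 →L[ℂ] C4) hb.memLp.toLp f,
    hb.memLp.coeFn_toLp] with x h1 h2
  rw [h1, h2]
  rfl

theorem norm_mulOp_apply_le {b : R3 → ℂ} (hb : IsBddMeas b) {C : ℝ} (hC : ∀ x, ‖b x‖ ≤ C)
    (f : L2) : ‖mulOp b f‖ ≤ C * ‖f‖ := by
  apply Lp.norm_le_mul_norm_of_ae_le_mul
  filter_upwards [mulOp_coeFn hb f] with x hx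
  rw [hx, norm_smul]
  gcongr
  exact hC x

theorem mulOp_mulOp {a b : R3 → ℂ} (ha : IsBddMeas a) (hb : IsBddMeas b) (f : L2) :
    mulOp a (mulOp b f) = mulOp (fun ξ => a ξ * b ξ) f := by
  apply Lp.ext
  filter_upwards [mulOp_coeFn ha (mulOp b f), mulOp_coeFn hb f, mulOp_coeFn (ha.mul hb) f]
    with x h1 h2 h3
  rw [h1, h2, h3, smul_smul]

theorem mulOp_add {a b : R3 → ℂ} (ha : IsBddMeas a) (hb : IsBddMeas b) :
    mulOp (fun ξ => a ξ + b ξ) = mulOp a + mulOp b := by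
  ext1 f
  apply Lp.ext
  rw [add_apply]
  filter_upwards [mulOp_coeFn ha f, mulOp_coeFn hb f, mulOp_coeFn (ha.add hb) f,
    Lp.coeFn_add (mulOp a f) (mulOp b f)] with x h1 h2 h3 h4
  rw [h3, h4, Pi.add_apply, h1, h2, add_smul]

theorem mulOp_sub {a b : R3 → ℂ} (ha : IsBddMeas a) (hb : IsBddMeas b) :
    mulOp (fun ξ => a ξ - b ξ) = mulOp a - mulOp b := by
  ext1 f
  apply Lp.ext
  rw [sub_apply]
  filter_upwards [mulOp_coeFn ha f, mulOp_coeFn hb f, mulOp_coeFn (ha.sub hb) f,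
    Lp.coeFn_sub (mulOp a f) (mulOp b f)] with x h1 h2 h3 h4
  rw [h3, h4, Pi.sub_apply, h1, h2, sub_smul]

theorem mulOp_const (c : ℂ) (f : L2) : mulOp (fun _ => c) f = c • f := by
  apply Lp.ext
  filter_upwards [mulOp_coeFn (IsBddMeas.const c) f, Lp.coeFn_smul c f] with x h1 h2
  rw [h1, h2, Pi.smul_apply]

theorem mulOp_const_mul {b : R3 → ℂ} (c : ℂ) (hb : IsBddMeas b) :
    mulOp (fun ξ => c * b ξ) = c • mulOp b := by
  ext1 f
  rw [← mulOp_mulOp (IsBddMeas.const c) hb, mulOp_const]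
  rfl

/-- The Fourier multiplier with a bounded measurable symbol on `L²`. -/
def multOp (b : R3 → ℂ) : L2 →L[ℂ] L2 :=
  ((Lp.fourierTransformₗᵢ R3 C4).symm : L2 →L[ℂ] L2) ∘L mulOp b ∘L
    ((Lp.fourierTransformₗᵢ R3 C4) : L2 →L[ℂ] L2)

theorem multOp_apply (b : R3 → ℂ) (f : L2) : multOp b f = 𝓕⁻ (mulOp b (𝓕 f)) := rfl

theorem fourier_multOp (b : R3 → ℂ) (f : L2) : 𝓕 (multOp b f) = mulOp b (𝓕 f) := by
  rw [multOp_apply, FourierTransform.fourier_fourierInv_eq]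

theorem norm_multOp_apply_le {b : R3 → ℂ} (hb : IsBddMeas b) {C : ℝ} (hC : ∀ x, ‖b x‖ ≤ C)
    (f : L2) : ‖multOp b f‖ ≤ C * ‖f‖ := by
  have h1 : ‖multOp b f‖ = ‖mulOp b (𝓕 f)‖ :=
    (Lp.fourierTransformₗᵢ R3 C4).symm.norm_map _
  rw [h1, ← Lp.norm_fourier_eq f]
  exact norm_mulOp_apply_le hb hC _

theorem multOp_multOp {a b : R3 → ℂ} (ha : IsBddMeas a) (hb : IsBddMeas b) (f : L2) :
    multOp a (multOp b f) = multOp (fun ξ => a ξ * b ξ) f := by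
  rw [multOp_apply a, fourier_multOp, mulOp_mulOp ha hb, multOp_apply]

theorem multOp_add {a b : R3 → ℂ} (ha : IsBddMeas a) (hb : IsBddMeas b) :
    multOp (fun ξ => a ξ + b ξ) = multOp a + multOp b := by
  simp only [multOp, mulOp_add ha hb, ContinuousLinearMap.add_comp, ContinuousLinearMap.comp_add]

theorem multOp_sub {a b : R3 → ℂ} (ha : IsBddMeas a) (hb : IsBddMeas b) :
    multOp (fun ξ => a ξ - b ξ) = multOp a - multOp b := by
  simp only [multOp, mulOp_sub ha hb, ContinuousLinearMap.sub_comp, ContinuousLinearMap.comp_sub]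

theorem multOp_const_mul {b : R3 → ℂ} (c : ℂ) (hb : IsBddMeas b) :
    multOp (fun ξ => c * b ξ) = c • multOp b := by
  simp only [multOp, mulOp_const_mul c hb, ContinuousLinearMap.smul_comp,
    ContinuousLinearMap.comp_smul]

theorem multOp_one (f : L2) : multOp (fun _ => 1) f = f := by
  rw [multOp_apply, mulOp_const, one_smul, FourierTransform.fourierInv_fourier_eq]

/-! ### Compatibility with tempered distributions -/

theorem ofL2_apply (f : L2) (φ : 𝓢(R3, ℂ)) : ofL2 f φ = ∫ x, φ x • f x :=
  Lp.toTemperedDistribution_apply f φ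

theorem ofL2_toLp (f : 𝓢(R3, C4)) : ofL2 (f.toLp 2) = ofSchwartz f :=
  Lp.toTemperedDistribution_toLp_eq f

/-- The product is given as an a.e. identity and not through `mulOp`, because a may be unbounded and
then af lies in L² only for particular f. -/
theorem smulLeftCLM_ofL2 {a : R3 → ℂ} (ha : a.HasTemperateGrowth) {f g : L2}
    (h : g =ᵐ[volume] fun x => a x • f x) :
    TemperedDistribution.smulLeftCLM C4 a (ofL2 f) = ofL2 g := by
  ext1 φ
  rw [TemperedDistribution.smulLeftCLM_apply_apply, ofL2_apply, ofL2_apply]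
  apply integral_congr_ae
  filter_upwards [h] with x hx
  rw [hx, SchwartzMap.smulLeftCLM_apply_apply ha, smul_eq_mul, mul_comm, smul_smul]

theorem mulWeight_ofL2 {t : ℝ} {f g : L2} (h : g =ᵐ[volume] fun x => weight t x • f x) :
    mulWeight t (ofL2 f) = ofL2 g := smulLeftCLM_ofL2 (weight_hasTemperateGrowth t) h

/-- Only b and the product ab have to be bounded: this is how unbounded multipliers such as ⟨D⟩² or
the momenta are applied to the range of a resolvent. -/
theorem fourierMultiplierCLM_ofL2 {a b : R3 → ℂ} (ha : a.HasTemperateGrowth) (hb : IsBddMeas b)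
    (hab : IsBddMeas (fun ξ => a ξ * b ξ)) (f : L2) :
    TemperedDistribution.fourierMultiplierCLM C4 a (ofL2 (multOp b f))
      = ofL2 (multOp (fun ξ => a ξ * b ξ) f) := by
  have h1 : 𝓕 (ofL2 (multOp b f)) = ofL2 (mulOp b (𝓕 f)) := by
    rw [← fourier_multOp]
    exact Lp.fourier_toTemperedDistribution_eq _
  have h2 : TemperedDistribution.smulLeftCLM C4 a (ofL2 (mulOp b (𝓕 f)))
      = ofL2 (mulOp (fun ξ => a ξ * b ξ) (𝓕 f)) := by
    apply smulLeftCLM_ofL2 ha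
    filter_upwards [mulOp_coeFn hb (𝓕 f), mulOp_coeFn hab (𝓕 f)] with x h3 h4
    rw [h3, h4, smul_smul]
  rw [TemperedDistribution.fourierMultiplierCLM_apply, h1, h2, multOp_apply]
  exact Lp.fourierInv_toTemperedDistribution_eq _

theorem fourierMultiplierCLM_ofL2' {a : R3 → ℂ} (ha : a.HasTemperateGrowth) (hb : IsBddMeas a)
    (f : L2) :
    TemperedDistribution.fourierMultiplierCLM C4 a (ofL2 f) = ofL2 (multOp a f) := by
  have := fourierMultiplierCLM_ofL2 ha (IsBddMeas.const 1) (by simpa using hb) f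
  simpa [multOp_one] using this

theorem mulWeight_ofSchwartz (t : ℝ) (f : 𝓢(R3, C4)) :
    mulWeight t (ofSchwartz f) = ofSchwartz (SchwartzMap.smulLeftCLM C4 (weight t) f) := by
  ext1 φ
  simp [mulWeight, ofSchwartz, SchwartzMap.smulLeftCLM_apply_apply,
    weight_hasTemperateGrowth, smul_smul, mul_comm]

theorem bessel_ofSchwartz (μ : ℝ) (f : 𝓢(R3, C4)) :
    bessel μ (ofSchwartz f)
      = ofSchwartz (SchwartzMap.fourierMultiplierCLM C4 (besselSymbol μ) f) :=
  TemperedDistribution.fourierMultiplierCLM_toTemperedDistributionCLM_eq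
    (besselSymbol_hasTemperateGrowth μ) f

theorem mulOp_toLp {a : R3 → ℂ} (ha : a.HasTemperateGrowth) (hb : IsBddMeas a) (f : 𝓢(R3, C4)) :
    mulOp a (f.toLp 2) = (SchwartzMap.smulLeftCLM C4 a f).toLp 2 := by
  apply Lp.ext
  filter_upwards [mulOp_coeFn hb (f.toLp 2), f.coeFn_toLp 2 volume,
    (SchwartzMap.smulLeftCLM C4 a f).coeFn_toLp 2 volume] with x h1 h2 h3
  rw [h1, h2, h3, SchwartzMap.smulLeftCLM_apply_apply ha]

theorem denseRange_toLp : DenseRange (fun f : 𝓢(R3, C4) => (f.toLp 2 : L2)) :=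
  SchwartzMap.denseRange_toLpCLM (p := 2) ENNReal.ofNat_ne_top

/-! ### Weights -/

theorem weight_measurable (t : ℝ) : Measurable (weight t) :=
  (weight_hasTemperateGrowth t).1.continuous.measurable

theorem norm_weight (t : ℝ) (x : R3) : ‖weight t x‖ = (1 + ‖x‖ ^ 2) ^ (t / 2) := by
  rw [weight, Complex.norm_real, Real.norm_of_nonneg (by positivity)]

theorem norm_weight_le_one {t : ℝ} (ht : t ≤ 0) (x : R3) : ‖weight t x‖ ≤ 1 := by
  rw [norm_weight]
  exact Real.rpow_le_one_of_one_le_of_nonpos (by nlinarith [sq_nonneg ‖x‖]) (by linarith)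

theorem weight_isBddMeas {t : ℝ} (ht : t ≤ 0) : IsBddMeas (weight t) :=
  ⟨weight_measurable t, 1, norm_weight_le_one ht⟩

theorem besselSymbol_isBddMeas {t : ℝ} (ht : t ≤ 0) : IsBddMeas (besselSymbol t) :=
  ⟨(besselSymbol_hasTemperateGrowth t).1.continuous.measurable, 1,
    fun _ => norm_weight_le_one ht _⟩

theorem mulWeight_ofL2_of_nonpos {t : ℝ} (ht : t ≤ 0) (f : L2) :
    mulWeight t (ofL2 f) = ofL2 (mulOp (weight t) f) :=
  mulWeight_ofL2 (mulOp_coeFn (weight_isBddMeas ht) f)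

theorem bessel_ofL2_of_nonpos {t : ℝ} (ht : t ≤ 0) (f : L2) :
    bessel t (ofL2 f) = ofL2 (multOp (besselSymbol t) f) :=
  fourierMultiplierCLM_ofL2' (besselSymbol_hasTemperateGrowth t) (besselSymbol_isBddMeas ht) f

/-! ### The weighted Sobolev spaces as copies of `L²` -/

theorem HSob.toDistr_injective {μ s : ℝ} : Function.Injective (HSob.toDistr (μ := μ) (s := s)) :=
  Subtype.val_injective

/-- The element of `H^{μ,s}` with `⟨x⟩ ^ s ⟨D⟩ ^ μ u = f`. -/
def HSob.ofL2Fun (μ s : ℝ) (f : L2) : HSob μ s :=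
  (⟨bessel (-μ) (mulWeight (-s) (ofL2 f)), f, by
    simp [weightedBessel, mulWeight_mulWeight, bessel_bessel, mulWeight_zero, bessel_zero]⟩ :
    weightedSobolev μ s)

theorem HSob.toDistr_ofL2Fun (μ s : ℝ) (f : L2) :
    (HSob.ofL2Fun μ s f).toDistr = bessel (-μ) (mulWeight (-s) (ofL2 f)) := rfl

theorem HSob.toL2_ofL2Fun (μ s : ℝ) (f : L2) : (HSob.ofL2Fun μ s f).toL2 = f := by
  apply ofL2_injective
  rw [HSob.ofL2_toL2, HSob.toDistr_ofL2Fun]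
  simp [weightedBessel, mulWeight_mulWeight, bessel_bessel, mulWeight_zero, bessel_zero]

/-- `H^{μ,s}` is isometric to `L²`. -/
def HSob.equiv (μ s : ℝ) : HSob μ s ≃ₗᵢ[ℂ] L2 where
  toLinearEquiv := LinearEquiv.ofBijective HSob.toL2
    ⟨HSob.toL2_injective, fun f => ⟨_, HSob.toL2_ofL2Fun μ s f⟩⟩
  norm_map' _ := rfl

theorem HSob.equiv_apply {μ s : ℝ} (u : HSob μ s) : HSob.equiv μ s u = u.toL2 := rfl

theorem HSob.equiv_symm_apply {μ s : ℝ} (f : L2) :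
    (HSob.equiv μ s).symm f = HSob.ofL2Fun μ s f := by
  rw [LinearIsometryEquiv.symm_apply_eq]
  exact (HSob.toL2_ofL2Fun μ s f).symm

theorem HSob.toDistr_eq {μ s : ℝ} (u : HSob μ s) :
    u.toDistr = bessel (-μ) (mulWeight (-s) (ofL2 u.toL2)) := by
  rw [← HSob.toDistr_ofL2Fun, ← HSob.equiv_symm_apply, ← HSob.equiv_apply,
    LinearIsometryEquiv.symm_apply_apply]

/-- Needed for passing to the real line: two norm-continuous families whose distributions agree in
the open half plane agree on its closure. -/
theorem HSob.continuous_toDistr (μ s : ℝ) : Continuous (HSob.toDistr (μ := μ) (s := s)) := by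
  have h : (HSob.toDistr : HSob μ s → Distr) = fun u =>
      TemperedDistribution.fourierMultiplierCLM C4 (besselSymbol (-μ))
        (TemperedDistribution.smulLeftCLM C4 (weight (-s))
          (Lp.toTemperedDistributionCLM C4 (volume : Measure R3) 2 (HSob.equiv μ s u))) :=
    funext HSob.toDistr_eq
  rw [h]
  exact (ContinuousLinearMap.continuous _).comp ((ContinuousLinearMap.continuous _).comp
    ((ContinuousLinearMap.continuous _).comp (HSob.equiv μ s).continuous))

/-- The operator `H^{μ,s} → H^{ν,t}` that corresponds to an operator in `L²`. -/
def HSob.conj (μ s ν t : ℝ) (A : L2 →L[ℂ] L2) : HSob μ s →L[ℂ] HSob ν t :=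
  ((HSob.equiv ν t).symm : L2 →L[ℂ] HSob ν t) ∘L A ∘L (HSob.equiv μ s : HSob μ s →L[ℂ] L2)

theorem HSob.toDistr_conj {μ s ν t : ℝ} (A : L2 →L[ℂ] L2) (u : HSob μ s) :
    (HSob.conj μ s ν t A u).toDistr = bessel (-ν) (mulWeight (-t) (ofL2 (A u.toL2))) := by
  rw [← HSob.toDistr_ofL2Fun, ← HSob.equiv_symm_apply]
  rfl

theorem HSob.continuous_conj (μ s ν t : ℝ) : Continuous (HSob.conj μ s ν t) :=
  (ContinuousLinearMap.compL ℂ (HSob μ s) L2 (HSob ν t) _).continuous.comp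
    ((ContinuousLinearMap.compL ℂ (HSob μ s) L2 L2).flip
      (HSob.equiv μ s : HSob μ s →L[ℂ] L2)).continuous

/-- The inverse of the isometry onto L² is ⟨D⟩^{-μ}⟨x⟩^{-s}, which maps Schwartz functions to
Schwartz functions, and these are dense in L². -/
theorem denseRange_schwartzToHSob (μ s : ℝ) : DenseRange (schwartzToHSob μ s) := by
  have h1 : DenseRange (fun f : 𝓢(R3, C4) => (HSob.equiv μ s).symm (f.toLp 2)) :=
    (HSob.equiv μ s).symm.surjective.denseRange.comp denseRange_toLp
      (HSob.equiv μ s).symm.continuous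
  apply h1.mono
  rintro _ ⟨g, rfl⟩
  refine ⟨SchwartzMap.fourierMultiplierCLM C4 (besselSymbol (-μ))
    (SchwartzMap.smulLeftCLM C4 (weight (-s)) g), ?_⟩
  apply HSob.toDistr_injective
  change ofSchwartz _ = HSob.toDistr ((HSob.equiv μ s).symm (g.toLp 2))
  rw [HSob.equiv_symm_apply, HSob.toDistr_ofL2Fun, ofL2_toLp, mulWeight_ofSchwartz,
    bessel_ofSchwartz]

theorem HSob.clm_ext_schwartz {μ s ν t : ℝ} {S T : HSob μ s →L[ℂ] HSob ν t}
    (h : ∀ f : 𝓢(R3, C4), S (schwartzToHSob μ s f) = T (schwartzToHSob μ s f)) : S = T := by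
  apply ContinuousLinearMap.coeFn_injective
  exact (denseRange_schwartzToHSob μ s).equalizer S.continuous T.continuous (funext h)

/-! ### The Fourier transform of the Helmholtz kernel -/

/-- The radial profile `e^{izr} / (4πr)` of the Helmholtz kernel. -/
def helmholtzRadial (z : ℂ) (r : ℝ) : ℂ := Complex.exp (Complex.I * z * r) / (4 * Real.pi * r)

theorem helmholtzRadial_measurable (z : ℂ) : Measurable (helmholtzRadial z) := by
  unfold helmholtzRadial
  fun_prop

theorem norm_exp_I_mul (z : ℂ) (r : ℝ) :
    ‖Complex.exp (Complex.I * z * r)‖ = Real.exp (-(z.im * r)) := by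
  rw [Complex.norm_exp]
  congr 1
  simp

theorem norm_helmholtzRadial (z : ℂ) {r : ℝ} (hr : 0 ≤ r) :
    ‖helmholtzRadial z r‖ = Real.exp (-(z.im * r)) / (4 * Real.pi * r) := by
  rw [helmholtzRadial, norm_div, norm_exp_I_mul]
  congr 1
  simp [abs_of_nonneg hr, abs_of_nonneg Real.pi_pos.le]

/-- In polar coordinates the Jacobian r² absorbs the singularity 1/r and Im z > 0 gives exponential
decay. The space is a general three-dimensional one because both ℝ³ and ℂ × ℝ are used. -/
theorem integrable_helmholtzRadial_norm {E : Type*} [NormedAddCommGroup E] [NormedSpace ℝ E]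
    [MeasurableSpace E] [BorelSpace E] [FiniteDimensional ℝ E] (μ : Measure E)
    [μ.IsAddHaarMeasure] (hE : Module.finrank ℝ E = 3) {z : ℂ} (hz : 0 < z.im) :
    Integrable (fun x : E => helmholtzRadial z ‖x‖) μ := by
  have : Nontrivial E := Module.nontrivial_of_finrank_pos (R := ℝ) (by omega)
  rw [integrable_fun_norm_addHaar μ (f := helmholtzRadial z), hE]
  have h1 : IntegrableOn (fun r : ℝ => r * Real.exp (-z.im * r)) (Set.Ioi 0) := by
    have := integrableOn_rpow_mul_exp_neg_mul_rpow (p := 1) (s := 1) (by norm_num) (by norm_num) hz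
    simpa using this
  refine (h1.const_mul (1 / (4 * Real.pi))).mono'
    (((measurable_id.pow_const 2).smul (helmholtzRadial_measurable z)).aestronglyMeasurable) ?_
  refine (ae_restrict_iff' measurableSet_Ioi).2 (.of_forall fun r (hr : 0 < r) => ?_)
  rw [norm_smul, norm_helmholtzRadial z hr.le, Real.norm_of_nonneg (by positivity)]
  apply le_of_eq
  have := Real.pi_pos
  field_simp

theorem hasDerivAt_sqrt_sq_add {t : ℝ} (ht : t ≠ 0) (r : ℝ) :
    HasDerivAt (fun r : ℝ => √(r ^ 2 + t ^ 2)) (r / √(r ^ 2 + t ^ 2)) r := by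
  have h := ((hasDerivAt_pow 2 r).add_const (t ^ 2)).sqrt (by positivity)
  convert h using 1
  push_cast
  field_simp

/-- In polar coordinates of the plane the integrand is an exact derivative: with ρ = √(r²+t²), the
primitive of r e^{izρ}/(4πρ) is e^{izρ}/(4πiz). It vanishes at infinity because Im z > 0. -/
theorem integral_helmholtzRadial_plane {z : ℂ} (hz : 0 < z.im) {t : ℝ} (ht : t ≠ 0) :
    ∫ w : ℂ, helmholtzRadial z √(‖w‖ ^ 2 + t ^ 2)
      = Complex.I / (2 * z) * Complex.exp (Complex.I * z * |t|) := by
  have hz0 : z ≠ 0 := by rintro rfl; simp at hz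
  have hπ := Real.pi_pos
  rw [integral_fun_norm_addHaar volume (fun r => helmholtzRadial z √(r ^ 2 + t ^ 2))]
  have hderiv : ∀ r : ℝ, HasDerivAt
      (fun r : ℝ => Complex.exp (Complex.I * z * (√(r ^ 2 + t ^ 2) : ℝ))
        / (4 * Real.pi * (Complex.I * z)))
      ((r : ℂ) * helmholtzRadial z √(r ^ 2 + t ^ 2)) r := by
    intro r
    have h1 := ((hasDerivAt_sqrt_sq_add ht r).ofReal_comp.const_mul (Complex.I * z)).cexp.div_const
      (4 * Real.pi * (Complex.I * z))
    refine h1.congr_deriv ?_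
    have h2 : ((√(r ^ 2 + t ^ 2) : ℝ) : ℂ) ≠ 0 := by
      rw [Complex.ofReal_ne_zero]
      positivity
    have h3 : (Real.pi : ℂ) ≠ 0 := Complex.ofReal_ne_zero.2 hπ.ne'
    rw [helmholtzRadial]
    push_cast
    field_simp
  have hbig : ∀ r : ℝ, 0 ≤ r → r ≤ √(r ^ 2 + t ^ 2) := fun r hr => by
    apply Real.le_sqrt_of_sq_le
    nlinarith [sq_nonneg t]
  have hint : IntegrableOn (fun r : ℝ => (r : ℂ) * helmholtzRadial z √(r ^ 2 + t ^ 2))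
      (Set.Ioi 0) := by
    have h1 : IntegrableOn (fun r : ℝ => Real.exp (-z.im * r)) (Set.Ioi 0) :=
      integrableOn_exp_mul_Ioi (by linarith) 0
    refine (h1.const_mul (1 / (4 * Real.pi))).mono'
      ((Complex.measurable_ofReal.mul ((helmholtzRadial_measurable z).comp
        (by fun_prop))).aestronglyMeasurable) ?_
    refine (ae_restrict_iff' measurableSet_Ioi).2 (.of_forall fun r (hr : 0 < r) => ?_)
    have h2 : 0 < √(r ^ 2 + t ^ 2) := by positivity
    have h3 := hbig r hr.le
    rw [norm_mul, norm_helmholtzRadial z h2.le, Complex.norm_real, Real.norm_of_nonneg hr.le]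
    have h4 : Real.exp (-(z.im * √(r ^ 2 + t ^ 2))) ≤ Real.exp (-z.im * r) := by
      apply Real.exp_le_exp.2
      nlinarith
    calc r * (Real.exp (-(z.im * √(r ^ 2 + t ^ 2))) / (4 * Real.pi * √(r ^ 2 + t ^ 2)))
        = (r / √(r ^ 2 + t ^ 2)) * (1 / (4 * Real.pi)
          * Real.exp (-(z.im * √(r ^ 2 + t ^ 2)))) := by field_simp
      _ ≤ 1 * (1 / (4 * Real.pi) * Real.exp (-z.im * r)) := by
          gcongr
          exact (div_le_one h2).2 h3
      _ = _ := one_mul _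
  have hlim : Tendsto (fun r : ℝ => Complex.exp (Complex.I * z * (√(r ^ 2 + t ^ 2) : ℝ))
        / (4 * Real.pi * (Complex.I * z))) atTop (𝓝 0) := by
    have h0 : Tendsto (fun r : ℝ => Complex.exp (Complex.I * z * (√(r ^ 2 + t ^ 2) : ℝ)))
        atTop (𝓝 0) := by
      rw [tendsto_zero_iff_norm_tendsto_zero]
      simp_rw [norm_exp_I_mul]
      apply Real.tendsto_exp_neg_atTop_nhds_zero.comp
      apply Tendsto.const_mul_atTop hz
      exact tendsto_atTop_mono' _ (eventually_ge_atTop 0 |>.mono hbig) tendsto_id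
    simpa using h0.div_const (4 * Real.pi * (Complex.I * z))
  have key := integral_Ioi_of_hasDerivAt_of_tendsto' (a := 0) (fun r _ => hderiv r) hint hlim
  have h5 : ∫ y in Set.Ioi (0 : ℝ), y ^ (Module.finrank ℝ ℂ - 1) •
      helmholtzRadial z √(y ^ 2 + t ^ 2)
      = ∫ r in Set.Ioi (0 : ℝ), (r : ℂ) * helmholtzRadial z √(r ^ 2 + t ^ 2) := by
    simp only [Complex.finrank_real_complex, Nat.add_one_sub_one, pow_one, Complex.real_smul]
  rw [h5, key, Measure.real, Complex.volume_ball]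
  simp only [Complex.finrank_real_complex, ENNReal.ofReal_one, one_pow, one_mul,
    ENNReal.coe_toReal, NNReal.coe_real_pi, zero_sub]
  have h3 : (Real.pi : ℂ) ≠ 0 := Complex.ofReal_ne_zero.2 hπ.ne'
  have h6 : √((0 : ℝ) ^ 2 + t ^ 2) = |t| := by rw [zero_pow two_ne_zero, zero_add, Real.sqrt_sq_eq_abs]
  rw [h6, nsmul_eq_mul, Complex.real_smul]
  field_simp
  push_cast
  rw [Complex.I_sq]
  ring

/-- Each half line carries a pure exponential, with exponents a and b. The two integrals add up by
partial fractions, where -ab = (2πρ)² - z². -/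
theorem integral_exp_mul_exp_abs {z : ℂ} (hz : 0 < z.im) (ρ : ℝ) :
    ∫ t : ℝ, Complex.exp ((-2 * Real.pi * (t * ρ) : ℝ) * Complex.I) *
      (Complex.I / (2 * z) * Complex.exp (Complex.I * z * |t|))
      = 1 / (((2 * Real.pi * ρ) ^ 2 : ℝ) - z ^ 2) := by
  have hz0 : z ≠ 0 := by rintro rfl; simp at hz
  set a : ℂ := Complex.I * z - 2 * Real.pi * ρ * Complex.I with ha
  set b : ℂ := -(Complex.I * z) - 2 * Real.pi * ρ * Complex.I with hb
  have har : a.re < 0 := by simp [ha]; exact hz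
  have hbr : 0 < b.re := by simp [hb]; exact hz
  have ha0 : a ≠ 0 := fun h => by simp [h] at har
  have hb0 : b ≠ 0 := fun h => by simp [h] at hbr
  have e1 : ∀ t ∈ Set.Ioi (0 : ℝ), Complex.exp ((-2 * Real.pi * (t * ρ) : ℝ) * Complex.I) *
      (Complex.I / (2 * z) * Complex.exp (Complex.I * z * |t|))
      = Complex.I / (2 * z) * Complex.exp (a * t) := by
    intro t (ht : 0 < t)
    rw [abs_of_pos ht, mul_left_comm, ← Complex.exp_add]
    congr 2
    push_cast [ha]
    ring
  have e2 : ∀ t ∈ Set.Iic (0 : ℝ), Complex.exp ((-2 * Real.pi * (t * ρ) : ℝ) * Complex.I) *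
      (Complex.I / (2 * z) * Complex.exp (Complex.I * z * |t|))
      = Complex.I / (2 * z) * Complex.exp (b * t) := by
    intro t (ht : t ≤ 0)
    rw [abs_of_nonpos ht, mul_left_comm, ← Complex.exp_add]
    congr 2
    push_cast [hb]
    ring
  have i1 := (integrableOn_exp_mul_complex_Ioi har 0).const_mul (Complex.I / (2 * z))
  have i2 := (integrableOn_exp_mul_complex_Iic hbr 0).const_mul (Complex.I / (2 * z))
  rw [← integral_add_compl (measurableSet_Iic (a := (0 : ℝ))), Set.compl_Iic,
    setIntegral_congr_fun measurableSet_Ioi e1, setIntegral_congr_fun measurableSet_Iic e2,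
    integral_const_mul, integral_const_mul, integral_exp_mul_complex_Ioi har,
    integral_exp_mul_complex_Iic hbr]
  · have h1 : (((2 * Real.pi * ρ) ^ 2 : ℝ) - z ^ 2 : ℂ) = - (a * b) := by
      push_cast [ha, hb]
      ring_nf
      rw [Complex.I_sq]
      ring
    rw [h1]
    simp only [Complex.ofReal_zero, mul_zero, Complex.exp_zero]
    have h2 : a - b = 2 * z * Complex.I := by rw [ha, hb]; ring
    have h3 : a = b + 2 * z * Complex.I := by rw [← h2]; ring
    field_simp
    rw [h3]
    ring_nf
    rw [Complex.I_sq]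
    ring
  · rw [← integrableOn_univ, ← Set.Iic_union_Ioi (a := (0 : ℝ))]
    exact (IntegrableOn.congr_fun i2 (fun t ht => (e2 t ht).symm) measurableSet_Iic).union
      (IntegrableOn.congr_fun i1 (fun t ht => (e1 t ht).symm) measurableSet_Ioi)

/-- For a frequency on the real axis of ℂ × ℝ the phase depends on t alone, so Fubini reduces the
transform to the plane integral followed by a one-dimensional Fourier integral. -/
theorem fourier_helmholtzRadial_axis {z : ℂ} (hz : 0 < z.im) (ρ : ℝ) :
    𝓕 (fun x : WithLp 2 (ℂ × ℝ) => helmholtzRadial z ‖x‖) (WithLp.toLp 2 (0, ρ))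
      = 1 / (((2 * Real.pi * ρ) ^ 2 : ℝ) - z ^ 2) := by
  have hdim : Module.finrank ℝ (WithLp 2 (ℂ × ℝ)) = 3 := by
    rw [LinearEquiv.finrank_eq (WithLp.linearEquiv 2 ℝ (ℂ × ℝ))]
    simp
  have hnorm : ∀ q : ℂ × ℝ, ‖(WithLp.toLp 2 q : WithLp 2 (ℂ × ℝ))‖ = √(‖q.1‖ ^ 2 + q.2 ^ 2) := by
    intro q
    rw [← Real.sqrt_sq (norm_nonneg (WithLp.toLp 2 q : WithLp 2 (ℂ × ℝ))),
      WithLp.prod_norm_sq_eq_of_L2]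
    simp
  have hmp := WithLp.volume_preserving_toLp ℂ ℝ
  have hme : MeasurableEmbedding (WithLp.toLp 2 : ℂ × ℝ → WithLp 2 (ℂ × ℝ)) :=
    (MeasurableEquiv.toLp 2 (ℂ × ℝ)).measurableEmbedding
  have hi := integrable_helmholtzRadial_norm (E := WithLp 2 (ℂ × ℝ)) volume hdim hz
  have hF : Integrable (fun x : WithLp 2 (ℂ × ℝ) =>
      Complex.exp ((-2 * Real.pi * inner ℝ x (WithLp.toLp 2 ((0 : ℂ), ρ)) : ℝ) * Complex.I) •
        helmholtzRadial z ‖x‖) := by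
    refine hi.bdd_smul (φ := fun x : WithLp 2 (ℂ × ℝ) =>
      Complex.exp ((-2 * Real.pi * inner ℝ x (WithLp.toLp 2 ((0 : ℂ), ρ)) : ℝ) * Complex.I)) 1
      (Continuous.aestronglyMeasurable (by fun_prop)) (.of_forall fun x => ?_)
    rw [Complex.norm_exp_ofReal_mul_I]
  rw [Real.fourier_eq', ← hmp.integral_comp hme]
  have hF' := (hmp.integrable_comp_emb hme).2 hF
  simp only [Function.comp_def] at hF'
  rw [Measure.volume_eq_prod] at hF' ⊢
  rw [integral_prod_symm _ hF', ← integral_exp_mul_exp_abs hz ρ]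
  apply integral_congr_ae
  -- The plane t = 0 contains the singularity and is discarded as a null set.
  have h0 : ∀ᵐ t : ℝ, t ≠ 0 := by
    rw [ae_iff]
    simp
  filter_upwards [h0] with t ht
  rw [← integral_helmholtzRadial_plane hz ht, ← integral_const_mul]
  congr 1
  ext w
  rw [hnorm, WithLp.prod_inner_apply]
  simp [mul_comm]

/-- A radial function has a radial Fourier transform, so ξ may be moved to the axis, where the
transform is known. -/
theorem fourier_helmholtzRadial {z : ℂ} (hz : 0 < z.im) (ξ : R3) :
    𝓕 (fun x : R3 => helmholtzRadial z ‖x‖) ξ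
      = 1 / ((‖(2 * Real.pi) • ξ‖ ^ 2 : ℝ) - z ^ 2) := by
  have hdim : Module.finrank ℝ (WithLp 2 (ℂ × ℝ)) = 3 := by
    rw [LinearEquiv.finrank_eq (WithLp.linearEquiv 2 ℝ (ℂ × ℝ))]
    simp
  obtain ⟨A⟩ : Nonempty (WithLp 2 (ℂ × ℝ) ≃ₗᵢ[ℝ] R3) :=
    ⟨((stdOrthonormalBasis ℝ (WithLp 2 (ℂ × ℝ))).reindex (finCongr hdim)).repr⟩
  set v : WithLp 2 (ℂ × ℝ) := WithLp.toLp 2 (0, ‖ξ‖) with hv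
  have hvn : ‖v‖ = ‖A.symm ξ‖ := by
    rw [LinearIsometryEquiv.norm_map, ← sq_eq_sq₀ (norm_nonneg _) (norm_nonneg _),
      WithLp.prod_norm_sq_eq_of_L2]
    simp [hv]
  -- Vectors of equal norm are exchanged by the reflection in the hyperplane orthogonal to their
  -- difference.
  set B : WithLp 2 (ℂ × ℝ) ≃ₗᵢ[ℝ] R3 :=
    (Submodule.reflection (ℝ ∙ (v - A.symm ξ))ᗮ).trans A with hB
  have hBv : B v = ξ := by
    rw [hB, LinearIsometryEquiv.trans_apply, Submodule.reflection_sub hvn,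
      LinearIsometryEquiv.apply_symm_apply]
  have h1 := Real.fourier_comp_linearIsometry B (fun x : R3 => helmholtzRadial z ‖x‖) v
  rw [hBv] at h1
  rw [← h1]
  have h2 : (fun x : R3 => helmholtzRadial z ‖x‖) ∘ B
      = fun x : WithLp 2 (ℂ × ℝ) => helmholtzRadial z ‖x‖ := by
    ext x
    simp
  rw [h2, hv, fourier_helmholtzRadial_axis hz, norm_smul,
    Real.norm_of_nonneg (by positivity : 0 ≤ 2 * Real.pi)]

/-! ### Convolution operators -/

theorem fourier_isBddMeas {G : R3 → ℂ} (hG : Integrable G) : IsBddMeas (𝓕 G) := by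
  refine ⟨Continuous.measurable ?_, ∫ x, ‖G x‖, fun ξ => ?_⟩
  · exact VectorFourier.fourierIntegral_continuous Real.continuous_fourierChar
      (by exact continuous_inner) hG
  · exact VectorFourier.norm_fourierIntegral_le_integral_norm _ _ _ _ _

theorem integral_fourier_smul_eq_of_integrable (φ : 𝓢(R3, ℂ)) {u : R3 → C4} (hu : Integrable u) :
    ∫ x, 𝓕 φ x • u x = ∫ ξ, φ ξ • 𝓕 u ξ := by
  have := VectorFourier.integral_fourierIntegral_smul_eq_flip (L := innerₗ R3)
    Real.continuous_fourierChar continuous_inner (φ.integrable (μ := volume)) hu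
  rw [flip_innerₗ] at this
  exact this

/-- Compactly supported smooth functions are Schwartz functions, and they already separate locally
integrable functions up to null sets. -/
theorem ae_eq_of_ofL2_apply {f : L2} {u : R3 → C4} (hu : LocallyIntegrable u)
    (h : ∀ φ : 𝓢(R3, ℂ), ofL2 f φ = ∫ x, φ x • u x) : f =ᵐ[volume] u := by
  apply ae_eq_of_integral_contDiff_smul_eq ((Lp.memLp f).locallyIntegrable (by norm_num)) hu
  intro g hg hgs
  have hg1 := Complex.ofRealCLM.contDiff.comp hg
  have hg2 : HasCompactSupport (Complex.ofRealCLM ∘ g) := hgs.comp_left Complex.ofReal_zero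
  have := h (hg2.toSchwartzMap hg1)
  rw [ofL2_apply] at this
  exact this

/-- The Fourier multiplier with symbol `𝓕 G`, `G` integrable, is the convolution with `G`. -/
theorem multOp_fourier_toLp {G : R3 → ℂ} (hG : Integrable G) (f : 𝓢(R3, C4)) :
    multOp (𝓕 G) (f.toLp 2) =ᵐ[volume] fun x => ∫ y, G (x - y) • f y := by
  set u : R3 → C4 := fun x => ∫ y, G (x - y) • f y with hu
  have hconv : convolution G f (ContinuousLinearMap.lsmul ℂ ℂ) volume = u := by
    ext1 x
    rw [convolution_eq_swap]
    rfl
  have hui : Integrable u := by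
    rw [← hconv]
    exact hG.integrable_convolution _ f.integrable
  have hFu : ∀ ξ, 𝓕 u ξ = 𝓕 G ξ • 𝓕 f ξ := by
    intro ξ
    rw [← hconv, Real.fourier_smul_convolution_eq hG f.integrable, SchwartzMap.fourier_coe]
  have hb := fourier_isBddMeas hG
  have hdist : ∀ φ : 𝓢(R3, ℂ), ofL2 (multOp (𝓕 G) (f.toLp 2)) φ = ∫ x, φ x • u x := by
    intro φ
    -- Testing against a Fourier transform moves 𝓕 to the other factor, where it turns the
    -- convolution into a product.
    obtain ⟨ψ, rfl⟩ : ∃ ψ : 𝓢(R3, ℂ), 𝓕 ψ = φ := ⟨𝓕⁻ φ, FourierTransform.fourier_fourierInv_eq φ⟩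
    have h1 : ofL2 (multOp (𝓕 G) (f.toLp 2)) (𝓕 ψ) = ofL2 (mulOp (𝓕 G) (𝓕 (f.toLp 2))) ψ := by
      rw [← fourier_multOp]
      exact congrArg (fun T : Distr => T ψ) (Lp.fourier_toTemperedDistribution_eq _)
    rw [h1, ofL2_apply, integral_fourier_smul_eq_of_integrable ψ hui, SchwartzMap.toLp_fourier_eq]
    apply integral_congr_ae
    filter_upwards [mulOp_coeFn hb ((𝓕 f).toLp 2), (𝓕 f).coeFn_toLp 2 volume] with ξ h2 h3
    rw [h2, h3, hFu]
  exact ae_eq_of_ofL2_apply hui.locallyIntegrable hdist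

/-! ### Cauchy–Schwarz, Young and Peetre inequalities -/

theorem lintegral_mul_sq_le {α : Type*} [MeasurableSpace α] {μ : Measure α} {f g : α → ℝ≥0∞}
    (hf : AEMeasurable f μ) (hg : AEMeasurable g μ) :
    (∫⁻ a, f a * g a ∂μ) ^ 2 ≤ (∫⁻ a, f a ^ 2 ∂μ) * ∫⁻ a, g a ^ 2 ∂μ := by
  have h := ENNReal.lintegral_mul_le_Lp_mul_Lq μ Real.HolderConjugate.two_two hf hg
  simp only [Pi.mul_apply, ENNReal.rpow_ofNat] at h
  calc (∫⁻ a, f a * g a ∂μ) ^ 2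
      ≤ ((∫⁻ a, f a ^ 2 ∂μ) ^ (1 / 2 : ℝ) * (∫⁻ a, g a ^ 2 ∂μ) ^ (1 / 2 : ℝ)) ^ 2 := by gcongr
    _ = _ := by
      rw [mul_pow, ← ENNReal.rpow_natCast, ← ENNReal.rpow_natCast, ← ENNReal.rpow_mul,
        ← ENNReal.rpow_mul]
      norm_num

/-- Young's inequality `L¹ * L² ⊆ L²`. -/
theorem lintegral_convolution_sq_le {κ g : R3 → ℝ≥0∞} (hκ : Measurable κ) (hg : Measurable g) :
    ∫⁻ x, (∫⁻ y, κ (x - y) * g y) ^ 2 ≤ (∫⁻ x, κ x) ^ 2 * ∫⁻ y, g y ^ 2 := by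
  have h1 : ∀ x, (∫⁻ y, κ (x - y) * g y) ^ 2 ≤ (∫⁻ y, κ y) * ∫⁻ y, κ (x - y) * g y ^ 2 := by
    intro x
    have hm : Measurable (fun y => κ (x - y)) := hκ.comp (measurable_const.sub measurable_id)
    have hs : ∀ a : ℝ≥0∞, (a ^ (1 / 2 : ℝ)) ^ 2 = a := fun a => by
      rw [← ENNReal.rpow_natCast, ← ENNReal.rpow_mul]
      norm_num
    -- Splitting κ = √κ · √κ in Cauchy–Schwarz leaves one factor ∫κ and keeps κ to the first power.
    have h := lintegral_mul_sq_le (μ := (volume : Measure R3))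
      (f := fun y => κ (x - y) ^ (1 / 2 : ℝ)) (g := fun y => κ (x - y) ^ (1 / 2 : ℝ) * g y)
      (hm.pow_const _).aemeasurable ((hm.pow_const _).mul hg).aemeasurable
    simp only [← mul_assoc, ← sq, mul_pow, hs] at h
    rwa [lintegral_sub_left_eq_self κ x] at h
  have hm2 : Measurable (fun q : R3 × R3 => κ (q.1 - q.2) * g q.2 ^ 2) :=
    (hκ.comp (measurable_fst.sub measurable_snd)).mul ((hg.comp measurable_snd).pow_const 2)
  calc ∫⁻ x, (∫⁻ y, κ (x - y) * g y) ^ 2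
      ≤ ∫⁻ x, (∫⁻ y, κ y) * ∫⁻ y, κ (x - y) * g y ^ 2 := lintegral_mono h1
    _ = (∫⁻ y, κ y) * ∫⁻ x, ∫⁻ y, κ (x - y) * g y ^ 2 :=
        lintegral_const_mul _ hm2.lintegral_prod_right'
    _ = (∫⁻ y, κ y) * ∫⁻ y, ∫⁻ x, κ (x - y) * g y ^ 2 := by
        rw [lintegral_lintegral_swap hm2.aemeasurable]
    _ = (∫⁻ y, κ y) * ∫⁻ y, (∫⁻ x, κ x) * g y ^ 2 := by
        congr 2
        ext y
        rw [lintegral_mul_const _ (show Measurable fun x => κ (x - y) from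
            hκ.comp (measurable_id.sub_const y)),
          lintegral_sub_right_eq_self κ y]
    _ = _ := by
        rw [lintegral_const_mul _ (hg.pow_const 2), ← mul_assoc, sq]

theorem enorm_sq_eq_lintegral (f : L2) : ‖f‖ₑ ^ 2 = ∫⁻ x, ‖f x‖ₑ ^ 2 := by
  rw [Lp.enorm_def, eLpNorm_eq_lintegral_rpow_enorm_toReal (by norm_num) (by norm_num)]
  simp only [ENNReal.toReal_ofNat, ENNReal.rpow_ofNat]
  rw [← ENNReal.rpow_natCast, ← ENNReal.rpow_mul]
  norm_num

/-- Peetre's inequality. -/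
theorem norm_weight_neg_le {t : ℝ} (ht : 0 ≤ t) (x y : R3) :
    ‖weight (-t) x‖ ≤ 2 ^ (t / 2) * ‖weight t (x - y)‖ * ‖weight (-t) y‖ := by
  simp only [norm_weight, neg_div]
  rw [Real.rpow_neg (by positivity), Real.rpow_neg (by positivity),
    ← div_eq_mul_inv, le_div_iff₀ (by positivity), inv_mul_le_iff₀ (by positivity),
    ← Real.mul_rpow (by positivity) (by positivity), ← Real.mul_rpow (by positivity) (by positivity)]
  -- What remains is 1 + |y|² ≤ 2(1 + |x|²)(1 + |x-y|²), raised to the power t/2.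
  apply Real.rpow_le_rpow (by positivity) _ (by linarith)
  have h1 : ‖y‖ ≤ ‖x‖ + ‖x - y‖ := by
    have := norm_sub_norm_le y x
    rw [norm_sub_rev] at this
    linarith
  have h2 : ‖y‖ ^ 2 ≤ (‖x‖ + ‖x - y‖) ^ 2 := by gcongr
  nlinarith [sq_nonneg (‖x‖ - ‖x - y‖), mul_nonneg (sq_nonneg ‖x‖) (sq_nonneg ‖x - y‖)]

/-- A Fourier multiplier with a Schwartz symbol is bounded in the weighted space `L^{2,-t}`. -/
theorem exists_norm_mulOp_weight_multOp_le (χ : 𝓢(R3, ℂ)) {t : ℝ} (ht : 0 ≤ t) :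
    ∃ C : ℝ, 0 ≤ C ∧ ∀ f : L2, ‖mulOp (weight (-t)) (multOp χ f)‖
      ≤ C * ‖mulOp (weight (-t)) f‖ := by
  have hw := weight_isBddMeas (t := -t) (by linarith)
  set k : 𝓢(R3, ℂ) := 𝓕⁻ χ with hk
  have hkχ : 𝓕 (k : R3 → ℂ) = χ := by
    rw [← SchwartzMap.fourier_coe, hk, FourierTransform.fourier_fourierInv_eq]
  -- By Peetre's inequality the weight at x is paid by a weight at y and a factor ⟨x-y⟩^t. The
  -- latter is absorbed into the convolution kernel, which stays integrable because k is Schwartz.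
  set κ : R3 → ℝ≥0∞ := fun x =>
    ENNReal.ofReal (2 ^ (t / 2)) * ‖SchwartzMap.smulLeftCLM ℂ (weight t) k x‖ₑ with hκ
  have hκm : Measurable κ :=
    ((SchwartzMap.smulLeftCLM ℂ (weight t) k).continuous.measurable.enorm).const_mul _
  have hκi : ∫⁻ x, κ x ≠ ∞ := by
    rw [hκ, lintegral_const_mul _
      (SchwartzMap.smulLeftCLM ℂ (weight t) k).continuous.measurable.enorm]
    exact ENNReal.mul_ne_top ENNReal.ofReal_ne_top
      (SchwartzMap.smulLeftCLM ℂ (weight t) k).integrable.2.ne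
  refine ⟨(∫⁻ x, κ x).toReal, ENNReal.toReal_nonneg, fun f => ?_⟩
  refine denseRange_toLp.induction_on (p := fun f : L2 => ‖mulOp (weight (-t)) (multOp χ f)‖
      ≤ (∫⁻ x, κ x).toReal * ‖mulOp (weight (-t)) f‖) f ?_ ?_
  · exact isClosed_le ((mulOp _).continuous.comp (multOp _).continuous).norm
      (continuous_const.mul (mulOp _).continuous.norm)
  intro f
  have h1 : ‖mulOp (weight (-t)) (multOp χ (f.toLp 2 volume : L2))‖ₑ ^ 2
      ≤ ((∫⁻ x, κ x) * ‖mulOp (weight (-t)) (f.toLp 2 volume : L2)‖ₑ) ^ 2 := by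
    rw [mul_pow, enorm_sq_eq_lintegral (mulOp (weight (-t)) (multOp χ (f.toLp 2 volume : L2))),
      enorm_sq_eq_lintegral (mulOp (weight (-t)) (f.toLp 2 volume : L2))]
    have h2 : ∫⁻ x, ‖mulOp (weight (-t)) (f.toLp 2 volume : L2) x‖ₑ ^ 2
        = ∫⁻ x, (‖weight (-t) x‖ₑ * ‖f x‖ₑ) ^ 2 := by
      apply lintegral_congr_ae
      filter_upwards [mulOp_coeFn hw (f.toLp 2 volume : L2), f.coeFn_toLp 2 volume] with x h3 h4
      rw [h3, h4, enorm_smul]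
    rw [h2]
    refine le_trans ?_ (lintegral_convolution_sq_le hκm
      ((weight_measurable (-t)).enorm.mul f.continuous.measurable.enorm))
    apply lintegral_mono_ae
    have h5 := multOp_fourier_toLp k.integrable f
    rw [hkχ] at h5
    filter_upwards [mulOp_coeFn hw (multOp χ (f.toLp 2 volume : L2)), h5] with x h6 h7
    rw [h6, h7, enorm_smul]
    gcongr
    calc ‖weight (-t) x‖ₑ * ‖∫ y, k (x - y) • f y‖ₑ
        ≤ ‖weight (-t) x‖ₑ * ∫⁻ y, ‖k (x - y) • f y‖ₑ := by
          gcongr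
          exact enorm_integral_le_lintegral_enorm _
      _ = ∫⁻ y, ‖weight (-t) x‖ₑ * ‖k (x - y) • f y‖ₑ := by
          rw [lintegral_const_mul' _ _ enorm_ne_top]
      _ ≤ _ := by
          apply lintegral_mono
          intro y
          simp only [hκ, SchwartzMap.smulLeftCLM_apply_apply (weight_hasTemperateGrowth t),
            ← ofReal_norm, ← ENNReal.ofReal_mul (norm_nonneg _)]
          rw [← ENNReal.ofReal_mul (by positivity), ← ENNReal.ofReal_mul (by positivity)]
          apply ENNReal.ofReal_le_ofReal
          rw [norm_smul, norm_smul]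
          have := norm_weight_neg_le ht x y
          calc ‖weight (-t) x‖ * (‖k (x - y)‖ * ‖f y‖)
              ≤ (2 ^ (t / 2) * ‖weight t (x - y)‖ * ‖weight (-t) y‖) * (‖k (x - y)‖ * ‖f y‖) := by
                gcongr
            _ = _ := by ring
  have h8 := (ENNReal.pow_le_pow_left_iff two_ne_zero).1 h1
  have h9 := ENNReal.toReal_mono (ENNReal.mul_ne_top hκi enorm_ne_top) h8
  simpa [ENNReal.toReal_mul] using h9

/-! ### Hilbert–Schmidt bounds -/

/-- The operator `⟨x⟩^{-s'} b(D) ⟨x⟩^{-s}` on `L²`. -/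
def weightedMult (s s' : ℝ) (b : R3 → ℂ) : L2 →L[ℂ] L2 :=
  mulOp (weight (-s')) ∘L multOp b ∘L mulOp (weight (-s))

/-- The square of the Hilbert–Schmidt norm of the kernel `⟨x⟩^{-s'} G(x-y) ⟨y⟩^{-s}`. -/
def hilbertSchmidt (s s' : ℝ) (G : R3 → ℂ) : ℝ≥0∞ :=
  ∫⁻ q : R3 × R3, (‖weight (-s') q.1‖ₑ * (‖G (q.1 - q.2)‖ₑ * ‖weight (-s) q.2‖ₑ)) ^ 2
    ∂((volume : Measure R3).prod volume)

/-- Cauchy–Schwarz in y for each fixed x, then integration in x. Schwartz h suffices and makes the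
convolution formula available. -/
theorem enorm_weightedMult_toLp_sq_le {s s' : ℝ} (hs : 0 ≤ s) (hs' : 0 ≤ s') {G : R3 → ℂ}
    (hG : Integrable G) (hGm : Measurable G) (h : 𝓢(R3, C4)) :
    ‖weightedMult s s' (𝓕 G) (h.toLp 2 volume : L2)‖ₑ ^ 2
      ≤ hilbertSchmidt s s' G * ‖(h.toLp 2 volume : L2)‖ₑ ^ 2 := by
  have hw := weight_isBddMeas (t := -s) (by linarith)
  have hw' := weight_isBddMeas (t := -s') (by linarith)
  set f : 𝓢(R3, C4) := SchwartzMap.smulLeftCLM C4 (weight (-s)) h with hf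
  have e1 : weightedMult s s' (𝓕 G) (h.toLp 2 volume : L2)
      = mulOp (weight (-s')) (multOp (𝓕 G) (f.toLp 2 volume : L2)) := by
    rw [hf, ← mulOp_toLp (weight_hasTemperateGrowth _) hw]
    rfl
  have hm : Measurable (fun q : R3 × R3 =>
      ‖weight (-s') q.1‖ₑ * (‖G (q.1 - q.2)‖ₑ * ‖weight (-s) q.2‖ₑ)) := by
    have := weight_measurable (-s)
    have := weight_measurable (-s')
    fun_prop
  rw [e1, enorm_sq_eq_lintegral (mulOp (weight (-s')) (multOp (𝓕 G) (f.toLp 2 volume : L2))),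
    enorm_sq_eq_lintegral (h.toLp 2 volume : L2), hilbertSchmidt,
    lintegral_prod _ (hm.pow_const 2).aemeasurable,
    ← lintegral_mul_const _ (hm.pow_const 2).lintegral_prod_right']
  apply lintegral_mono_ae
  filter_upwards [mulOp_coeFn hw' (multOp (𝓕 G) (f.toLp 2 volume : L2)),
    multOp_fourier_toLp hG f] with x h1 h2
  have h3 : ∫⁻ y, ‖(h.toLp 2 volume : L2) y‖ₑ ^ 2 = ∫⁻ y, ‖h y‖ₑ ^ 2 := by
    apply lintegral_congr_ae
    filter_upwards [h.coeFn_toLp 2 volume] with y hy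
    rw [hy]
  rw [h3]
  refine le_trans ?_ (lintegral_mul_sq_le (hm.comp measurable_prodMk_left).aemeasurable
    h.continuous.measurable.enorm.aemeasurable)
  rw [h1, h2, enorm_smul]
  gcongr
  calc ‖weight (-s') x‖ₑ * ‖∫ y, G (x - y) • f y‖ₑ
      ≤ ‖weight (-s') x‖ₑ * ∫⁻ y, ‖G (x - y) • f y‖ₑ := by
        gcongr
        exact enorm_integral_le_lintegral_enorm _
    _ = ∫⁻ y, ‖weight (-s') x‖ₑ * ‖G (x - y) • f y‖ₑ := by
        rw [lintegral_const_mul' _ _ enorm_ne_top]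
    _ = _ := by
        congr 1
        ext y
        rw [hf, SchwartzMap.smulLeftCLM_apply_apply (weight_hasTemperateGrowth (-s)), enorm_smul,
          enorm_smul]
        simp only [mul_assoc]

theorem norm_weightedMult_le_hilbertSchmidt {s s' : ℝ} (hs : 0 ≤ s) (hs' : 0 ≤ s') {G : R3 → ℂ}
    (hG : Integrable G) (hGm : Measurable G) (hfin : hilbertSchmidt s s' G ≠ ∞) :
    ‖weightedMult s s' (𝓕 G)‖ ≤ √(hilbertSchmidt s s' G).toReal := by
  refine ContinuousLinearMap.opNorm_le_bound _ (Real.sqrt_nonneg _) fun f => ?_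
  refine denseRange_toLp.induction_on (p := fun f : L2 => ‖weightedMult s s' (𝓕 G) f‖
      ≤ √(hilbertSchmidt s s' G).toReal * ‖f‖) f ?_ ?_
  · exact isClosed_le (weightedMult s s' (𝓕 G)).continuous.norm
      (continuous_const.mul continuous_norm)
  intro h
  have h1 := ENNReal.toReal_mono (ENNReal.mul_ne_top hfin (by finiteness))
    (enorm_weightedMult_toLp_sq_le hs hs' hG hGm h)
  simp only [ENNReal.toReal_mul, ENNReal.toReal_pow, toReal_enorm] at h1
  have h2 := Real.sqrt_le_sqrt h1
  rwa [Real.sqrt_sq (norm_nonneg _), Real.sqrt_mul ENNReal.toReal_nonneg,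
    Real.sqrt_sq (norm_nonneg _)] at h2

/-- The Jacobian r² cancels the singularity and leaves (1+r²)^{-c} on the half line, integrable as
2c > 1. -/
theorem integrable_inv_norm_sq_mul_rpow {c : ℝ} (hc : 1 / 2 < c) :
    Integrable (fun w : R3 => (‖w‖ ^ 2)⁻¹ * (1 + ‖w‖ ^ 2) ^ (-c)) := by
  rw [integrable_fun_norm_addHaar volume (f := fun r => (r ^ 2)⁻¹ * (1 + r ^ 2) ^ (-c))]
  have h1 : Integrable (fun r : ℝ => (1 + ‖r‖ ^ 2) ^ (-(2 * c) / 2)) :=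
    integrable_rpow_neg_one_add_norm_sq (by simp; linarith)
  refine (h1.integrableOn (s := Set.Ioi 0)).congr_fun (fun r (hr : 0 < r) => ?_) measurableSet_Ioi
  simp only [finrank_euclideanSpace_fin, Real.norm_eq_abs, sq_abs, smul_eq_mul]
  rw [← mul_assoc, mul_inv_cancel₀ (by positivity), one_mul]
  congr 1
  ring

/-- The larger of |x|, |y| controls |x-y|. So ⟨·⟩^{-2c} of its decay can be traded for ⟨x-y⟩^{-2c},
which makes |x-y|⁻² integrable at infinity if c > 1/2. The remaining decay is shifted to the smaller
variable, whose total power ⟨·⟩^{-2e} with e = s + s' - c is integrable on ℝ³ if e > 3/2. The bound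
is then a sum of two convolution integrands of integrable functions. -/
theorem lintegral_inv_norm_sq_mul_weight_lt_top {s s' : ℝ} (hs : 1 / 2 < s) (hs' : 1 / 2 < s')
    (hss' : 2 < s + s') :
    ∫⁻ q : R3 × R3, ENNReal.ofReal ((1 + ‖q.1‖ ^ 2) ^ (-s') * (‖q.1 - q.2‖ ^ 2)⁻¹
      * (1 + ‖q.2‖ ^ 2) ^ (-s)) ∂((volume : Measure R3).prod volume) < ∞ := by
  -- The number (s+s'-1)/2 is the midpoint of 1/2 and s+s'-3/2, and this interval is nonempty
  -- because s + s' > 2. The last bound on c is e > 3/2.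
  obtain ⟨c, hc, hcs, hcs', hce⟩ : ∃ c, 1 / 2 < c ∧ c ≤ s ∧ c ≤ s' ∧ c < s + s' - 3 / 2 :=
    ⟨min (min s s') ((s + s' - 1) / 2), by simp only [lt_min_iff]; constructor <;> grind,
      by grind, by grind, by grind⟩
  set e := s + s' - c with he
  set u : R3 → ℝ := fun w => (‖w‖ ^ 2)⁻¹ * (1 + ‖w‖ ^ 2) ^ (-c) with hu
  set v : R3 → ℝ := fun w => (1 + ‖w‖ ^ 2) ^ (-e) with hv
  have hui : Integrable u := integrable_inv_norm_sq_mul_rpow hc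
  have hvi : Integrable v := by
    have h1 : Integrable (fun w : R3 => (1 + ‖w‖ ^ 2) ^ (-(2 * e) / 2)) :=
      integrable_rpow_neg_one_add_norm_sq (by simp; linarith)
    refine h1.congr (.of_forall fun w => ?_)
    simp only [hv]
    congr 1
    ring
  have hum : Measurable u := by fun_prop
  have hvm : Measurable v := by fun_prop
  -- X and Y stand for the larger and the smaller of |x|², |y|², W for |x-y|², and a for the
  -- exponent on the larger variable. The constant 4 comes from 1 + W ≤ 4(1 + X).
  have key : ∀ X Y W : ℝ, 0 ≤ X → 0 ≤ Y → 0 ≤ W → Y ≤ X → W ≤ 2 * X + 2 * Y → ∀ a b : ℝ,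
      c ≤ a → a + b = s + s' →
      (1 + X) ^ (-a) * (1 + Y) ^ (-b) ≤ 4 ^ c * ((1 + W) ^ (-c) * (1 + Y) ^ (-e)) := by
    intro X Y W hX hY hW hYX hWX a b hca hab
    have h1 : (1 + X) ^ (-a) = (1 + X) ^ (-c) * (1 + X) ^ (-(a - c)) := by
      rw [← Real.rpow_add (by positivity)]
      congr 1
      ring
    have h2 : (1 + Y) ^ (-e) = (1 + Y) ^ (-(a - c)) * (1 + Y) ^ (-b) := by
      rw [← Real.rpow_add (by positivity)]
      congr 1
      rw [he]
      linarith
    have h3 : (1 + X) ^ (-c) ≤ 4 ^ c * (1 + W) ^ (-c) := by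
      have : (4 : ℝ) ^ c * (1 + W) ^ (-c) = ((1 + W) / 4) ^ (-c) := by
        rw [Real.div_rpow (by positivity) (by positivity), Real.rpow_neg (x := 4) (by norm_num),
          div_inv_eq_mul, mul_comm]
      rw [this]
      exact Real.rpow_le_rpow_of_nonpos (by positivity) (by linarith) (by linarith)
    have h4 : (1 + X) ^ (-(a - c)) ≤ (1 + Y) ^ (-(a - c)) :=
      Real.rpow_le_rpow_of_nonpos (by positivity) (by linarith) (by linarith)
    rw [h1, h2]
    calc (1 + X) ^ (-c) * (1 + X) ^ (-(a - c)) * (1 + Y) ^ (-b)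
        ≤ (4 ^ c * (1 + W) ^ (-c)) * (1 + Y) ^ (-(a - c)) * (1 + Y) ^ (-b) := by gcongr
      _ = _ := by ring
  have hpt : ∀ q : R3 × R3, (1 + ‖q.1‖ ^ 2) ^ (-s') * (‖q.1 - q.2‖ ^ 2)⁻¹
      * (1 + ‖q.2‖ ^ 2) ^ (-s) ≤ 4 ^ c * (u (q.1 - q.2) * v q.2 + u (q.1 - q.2) * v q.1) := by
    rintro ⟨x, y⟩
    have hW : ‖x - y‖ ^ 2 ≤ 2 * ‖x‖ ^ 2 + 2 * ‖y‖ ^ 2 := by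
      have h1 : ‖x - y‖ ^ 2 ≤ (‖x‖ + ‖y‖) ^ 2 := by gcongr; exact norm_sub_le x y
      nlinarith [sq_nonneg (‖x‖ - ‖y‖)]
    have hux : 0 ≤ u (x - y) := by positivity
    have hvx : 0 ≤ v x := by positivity
    have hvy : 0 ≤ v y := by positivity
    rcases le_total (‖y‖ ^ 2) (‖x‖ ^ 2) with h | h
    · have h1 := key (‖x‖ ^ 2) (‖y‖ ^ 2) (‖x - y‖ ^ 2) (by positivity) (by positivity)
        (by positivity) h hW s' s hcs' (by ring)
      calc (1 + ‖x‖ ^ 2) ^ (-s') * (‖x - y‖ ^ 2)⁻¹ * (1 + ‖y‖ ^ 2) ^ (-s)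
          = (‖x - y‖ ^ 2)⁻¹ * ((1 + ‖x‖ ^ 2) ^ (-s') * (1 + ‖y‖ ^ 2) ^ (-s)) := by ring
        _ ≤ (‖x - y‖ ^ 2)⁻¹ * (4 ^ c * ((1 + ‖x - y‖ ^ 2) ^ (-c) * (1 + ‖y‖ ^ 2) ^ (-e))) := by
            gcongr
        _ = 4 ^ c * (u (x - y) * v y + 0) := by simp only [hu, hv]; ring
        _ ≤ _ := by
            have := mul_nonneg hux hvx
            gcongr
    · have h1 := key (‖y‖ ^ 2) (‖x‖ ^ 2) (‖x - y‖ ^ 2) (by positivity) (by positivity)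
        (by positivity) h (by linarith) s s' hcs (by ring)
      calc (1 + ‖x‖ ^ 2) ^ (-s') * (‖x - y‖ ^ 2)⁻¹ * (1 + ‖y‖ ^ 2) ^ (-s)
          = (‖x - y‖ ^ 2)⁻¹ * ((1 + ‖y‖ ^ 2) ^ (-s) * (1 + ‖x‖ ^ 2) ^ (-s')) := by ring
        _ ≤ (‖x - y‖ ^ 2)⁻¹ * (4 ^ c * ((1 + ‖x - y‖ ^ 2) ^ (-c) * (1 + ‖x‖ ^ 2) ^ (-e))) := by
            gcongr
        _ = 4 ^ c * (0 + u (x - y) * v x) := by simp only [hu, hv]; ring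
        _ ≤ _ := by
            have := mul_nonneg hux hvy
            gcongr
  have hint : Integrable (fun q : R3 × R3 => 4 ^ c * (u (q.1 - q.2) * v q.2 + u (q.1 - q.2) * v q.1))
      ((volume : Measure R3).prod volume) := by
    have h1 : Integrable (fun q : R3 × R3 => u (q.1 - q.2) * v q.2)
        ((volume : Measure R3).prod volume) :=
      (hvi.convolution_integrand (ContinuousLinearMap.mul ℝ ℝ) hui).congr
        (.of_forall fun q => by simp [mul_comm])
    have h2 : Integrable (fun q : R3 × R3 => u (q.1 - q.2) * v q.1)
        ((volume : Measure R3).prod volume) := by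
      refine h1.swap.congr (.of_forall fun q => ?_)
      simp only [Function.comp_apply, Prod.fst_swap, Prod.snd_swap, hu, norm_sub_rev q.2 q.1]
    exact (h1.add h2).const_mul _
  calc _ ≤ ∫⁻ q : R3 × R3, ENNReal.ofReal (4 ^ c * (u (q.1 - q.2) * v q.2 + u (q.1 - q.2) * v q.1))
          ∂((volume : Measure R3).prod volume) :=
        lintegral_mono fun q => ENNReal.ofReal_le_ofReal (hpt q)
    _ < ∞ := hint.lintegral_lt_top

section

/-! ### The symbol of the resolvent -/

/-- The symbol of `(-Δ - ζ)⁻¹`. -/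
def resSymbol (ζ : ℂ) (ξ : R3) : ℂ := 1 / ((‖(2 * Real.pi) • ξ‖ ^ 2 : ℝ) - ζ)

theorem resSymbol_measurable (ζ : ℂ) : Measurable (resSymbol ζ) := by
  unfold resSymbol
  fun_prop

theorem besselSymbol_two (ξ : R3) : besselSymbol 2 ξ = 1 + (‖(2 * Real.pi) • ξ‖ ^ 2 : ℝ) := by
  simp [besselSymbol, weight]

theorem sub_ne_zero_of_not_nonneg {ζ : ℂ} (hζ : ¬ ∃ r : ℝ, 0 ≤ r ∧ ζ = r) (ξ : R3) :
    ((‖(2 * Real.pi) • ξ‖ ^ 2 : ℝ) - ζ : ℂ) ≠ 0 := fun h =>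
  hζ ⟨_, by positivity, (sub_eq_zero.1 h).symm⟩

theorem sq_not_nonneg {z : ℂ} (hz : z.im ≠ 0) : ¬ ∃ r : ℝ, 0 ≤ r ∧ z ^ 2 = r := by
  rintro ⟨r, hr, h⟩
  have h1 : z ^ 2 = ((√r : ℝ) : ℂ) ^ 2 := by
    rw [h, ← Complex.ofReal_pow, Real.sq_sqrt hr]
  rcases sq_eq_sq_iff_eq_or_eq_neg.1 h1 with h2 | h2 <;> rw [h2] at hz <;> simp at hz

/-- If d > 0 is a radius of a disc around ζ that misses [0,∞), then for p ≥ 0 one has 1 + p ≤ 1 +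
|ζ| + |p-ζ| and |p-ζ| ≥ d, so the quotient is at most (1+|ζ|)/d + 1. -/
theorem besselSymbol_mul_resSymbol_isBddMeas {ζ : ℂ} (hζ : ¬ ∃ r : ℝ, 0 ≤ r ∧ ζ = r) :
    IsBddMeas (fun ξ => besselSymbol 2 ξ * resSymbol ζ ξ) := by
  refine ⟨(besselSymbol_hasTemperateGrowth 2).1.continuous.measurable.mul
    (resSymbol_measurable ζ), ?_⟩
  have hcl : IsClosed {w : ℂ | 0 ≤ w.re ∧ w.im = 0} :=
    (isClosed_le continuous_const Complex.continuous_re).inter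
      (isClosed_eq Complex.continuous_im continuous_const)
  have hmem : ζ ∉ {w : ℂ | 0 ≤ w.re ∧ w.im = 0} := fun h =>
    hζ ⟨ζ.re, h.1, Complex.ext rfl (by simpa using h.2)⟩
  obtain ⟨d, hd, hball⟩ := Metric.isOpen_iff.1 hcl.isOpen_compl ζ hmem
  refine ⟨(1 + ‖ζ‖) / d + 1, fun ξ => ?_⟩
  set p : ℝ := ‖(2 * Real.pi) • ξ‖ ^ 2 with hp
  have hp0 : 0 ≤ p := by positivity
  have h1 : d ≤ ‖(p : ℂ) - ζ‖ := by
    by_contra! h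
    exact hball (show (p : ℂ) ∈ Metric.ball ζ d by rwa [Metric.mem_ball, dist_eq_norm])
      ⟨by simpa using hp0, by simp⟩
  have h2 : p ≤ ‖ζ‖ + ‖(p : ℂ) - ζ‖ := by
    have := norm_add_le ζ ((p : ℂ) - ζ)
    rwa [add_sub_cancel, Complex.norm_real, Real.norm_of_nonneg hp0] at this
  simp only [besselSymbol_two, resSymbol]
  rw [← hp, norm_mul, norm_div, norm_one, ← Complex.ofReal_one,
    ← Complex.ofReal_add, Complex.norm_real, Real.norm_of_nonneg (by positivity), mul_one_div,
    div_le_iff₀ (by linarith)]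
  have h3 : (1 + ‖ζ‖) ≤ (1 + ‖ζ‖) / d * ‖(p : ℂ) - ζ‖ := by
    rw [div_mul_eq_mul_div, le_div_iff₀ hd]
    gcongr
  linarith

theorem IsBddMeas.besselSymbol_mul {b : R3 → ℂ} {ζ : ℂ} (hb : IsBddMeas b)
    (hζ : ¬ ∃ r : ℝ, 0 ≤ r ∧ ζ = r) :
    IsBddMeas (fun ξ => b ξ * (besselSymbol 2 ξ * resSymbol ζ ξ)) :=
  hb.mul (besselSymbol_mul_resSymbol_isBddMeas hζ)

theorem besselSymbol_neg_mul (t : ℝ) (ξ : R3) : besselSymbol (-t) ξ * besselSymbol t ξ = 1 := by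
  have := congrFun (besselSymbol_mul (-t) t) ξ
  rwa [neg_add_cancel, besselSymbol_zero] at this

theorem resSymbol_isBddMeas {ζ : ℂ} (hζ : ¬ ∃ r : ℝ, 0 ≤ r ∧ ζ = r) : IsBddMeas (resSymbol ζ) := by
  have h := (besselSymbol_isBddMeas (t := -2) (by norm_num)).besselSymbol_mul hζ
  have h2 : (fun ξ => besselSymbol (-2) ξ * (besselSymbol 2 ξ * resSymbol ζ ξ)) = resSymbol ζ := by
    ext ξ
    rw [← mul_assoc, besselSymbol_neg_mul, one_mul]
  rwa [h2] at h

theorem fourier_helmholtz {z : ℂ} (hz : 0 < z.im) :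
    𝓕 (fun x : R3 => helmholtzRadial z ‖x‖) = resSymbol (z ^ 2) :=
  funext (fourier_helmholtzRadial hz)

theorem integrable_helmholtz {z : ℂ} (hz : 0 < z.im) :
    Integrable (fun x : R3 => helmholtzRadial z ‖x‖) :=
  integrable_helmholtzRadial_norm volume (by simp) hz

/-- The factor 1/2 is a crude bound for 1/(4π), chosen so that the difference of two such kernels is
at most 1/r. -/
theorem norm_helmholtzRadial_le {z : ℂ} (hz : 0 ≤ z.im) {r : ℝ} (hr : 0 ≤ r) :
    ‖helmholtzRadial z r‖ ≤ 1 / 2 * r⁻¹ := by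
  rw [norm_helmholtzRadial z hr, div_eq_mul_inv, mul_inv, ← mul_assoc]
  gcongr
  have h1 : Real.exp (-(z.im * r)) ≤ 1 := Real.exp_le_one_iff.2 (by nlinarith [mul_nonneg hz hr])
  have h2 : (4 * Real.pi)⁻¹ ≤ 1 / 2 := by
    rw [inv_le_comm₀ (by positivity) (by norm_num)]
    nlinarith [Real.pi_gt_three]
  calc Real.exp (-(z.im * r)) * (4 * Real.pi)⁻¹ ≤ 1 * (1 / 2) := by gcongr
    _ = _ := one_mul _

theorem continuous_helmholtzRadial_left (r : ℝ) : Continuous (fun z => helmholtzRadial z r) := by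
  unfold helmholtzRadial
  fun_prop

/-! ### Limits of the weighted resolvents -/

theorem eventually_upper (z₀ : ℂ) : ∀ᶠ z in 𝓝[{z : ℂ | 0 < z.im}] z₀, 0 < z.im :=
  self_mem_nhdsWithin

theorem tendsto_dist_prod {X : Type*} [PseudoMetricSpace X] {f : ℂ → X} {l : Filter ℂ} {a : X}
    (hf : Tendsto f l (𝓝 a)) :
    Tendsto (fun p : ℂ × ℂ => dist (f p.1) (f p.2)) (l ×ˢ l) (𝓝 0) := by
  have h1 : Tendsto (fun p : ℂ × ℂ => f p.1) (l ×ˢ l) (𝓝 a) := hf.comp tendsto_fst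
  have h2 : Tendsto (fun p : ℂ × ℂ => f p.2) (l ×ˢ l) (𝓝 a) := hf.comp tendsto_snd
  simpa using h1.dist h2

section Limits

variable {s s' : ℝ}

/-- The majorant does not depend on z and w, as dominated convergence up to the real line requires.
-/
theorem enorm_weight_sub_le {z w : ℂ} (hz : 0 ≤ z.im) (hw : 0 ≤ w.im) (q : R3 × R3) :
    (‖weight (-s') q.1‖ₑ * (‖helmholtzRadial z ‖q.1 - q.2‖ - helmholtzRadial w ‖q.1 - q.2‖‖ₑ
      * ‖weight (-s) q.2‖ₑ)) ^ 2
      ≤ ENNReal.ofReal ((1 + ‖q.1‖ ^ 2) ^ (-s') * (‖q.1 - q.2‖ ^ 2)⁻¹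
      * (1 + ‖q.2‖ ^ 2) ^ (-s)) := by
  have hsq : ∀ (t : ℝ) (x : R3), ‖weight (-t) x‖ ^ 2 = (1 + ‖x‖ ^ 2) ^ (-t) := by
    intro t x
    rw [norm_weight, ← Real.rpow_natCast, ← Real.rpow_mul (by positivity)]
    congr 1
    push_cast
    ring
  rw [← hsq, ← hsq, ← ofReal_norm, ← ofReal_norm, ← ofReal_norm,
    ← ENNReal.ofReal_mul (norm_nonneg _), ← ENNReal.ofReal_mul (norm_nonneg _),
    ← ENNReal.ofReal_pow (by positivity)]
  apply ENNReal.ofReal_le_ofReal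
  have h1 : ‖helmholtzRadial z ‖q.1 - q.2‖ - helmholtzRadial w ‖q.1 - q.2‖‖ ≤ ‖q.1 - q.2‖⁻¹ := by
    refine (norm_sub_le _ _).trans ?_
    have := norm_helmholtzRadial_le hz (norm_nonneg (q.1 - q.2))
    have := norm_helmholtzRadial_le hw (norm_nonneg (q.1 - q.2))
    linarith
  calc _ ≤ (‖weight (-s') q.1‖ * (‖q.1 - q.2‖⁻¹ * ‖weight (-s) q.2‖)) ^ 2 := by gcongr
    _ = _ := by rw [mul_pow, mul_pow, inv_pow]; ring

theorem hilbertSchmidt_sub_ne_top (hs : 1 / 2 < s) (hs' : 1 / 2 < s') (hss' : 2 < s + s')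
    {z w : ℂ} (hz : 0 ≤ z.im) (hw : 0 ≤ w.im) :
    hilbertSchmidt s s' (fun x => helmholtzRadial z ‖x‖ - helmholtzRadial w ‖x‖) ≠ ∞ :=
  ((lintegral_mono (enorm_weight_sub_le hz hw)).trans_lt
    (lintegral_inv_norm_sq_mul_weight_lt_top hs hs' hss')).ne

theorem tendsto_hilbertSchmidt_sub (hs : 1 / 2 < s) (hs' : 1 / 2 < s') (hss' : 2 < s + s')
    (z₀ : ℂ) :
    Tendsto (fun p : ℂ × ℂ => hilbertSchmidt s s'
      (fun x => helmholtzRadial p.1 ‖x‖ - helmholtzRadial p.2 ‖x‖))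
      (𝓝[{z | 0 < z.im}] z₀ ×ˢ 𝓝[{z | 0 < z.im}] z₀) (𝓝 0) := by
  have hev : ∀ᶠ p in 𝓝[{z : ℂ | 0 < z.im}] z₀ ×ˢ 𝓝[{z : ℂ | 0 < z.im}] z₀,
      0 < p.1.im ∧ 0 < p.2.im :=
    (eventually_upper z₀).prod_mk (eventually_upper z₀)
  have hlim : Tendsto (fun p : ℂ × ℂ => p)
      (𝓝[{z : ℂ | 0 < z.im}] z₀ ×ˢ 𝓝[{z : ℂ | 0 < z.im}] z₀) (𝓝 (z₀, z₀)) := by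
    rw [nhds_prod_eq]
    exact tendsto_id.mono_left (Filter.prod_mono nhdsWithin_le_nhds nhdsWithin_le_nhds)
  have := tendsto_lintegral_filter_of_dominated_convergence
    (μ := (volume : Measure R3).prod volume)
    (F := fun (p : ℂ × ℂ) (q : R3 × R3) => (‖weight (-s') q.1‖ₑ *
      (‖helmholtzRadial p.1 ‖q.1 - q.2‖ - helmholtzRadial p.2 ‖q.1 - q.2‖‖ₑ
      * ‖weight (-s) q.2‖ₑ)) ^ 2) (f := fun _ => 0)
    (l := 𝓝[{z : ℂ | 0 < z.im}] z₀ ×ˢ 𝓝[{z : ℂ | 0 < z.im}] z₀) _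
    (.of_forall fun p => by
      have := weight_measurable (-s)
      have := weight_measurable (-s')
      have := helmholtzRadial_measurable p.1
      have := helmholtzRadial_measurable p.2
      fun_prop)
    (hev.mono fun p hp => .of_forall fun q => enorm_weight_sub_le hp.1.le hp.2.le q)
    (lintegral_inv_norm_sq_mul_weight_lt_top hs hs' hss').ne
    (.of_forall fun q => by
      have h1 : Continuous (fun p : ℂ × ℂ => (‖weight (-s') q.1‖ₑ *
          (‖helmholtzRadial p.1 ‖q.1 - q.2‖ - helmholtzRadial p.2 ‖q.1 - q.2‖‖ₑ
          * ‖weight (-s) q.2‖ₑ)) ^ 2) := by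
        have h2 := continuous_helmholtzRadial_left ‖q.1 - q.2‖
        have h3 := ((h2.comp continuous_fst).sub (h2.comp continuous_snd)).enorm
        exact (ENNReal.continuous_pow 2).comp ((ENNReal.continuous_const_mul enorm_ne_top).comp
          ((ENNReal.continuous_mul_const enorm_ne_top).comp h3))
      have h4 := (h1.tendsto (z₀, z₀)).comp hlim
      simpa [Function.comp_def] using h4)
  simpa [hilbertSchmidt] using this

/-- The Cauchy criterion yields boundary values without a formula for them; at real z the resolvent
symbol may be singular and defines no bounded multiplier. -/
theorem exists_tendsto_of_dist_le {X : Type*} [MetricSpace X] [CompleteSpace X] {f : ℂ → X}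
    {l : Filter ℂ} [l.NeBot] {g : ℂ × ℂ → ℝ} (h : ∀ᶠ p in l ×ˢ l, dist (f p.1) (f p.2) ≤ g p)
    (hg : Tendsto g (l ×ˢ l) (𝓝 0)) : ∃ a, Tendsto f l (𝓝 a) := by
  rw [← cauchy_map_iff_exists_tendsto, cauchy_map_iff]
  refine ⟨inferInstance, ?_⟩
  rw [tendsto_uniformity_iff_dist_tendsto_zero]
  exact squeeze_zero' (.of_forall fun _ => dist_nonneg) h hg

theorem nhdsWithin_upper_neBot {z₀ : ℂ} (hz₀ : 0 ≤ z₀.im) : (𝓝[{z : ℂ | 0 < z.im}] z₀).NeBot := by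
  rw [← mem_closure_iff_nhdsWithin_neBot, Complex.closure_setOfPred_lt_im]
  exact hz₀

theorem weightedMult_add {a b : R3 → ℂ} (ha : IsBddMeas a) (hb : IsBddMeas b) :
    weightedMult s s' (fun ξ => a ξ + b ξ) = weightedMult s s' a + weightedMult s s' b := by
  simp only [weightedMult, multOp_add ha hb, ContinuousLinearMap.add_comp,
    ContinuousLinearMap.comp_add]

theorem weightedMult_sub {a b : R3 → ℂ} (ha : IsBddMeas a) (hb : IsBddMeas b) :
    weightedMult s s' (fun ξ => a ξ - b ξ) = weightedMult s s' a - weightedMult s s' b := by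
  simp only [weightedMult, multOp_sub ha hb, ContinuousLinearMap.sub_comp,
    ContinuousLinearMap.comp_sub]

theorem weightedMult_const_mul {b : R3 → ℂ} (c : ℂ) (hb : IsBddMeas b) :
    weightedMult s s' (fun ξ => c * b ξ) = c • weightedMult s s' b := by
  simp only [weightedMult, multOp_const_mul c hb, ContinuousLinearMap.smul_comp,
    ContinuousLinearMap.comp_smul]

theorem norm_weightedMult_le (hs : 0 ≤ s) (hs' : 0 ≤ s') {b : R3 → ℂ} (hb : IsBddMeas b) {C : ℝ}
    (hC : ∀ x, ‖b x‖ ≤ C) : ‖weightedMult s s' b‖ ≤ C := by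
  have hC0 : 0 ≤ C := (norm_nonneg _).trans (hC 0)
  refine ContinuousLinearMap.opNorm_le_bound _ hC0 fun f => ?_
  have h1 := norm_mulOp_apply_le (weight_isBddMeas (t := -s') (by linarith))
    (norm_weight_le_one (by linarith)) (multOp b (mulOp (weight (-s)) f))
  have h2 := norm_multOp_apply_le hb hC (mulOp (weight (-s)) f)
  have h3 := norm_mulOp_apply_le (weight_isBddMeas (t := -s) (by linarith))
    (norm_weight_le_one (by linarith)) f
  rw [one_mul] at h1 h3
  exact (h1.trans h2).trans (by gcongr)

/-- The difference of two resolvents has the difference of the Helmholtz functions as convolution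
kernel, so its weighted operator norm is at most a Hilbert–Schmidt norm that tends to 0. -/
theorem exists_tendsto_weightedMult_resSymbol (hs : 1 / 2 < s) (hs' : 1 / 2 < s')
    (hss' : 2 < s + s') {z₀ : ℂ} (hz₀ : 0 ≤ z₀.im) :
    ∃ L, Tendsto (fun z : ℂ => weightedMult s s' (resSymbol (z ^ 2)))
      (𝓝[{z | 0 < z.im}] z₀) (𝓝 L) := by
  have := nhdsWithin_upper_neBot hz₀
  have hev : ∀ᶠ p in 𝓝[{z : ℂ | 0 < z.im}] z₀ ×ˢ 𝓝[{z : ℂ | 0 < z.im}] z₀,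
      0 < p.1.im ∧ 0 < p.2.im :=
    (eventually_upper z₀).prod_mk (eventually_upper z₀)
  refine exists_tendsto_of_dist_le (g := fun p => √(hilbertSchmidt s s'
      (fun x => helmholtzRadial p.1 ‖x‖ - helmholtzRadial p.2 ‖x‖)).toReal)
    (hev.mono ?_) ?_
  · rintro ⟨z, w⟩ ⟨hz, hw⟩
    simp only at hz hw ⊢
    have hint := (integrable_helmholtz hz).sub (integrable_helmholtz hw)
    have hm : Measurable (fun x : R3 => helmholtzRadial z ‖x‖ - helmholtzRadial w ‖x‖) := by
      have := helmholtzRadial_measurable z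
      have := helmholtzRadial_measurable w
      fun_prop
    have h1 : 𝓕 (fun x : R3 => helmholtzRadial z ‖x‖ - helmholtzRadial w ‖x‖)
        = fun ξ => resSymbol (z ^ 2) ξ - resSymbol (w ^ 2) ξ := by
      ext ξ
      rw [← fourier_helmholtz hz, ← fourier_helmholtz hw, Real.fourier_eq, Real.fourier_eq,
        Real.fourier_eq, ← integral_sub
          ((Real.fourierIntegral_convergent_iff ξ).2 (integrable_helmholtz hz))
          ((Real.fourierIntegral_convergent_iff ξ).2 (integrable_helmholtz hw))]
      simp only [smul_sub]
    rw [dist_eq_norm, ← weightedMult_sub (resSymbol_isBddMeas (sq_not_nonneg hz.ne'))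
      (resSymbol_isBddMeas (sq_not_nonneg hw.ne')), ← h1]
    exact norm_weightedMult_le_hilbertSchmidt (by linarith) (by linarith) hint hm
      (hilbertSchmidt_sub_ne_top hs hs' hss' hz.le hw.le)
  · have h1 := (ENNReal.continuousAt_toReal ENNReal.zero_ne_top).tendsto.comp
      (tendsto_hilbertSchmidt_sub hs hs' hss' z₀)
    have h2 := (Real.continuous_sqrt.tendsto _).comp h1
    simpa [Function.comp_def] using h2

/-! ### Frequency cutoff and limits with an additional multiplier -/

theorem norm_resSymbol_sub_le {ζ ω : ℂ} {ξ : R3}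
    (h1 : 1 ≤ ‖((‖(2 * Real.pi) • ξ‖ ^ 2 : ℝ) - ζ : ℂ)‖)
    (h2 : 1 ≤ ‖((‖(2 * Real.pi) • ξ‖ ^ 2 : ℝ) - ω : ℂ)‖) :
    ‖resSymbol ζ ξ - resSymbol ω ξ‖ ≤ ‖ζ - ω‖ := by
  rw [resSymbol, resSymbol]
  generalize ((‖(2 * Real.pi) • ξ‖ ^ 2 : ℝ) : ℂ) = p at h1 h2 ⊢
  have hz0 : p - ζ ≠ 0 := norm_pos_iff.1 (by linarith)
  have hw0 : p - ω ≠ 0 := norm_pos_iff.1 (by linarith)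
  have h3 : 1 / (p - ζ) - 1 / (p - ω) = (ζ - ω) / ((p - ζ) * (p - ω)) := by
    rw [div_sub_div _ _ hz0 hw0]
    congr 1
    ring
  rw [h3, norm_div, norm_mul]
  exact div_le_self (norm_nonneg _) (by nlinarith)

theorem one_le_norm_sub_sq {r : ℝ} (hr : 0 < r) {z : ℂ} (hz : ‖z‖ ≤ r) {ξ : R3}
    (hξ : r + 1 ≤ ‖ξ‖) : 1 ≤ ‖((‖(2 * Real.pi) • ξ‖ ^ 2 : ℝ) - z ^ 2 : ℂ)‖ := by
  have h1 : ‖ξ‖ ≤ ‖(2 * Real.pi) • ξ‖ := by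
    rw [norm_smul, Real.norm_of_nonneg (by positivity)]
    nlinarith [norm_nonneg ξ, Real.pi_gt_three]
  have h2 : (r + 1) ^ 2 ≤ ‖(2 * Real.pi) • ξ‖ ^ 2 := by
    have := hξ.trans h1
    gcongr
  have h3 := norm_sub_norm_le (((‖(2 * Real.pi) • ξ‖ ^ 2 : ℝ) : ℂ)) (z ^ 2)
  rw [Complex.norm_real, Real.norm_of_nonneg (by positivity), norm_pow] at h3
  have h4 : ‖z‖ ^ 2 ≤ r ^ 2 := by gcongr
  nlinarith

/-- A cutoff splits m into a Schwartz symbol χ and a part vanishing near the spheres where the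
resolvent symbols become singular. The operator χ(D) is bounded on L^{2,-s'} and so preserves the
Cauchy property already known without m; on the other part the symbols themselves are uniformly
Cauchy. -/
theorem exists_tendsto_weightedMult_mul_resSymbol (hs : 1 / 2 < s) (hs' : 1 / 2 < s')
    (hss' : 2 < s + s') {m : R3 → ℂ} (hm : m.HasTemperateGrowth) (hmb : IsBddMeas m)
    {z₀ : ℂ} (hz₀ : 0 ≤ z₀.im) :
    ∃ L, Tendsto (fun z : ℂ => weightedMult s s' (fun ξ => m ξ * resSymbol (z ^ 2) ξ))
      (𝓝[{z | 0 < z.im}] z₀) (𝓝 L) := by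
  have := nhdsWithin_upper_neBot hz₀
  obtain ⟨L₁, hL₁⟩ := exists_tendsto_weightedMult_resSymbol hs hs' hss' hz₀
  obtain ⟨M, hM⟩ := hmb.2
  have hM0 : 0 ≤ M := (norm_nonneg _).trans (hM 0)
  set r : ℝ := ‖z₀‖ + 1 with hr
  have hr0 : 0 < r := by positivity
  -- All z within distance 1 of z₀ satisfy |z| ≤ r. Where φ ≠ 1 one has |ξ| > r + 1, hence |2πξ|² -
  -- |z|² ≥ (r+1)² - r² ≥ 1.
  let φ : ContDiffBump (0 : R3) := ⟨r + 1, r + 2, by linarith, by linarith⟩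
  have hφc : HasCompactSupport (fun ξ => ((φ ξ : ℝ) : ℂ)) :=
    φ.hasCompactSupport.comp_left Complex.ofReal_zero
  have hφd := Complex.ofRealCLM.contDiff.comp (φ.contDiff (n := (⊤ : ℕ∞)))
  let χ : 𝓢(R3, ℂ) := (hφc.mul_left (f := m)).toSchwartzMap (hm.1.mul hφd)
  have hχ : ∀ ξ, χ ξ = m ξ * ((φ ξ : ℝ) : ℂ) := fun ξ => rfl
  have hφ1 : ∀ ξ, ‖(1 : ℂ) - ((φ ξ : ℝ) : ℂ)‖ ≤ 1 := fun ξ => by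
    rw [← Complex.ofReal_one, ← Complex.ofReal_sub, Complex.norm_real, Real.norm_eq_abs, abs_le]
    constructor <;> linarith [φ.nonneg (x := ξ), φ.le_one (x := ξ)]
  have hχb : IsBddMeas χ := by
    refine ⟨χ.continuous.measurable, M, fun ξ => ?_⟩
    rw [hχ, norm_mul, Complex.norm_real, Real.norm_of_nonneg φ.nonneg]
    calc ‖m ξ‖ * φ ξ ≤ M * 1 := mul_le_mul (hM ξ) φ.le_one φ.nonneg hM0
      _ = M := mul_one M
  have hψb : IsBddMeas (fun ξ => m ξ * (1 - ((φ ξ : ℝ) : ℂ))) :=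
    hmb.mul ⟨measurable_const.sub (Complex.measurable_ofReal.comp φ.continuous.measurable), 1, hφ1⟩
  obtain ⟨C, hC0, hC⟩ := exists_norm_mulOp_weight_multOp_le χ (t := s') (by linarith)
  have hball : ∀ᶠ z in 𝓝[{z : ℂ | 0 < z.im}] z₀, 0 < z.im ∧ ‖z‖ ≤ r := by
    refine (eventually_upper z₀).and (nhdsWithin_le_nhds ?_)
    filter_upwards [Metric.ball_mem_nhds z₀ one_pos] with z hz
    rw [Metric.mem_ball, dist_eq_norm] at hz
    have := norm_add_le z₀ (z - z₀)
    rw [add_sub_cancel] at this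
    linarith
  refine exists_tendsto_of_dist_le (g := fun p =>
    C * dist (weightedMult s s' (resSymbol (p.1 ^ 2))) (weightedMult s s' (resSymbol (p.2 ^ 2)))
      + M * dist (p.1 ^ 2) (p.2 ^ 2)) ((hball.prod_mk hball).mono ?_) ?_
  · rintro ⟨z, w⟩ ⟨⟨hz, hzr⟩, hw, hwr⟩
    simp only at hz hw hzr hwr ⊢
    have hbz := resSymbol_isBddMeas (sq_not_nonneg hz.ne')
    have hbw := resSymbol_isBddMeas (sq_not_nonneg hw.ne')
    have hsplit : (fun ξ => m ξ * resSymbol (z ^ 2) ξ - m ξ * resSymbol (w ^ 2) ξ)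
        = fun ξ => χ ξ * (resSymbol (z ^ 2) ξ - resSymbol (w ^ 2) ξ)
          + m ξ * (1 - ((φ ξ : ℝ) : ℂ)) * (resSymbol (z ^ 2) ξ - resSymbol (w ^ 2) ξ) := by
      ext ξ
      rw [hχ]
      ring
    rw [dist_eq_norm, ← weightedMult_sub (hmb.mul hbz) (hmb.mul hbw), hsplit,
      weightedMult_add (hχb.mul (hbz.sub hbw)) (hψb.mul (hbz.sub hbw))]
    refine (norm_add_le _ _).trans (add_le_add ?_ ?_)
    · rw [dist_eq_norm, ← weightedMult_sub hbz hbw]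
      refine ContinuousLinearMap.opNorm_le_bound _ (by positivity) fun f => ?_
      have h1 := hC (multOp (fun ξ => resSymbol (z ^ 2) ξ - resSymbol (w ^ 2) ξ)
        (mulOp (weight (-s)) f))
      rw [multOp_multOp hχb (hbz.sub hbw)] at h1
      refine h1.trans ?_
      rw [mul_assoc]
      gcongr
      exact (weightedMult s s' (fun ξ => resSymbol (z ^ 2) ξ - resSymbol (w ^ 2) ξ)).le_opNorm f
    · refine norm_weightedMult_le (by linarith) (by linarith) (hψb.mul (hbz.sub hbw)) fun ξ => ?_
      rw [norm_mul, norm_mul, mul_assoc]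
      refine mul_le_mul (hM ξ) ?_ (by positivity) hM0
      rcases le_or_gt (r + 1) ‖ξ‖ with h | h
      · refine (mul_le_of_le_one_left (norm_nonneg _) (hφ1 ξ)).trans ?_
        rw [dist_eq_norm]
        exact norm_resSymbol_sub_le (one_le_norm_sub_sq hr0 hzr h) (one_le_norm_sub_sq hr0 hwr h)
      · have h1 : φ ξ = 1 := φ.one_of_mem_closedBall (by simpa using h.le)
        simp [h1]
  · have h1 := tendsto_dist_prod hL₁
    have h2 := tendsto_dist_prod
      (((continuous_pow 2).tendsto z₀).mono_left (nhdsWithin_le_nhds (s := {z : ℂ | 0 < z.im})))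
    simpa using (h1.const_mul C).add (h2.const_mul M)

end Limits

end

/-! ### Algebra of the Dirac operator -/

/-- The product of two off-diagonal block matrices is block diagonal with entries σⱼσₖ, so the
Clifford relations reduce to those of the Pauli matrices. -/
theorem diracAlpha_anticomm (j k : Fin 3) :
    diracAlpha j * diracAlpha k + diracAlpha k * diracAlpha j
      = if j = k then (2 : ℂ) • (1 : Matrix (Fin 4) (Fin 4) ℂ) else 0 := by
  have h : ∀ j k, diracAlpha j * diracAlpha k
      = Matrix.reindex finSumFinEquiv finSumFinEquiv
        (Matrix.fromBlocks (pauli j * pauli k) 0 0 (pauli j * pauli k)) := by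
    intro j k
    simp [diracAlpha, Matrix.fromBlocks_multiply]
  have h1 : ∀ j k, pauli j * pauli k + pauli k * pauli j
      = if j = k then (2 : ℂ) • (1 : Matrix (Fin 2) (Fin 2) ℂ) else 0 := by
    intro j k
    fin_cases j <;> fin_cases k <;> ext a b <;> fin_cases a <;> fin_cases b <;>
      simp [pauli] <;> norm_num
  have h2 : ∀ A B : Matrix (Fin 2 ⊕ Fin 2) (Fin 2 ⊕ Fin 2) ℂ,
      Matrix.reindex finSumFinEquiv finSumFinEquiv A + Matrix.reindex finSumFinEquiv finSumFinEquiv B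
        = Matrix.reindex finSumFinEquiv finSumFinEquiv (A + B) := fun _ _ => rfl
  rw [h, h, h2, Matrix.fromBlocks_add, h1]
  split_ifs
  · have h3 : Matrix.fromBlocks ((2 : ℂ) • (1 : Matrix (Fin 2) (Fin 2) ℂ)) (0 + 0) (0 + 0)
        ((2 : ℂ) • 1) = (2 : ℂ) • (1 : Matrix (Fin 2 ⊕ Fin 2) (Fin 2 ⊕ Fin 2) ℂ) := by
      rw [← Matrix.fromBlocks_one, Matrix.fromBlocks_smul, smul_zero, add_zero]
    rw [h3, Matrix.reindex_apply]
    have h4 : (1 : Matrix (Fin 2 ⊕ Fin 2) (Fin 2 ⊕ Fin 2) ℂ).submatrix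
        (finSumFinEquiv (m := 2) (n := 2)).symm (finSumFinEquiv (m := 2) (n := 2)).symm = 1 :=
      Matrix.submatrix_one_equiv _
    rw [Matrix.submatrix_smul, Pi.smul_apply, Pi.smul_apply, h4]
  · simp

theorem alphaOp_anticomm (j k : Fin 3) (v : C4) :
    alphaOp j (alphaOp k v) + alphaOp k (alphaOp j v) = if j = k then (2 : ℂ) • v else 0 := by
  have h1 : ∀ A B : Matrix (Fin 4) (Fin 4) ℂ, Matrix.toEuclideanCLM (𝕜 := ℂ) A
      (Matrix.toEuclideanCLM (𝕜 := ℂ) B v) = Matrix.toEuclideanCLM (𝕜 := ℂ) (A * B) v := by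
    intro A B
    rw [map_mul]
    rfl
  rw [alphaOp, alphaOp, h1, h1, ← add_apply, ← map_add, diracAlpha_anticomm]
  split_ifs
  · rw [map_smul, map_one]
    rfl
  · simp

/-- The symbol of `(1/i) ∂ⱼ`. -/
def momSymbol (j : Fin 3) (ξ : R3) : ℂ :=
  (2 * Real.pi : ℂ) * (inner ℝ ξ (EuclideanSpace.single j (1 : ℝ)) : ℝ)

theorem momSymbol_hasTemperateGrowth (j : Fin 3) : (momSymbol j).HasTemperateGrowth := by
  unfold momSymbol
  fun_prop

theorem momentum_apply (j : Fin 3) (u : Distr) :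
    momentum j u = (-Complex.I) • ∂_{(EuclideanSpace.single j (1 : ℝ) : R3)} u := rfl

theorem momentum_eq (j : Fin 3) (u : Distr) :
    momentum j u = TemperedDistribution.fourierMultiplierCLM C4 (momSymbol j) u := by
  have h1 : momSymbol j = (2 * Real.pi : ℂ) •
      (fun ξ : R3 => ((inner ℝ ξ (EuclideanSpace.single j (1 : ℝ)) : ℝ) : ℂ)) := rfl
  rw [momentum_apply, TemperedDistribution.lineDeriv_eq_fourierMultiplierCLM, h1,
    TemperedDistribution.fourierMultiplierCLM_smul (by fun_prop), smul_apply, smul_smul]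
  congr 1
  linear_combination (-2 * Real.pi : ℂ) * Complex.I_sq

theorem momentum_comm (j k : Fin 3) (u : Distr) :
    momentum j (momentum k u) = momentum k (momentum j u) := by
  simp only [momentum_eq]
  rw [TemperedDistribution.fourierMultiplierCLM_fourierMultiplierCLM_apply
    (momSymbol_hasTemperateGrowth _) (momSymbol_hasTemperateGrowth _),
    TemperedDistribution.fourierMultiplierCLM_fourierMultiplierCLM_apply
    (momSymbol_hasTemperateGrowth _) (momSymbol_hasTemperateGrowth _), mul_comm]

theorem alphaDistr_momentum (j k : Fin 3) (u : Distr) :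
    momentum k (alphaDistr j u) = alphaDistr j (momentum k u) := by
  ext1 φ
  exact ((alphaOp j).map_smul (-Complex.I) _).symm

theorem alphaDistr_anticomm (j k : Fin 3) (u : Distr) :
    alphaDistr j (alphaDistr k u) + alphaDistr k (alphaDistr j u)
      = if j = k then (2 : ℂ) • u else 0 := by
  ext1 φ
  have := alphaOp_anticomm j k (u φ)
  split_ifs at this ⊢
  · exact this
  · exact this

theorem negLaplaceDistr_eq_sum (u : Distr) :
    negLaplaceDistr u = ∑ j, momentum j (momentum j u) := by
  have h1 : negLaplaceDistr u = -(Δ u) :=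
    congrArg (fun v : Distr => -v) (TemperedDistribution.laplacianCLM_apply u)
  rw [h1, TemperedDistribution.laplacian_eq_sum (EuclideanSpace.basisFun (Fin 3) ℝ),
    ← Finset.sum_neg_distrib]
  refine Finset.sum_congr rfl fun j _ => ?_
  rw [momentum_apply, momentum_apply, LineDeriv.lineDerivOp_smul, smul_smul,
    EuclideanSpace.basisFun_apply, neg_mul_neg, Complex.I_mul_I, neg_one_smul]

theorem diracDistr_apply (u : Distr) : diracDistr u = ∑ j, alphaDistr j (momentum j u) := by
  simp [diracDistr]

/-- `H₀² = -Δ`. -/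
theorem diracDistr_diracDistr (u : Distr) : diracDistr (diracDistr u) = negLaplaceDistr u := by
  have hsq : ∀ j (v : Distr), alphaDistr j (alphaDistr j v) = v := by
    intro j v
    have h := alphaDistr_anticomm j j v
    rw [if_pos rfl, ← two_smul ℂ] at h
    exact smul_right_injective Distr (two_ne_zero (α := ℂ)) h
  have hac : ∀ j k, j ≠ k → ∀ v : Distr,
      alphaDistr j (alphaDistr k v) + alphaDistr k (alphaDistr j v) = 0 := by
    intro j k hjk v
    rw [alphaDistr_anticomm, if_neg hjk]
  rw [negLaplaceDistr_eq_sum, diracDistr_apply, diracDistr_apply]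
  simp only [alphaDistr_momentum, Fin.sum_univ_three, map_add, hsq]
  rw [momentum_comm 1 0, momentum_comm 2 0, momentum_comm 2 1]
  have h1 := hac 0 1 (by decide) (momentum 0 (momentum 1 u))
  have h2 := hac 0 2 (by decide) (momentum 0 (momentum 2 u))
  have h3 := hac 1 2 (by decide) (momentum 1 (momentum 2 u))
  -- Momenta commute, so the mixed terms of H₀² group into three anticommutators, each of which
  -- vanishes.
  have h4 := congrArg₂ (· + ·) (congrArg₂ (· + ·) h1 h2) h3
  simp only [add_zero] at h4
  rw [← sub_eq_zero, ← h4]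
  abel

/-- The symbol of ⟨D⟩² is 1 + |2πξ|². Thus questions about -Δ become questions about `bessel 2`,
which also defines the domain. -/
theorem negLaplaceDistr_eq (u : Distr) : negLaplaceDistr u = bessel 2 u - u := by
  have h1 : negLaplaceDistr u = -(Δ u) :=
    congrArg (fun v : Distr => -v) (TemperedDistribution.laplacianCLM_apply u)
  have hp : (fun x : R3 => Complex.ofReal (‖x‖ ^ 2)).HasTemperateGrowth :=
    Function.Complex.hasTemperateGrowth_ofReal.comp (Function.hasTemperateGrowth_norm_sq R3)
  have hq : (((2 * Real.pi) ^ 2 : ℂ) • (fun x : R3 => Complex.ofReal (‖x‖ ^ 2))).HasTemperateGrowth :=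
    (Function.HasTemperateGrowth.const _).mul hp
  have h2 : besselSymbol 2 = (fun _ => 1) + ((2 * Real.pi) ^ 2 : ℂ) •
      (fun x : R3 => Complex.ofReal (‖x‖ ^ 2)) := by
    ext ξ
    rw [besselSymbol_two, norm_smul, Real.norm_of_nonneg (by positivity)]
    simp [mul_pow]
  have h3 : bessel 2 u = u + ((2 * Real.pi) ^ 2 : ℂ) •
      TemperedDistribution.fourierMultiplierCLM C4 (fun x : R3 => Complex.ofReal (‖x‖ ^ 2)) u := by
    have h4 : bessel 2 u = FourierTransform.fourierInv
        (TemperedDistribution.smulLeftCLM C4 (besselSymbol 2) (𝓕 u)) := rfl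
    rw [h4, h2, TemperedDistribution.smulLeftCLM_add (Function.HasTemperateGrowth.const 1) hq,
      TemperedDistribution.smulLeftCLM_smul hp, add_apply, smul_apply,
      TemperedDistribution.smulLeftCLM_const, one_smul, FourierTransform.fourierInv_add,
      FourierTransform.fourierInv_smul, FourierTransform.fourierInv_fourier_eq]
    rfl
  rw [h1, h3, TemperedDistribution.laplacian_eq_fourierMultiplierCLM, add_sub_cancel_left,
    ← Complex.coe_smul, ← neg_smul]
  congr 1
  push_cast
  ring

/-! ### The resolvents of `-Δ` and of the Dirac operator -/

theorem IsResolvent.unique {T : L2 →ₗ.[ℂ] L2} {z : ℂ} {R S : L2 →L[ℂ] L2}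
    (hR : IsResolvent T z R) (hS : IsResolvent T z S) : R = S := by
  ext1 f
  obtain ⟨h, hf⟩ := hS.1 f
  have := hR.2 ⟨S f, h⟩
  rw [hf] at this
  exact this

theorem IsResolvent.resolventOp_eq {T : L2 →ₗ.[ℂ] L2} {z : ℂ} {R : L2 →L[ℂ] L2}
    (hR : IsResolvent T z R) : resolventOp T z = R := by
  have h : ∃ R, IsResolvent T z R := ⟨R, hR⟩
  rw [resolventOp, dif_pos h]
  exact h.choose_spec.unique hR

theorem mem_weightedSobolev_zero_right {μ : ℝ} {u : Distr} :
    u ∈ weightedSobolev μ 0 ↔ ∃ g : L2, ofL2 g = bessel μ u := by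
  simp [weightedSobolev, weightedBessel, mulWeight_zero]

theorem bessel_multOp {μ : ℝ} {b : R3 → ℂ} (hb : IsBddMeas b)
    (hab : IsBddMeas (fun ξ => besselSymbol μ ξ * b ξ)) (f : L2) :
    bessel μ (ofL2 (multOp b f)) = ofL2 (multOp (fun ξ => besselSymbol μ ξ * b ξ) f) :=
  fourierMultiplierCLM_ofL2 (besselSymbol_hasTemperateGrowth μ) hb hab f

/-- With p = |2πξ|² this is 1 + p = (p - ζ) + (1 + ζ) divided by p - ζ; it is the reason why the
gain of two derivatives follows from the L² theory. -/
theorem besselSymbol_two_eq (ξ : R3) {ζ : ℂ} (hζ : ¬ ∃ r : ℝ, 0 ≤ r ∧ ζ = r) :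
    besselSymbol 2 ξ * resSymbol ζ ξ = 1 + (1 + ζ) * resSymbol ζ ξ := by
  have := sub_ne_zero_of_not_nonneg hζ ξ
  rw [besselSymbol_two, resSymbol]
  field_simp
  ring

theorem bessel_two_resSymbol {ζ : ℂ} (hζ : ¬ ∃ r : ℝ, 0 ≤ r ∧ ζ = r) (f : L2) :
    bessel 2 (ofL2 (multOp (resSymbol ζ) f)) = ofL2 (f + (1 + ζ) • multOp (resSymbol ζ) f) := by
  have hb := resSymbol_isBddMeas hζ
  rw [bessel_multOp hb (besselSymbol_mul_resSymbol_isBddMeas hζ)]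
  simp_rw [fun ξ => besselSymbol_two_eq ξ hζ]
  rw [multOp_add (IsBddMeas.const 1) (hb.const_mul _), multOp_const_mul _ hb, add_apply, multOp_one,
    smul_apply]

theorem negLaplaceDistr_resSymbol {ζ : ℂ} (hζ : ¬ ∃ r : ℝ, 0 ≤ r ∧ ζ = r) (f : L2) :
    negLaplaceDistr (ofL2 (multOp (resSymbol ζ) f)) = ofL2 (f + ζ • multOp (resSymbol ζ) f) := by
  rw [negLaplaceDistr_eq, bessel_two_resSymbol hζ, ← map_sub]
  congr 1
  module

/-- The left inverse property in a form that assumes only a distributional equation. It gives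
injectivity of -Δ - ζ, and through H₀² = -Δ also that of H₀ - z. -/
theorem eq_multOp_resSymbol {ζ : ℂ} (hζ : ¬ ∃ r : ℝ, 0 ≤ r ∧ ζ = r) {g k : L2}
    (h : negLaplaceDistr (ofL2 g) = ofL2 (k + ζ • g)) : multOp (resSymbol ζ) k = g := by
  have hb := resSymbol_isBddMeas hζ
  have hb2 := besselSymbol_isBddMeas (t := -2) (by norm_num)
  have h1 : bessel 2 (ofL2 g) = ofL2 (k + (1 + ζ) • g) := by
    rw [negLaplaceDistr_eq, sub_eq_iff_eq_add, ← map_add] at h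
    rw [h]
    congr 1
    module
  have h2 : g = multOp (besselSymbol (-2)) (k + (1 + ζ) • g) := by
    apply ofL2_injective
    rw [← bessel_ofL2_of_nonpos (by norm_num), ← h1, bessel_bessel, add_neg_cancel, bessel_zero]
  have h3 : ofL2 (multOp (resSymbol ζ) (k + (1 + ζ) • g)) = ofL2 (g + (1 + ζ) • multOp (resSymbol ζ) g) := by
    rw [← bessel_two_resSymbol hζ]
    -- Writing g as ⟨D⟩⁻² of an L² function lets ⟨D⟩² cancel through the resolvent, since
    -- multipliers commute.
    conv_rhs => rw [h2]
    rw [multOp_multOp hb hb2]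
    have h4 : (fun ξ => besselSymbol 2 ξ * (resSymbol ζ ξ * besselSymbol (-2) ξ)) = resSymbol ζ := by
      ext ξ
      rw [mul_left_comm, mul_comm (besselSymbol 2 ξ), besselSymbol_neg_mul, mul_one]
    rw [bessel_multOp (hb.mul hb2) (by rwa [h4]), h4]
  have h5 := ofL2_injective h3
  rw [map_add, map_smul] at h5
  exact add_right_cancel h5

theorem mem_domain_l2Realization (T : Distr →ₗ[ℂ] Distr) (μ : ℝ)
    (hT : ∀ u ∈ weightedSobolev μ 0, T u ∈ LinearMap.range ofL2) (g : L2) :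
    g ∈ (l2Realization T μ hT).domain ↔ ofL2 g ∈ weightedSobolev μ 0 := by
  have h : (l2Realization T μ hT).domain = (weightedSobolev μ 0).comap ofL2 := rfl
  rw [h, Submodule.mem_comap]

theorem mem_domain_negLaplaceOp (g : L2) :
    g ∈ negLaplaceOp.domain ↔ ∃ k : L2, ofL2 k = bessel 2 (ofL2 g) := by
  rw [negLaplaceOp, mem_domain_l2Realization, mem_weightedSobolev_zero_right]

theorem mem_domain_diracOp (g : L2) :
    g ∈ diracOp.domain ↔ ∃ k : L2, ofL2 k = bessel 1 (ofL2 g) := by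
  rw [diracOp, mem_domain_l2Realization, mem_weightedSobolev_zero_right]

theorem ofL2_negLaplaceOp (g : negLaplaceOp.domain) :
    ofL2 (negLaplaceOp g) = negLaplaceDistr (ofL2 (g : L2)) :=
  ofL2_l2Realization negLaplaceDistr 2 (fun _ => negLaplaceDistr_mem) g

theorem ofL2_diracOp (g : diracOp.domain) : ofL2 (diracOp g) = diracDistr (ofL2 (g : L2)) :=
  ofL2_l2Realization diracDistr 1 (fun _ => diracDistr_mem) g

theorem isResolvent_negLaplaceOp {ζ : ℂ} (hζ : ¬ ∃ r : ℝ, 0 ≤ r ∧ ζ = r) :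
    IsResolvent negLaplaceOp ζ (multOp (resSymbol ζ)) := by
  refine ⟨fun f => ?_, fun g => ?_⟩
  · have h : multOp (resSymbol ζ) f ∈ negLaplaceOp.domain :=
      (mem_domain_negLaplaceOp _).2 ⟨_, (bessel_two_resSymbol hζ f).symm⟩
    refine ⟨h, ?_⟩
    apply ofL2_injective
    rw [map_sub, ofL2_negLaplaceOp, negLaplaceDistr_resSymbol hζ, ← map_sub, add_sub_cancel_right]
  · apply eq_multOp_resSymbol hζ
    rw [sub_add_cancel, ofL2_negLaplaceOp]

theorem laplaceResolvent_eq {ζ : ℂ} (hζ : ¬ ∃ r : ℝ, 0 ≤ r ∧ ζ = r) :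
    laplaceResolvent ζ = multOp (resSymbol ζ) := (isResolvent_negLaplaceOp hζ).resolventOp_eq

/-! ### The L² resolvent of the Dirac operator -/

/-- `αⱼ` as an operator on `L²`. -/
def alphaL2 (j : Fin 3) : L2 →L[ℂ] L2 := (alphaOp j).compLpL 2 volume

theorem alphaL2_coeFn (j : Fin 3) (f : L2) : alphaL2 j f =ᵐ[volume] fun x => alphaOp j (f x) :=
  (alphaOp j).coeFn_compLpL f

theorem alphaDistr_ofL2 (j : Fin 3) (f : L2) : alphaDistr j (ofL2 f) = ofL2 (alphaL2 j f) := by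
  ext1 φ
  have hi : Integrable (fun x => φ x • f x) volume :=
    memLp_one_iff_integrable.mp ((Lp.memLp f).smul (φ.memLp 2 (volume : Measure R3)) (r := 1))
  have h4 : alphaDistr j (ofL2 f) φ = alphaOp j (∫ x, φ x • f x) :=
    congrArg (alphaOp j) (ofL2_apply f φ)
  rw [h4, ofL2_apply, ← ContinuousLinearMap.integral_comp_comm _ hi]
  apply integral_congr_ae
  filter_upwards [alphaL2_coeFn j f] with x hx
  rw [hx, map_smul]

theorem alphaL2_mulOp (j : Fin 3) {b : R3 → ℂ} (hb : IsBddMeas b) (f : L2) :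
    alphaL2 j (mulOp b f) = mulOp b (alphaL2 j f) := by
  apply Lp.ext
  filter_upwards [alphaL2_coeFn j (mulOp b f), mulOp_coeFn hb f, mulOp_coeFn hb (alphaL2 j f),
    alphaL2_coeFn j f] with x h1 h2 h3 h4
  rw [h1, h2, h3, h4, map_smul]

theorem momSymbol_measurable (j : Fin 3) : Measurable (momSymbol j) :=
  (momSymbol_hasTemperateGrowth j).1.continuous.measurable

theorem momSymbol_mul_bessel_isBddMeas (j : Fin 3) :
    IsBddMeas (fun ξ => momSymbol j ξ * besselSymbol (-1) ξ) := by
  refine ⟨(momSymbol_measurable j).mul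
    (besselSymbol_hasTemperateGrowth (-1)).1.continuous.measurable, 1, fun ξ => ?_⟩
  have h1 : ‖momSymbol j ξ‖ ≤ ‖(2 * Real.pi) • ξ‖ := by
    have h2 := norm_inner_le_norm (𝕜 := ℝ) ξ (EuclideanSpace.single j (1 : ℝ) : R3)
    rw [PiLp.norm_single, norm_one, mul_one] at h2
    rw [momSymbol, norm_smul, norm_mul, Complex.norm_real]
    gcongr
    simp
  have h3 : ‖(2 * Real.pi) • ξ‖ ≤ (1 + ‖(2 * Real.pi) • ξ‖ ^ 2) ^ (1 / 2 : ℝ) := by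
    rw [← Real.sqrt_eq_rpow]
    apply Real.le_sqrt_of_sq_le
    linarith
  rw [norm_mul, besselSymbol, norm_weight, neg_div, Real.rpow_neg (by positivity),
    mul_inv_le_iff₀ (by positivity), one_mul]
  exact h1.trans h3

theorem besselSymbol_neg_one_mul (ξ : R3) :
    besselSymbol (-1) ξ * besselSymbol (-1) ξ = besselSymbol (-2) ξ := by
  have := congrFun (besselSymbol_mul (-1) (-1)) ξ
  norm_num at this
  exact this

theorem momSymbol_mul_resSymbol_isBddMeas (j : Fin 3) {ζ : ℂ} (hζ : ¬ ∃ r : ℝ, 0 ≤ r ∧ ζ = r) :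
    IsBddMeas (fun ξ => momSymbol j ξ * resSymbol ζ ξ) := by
  have h := ((momSymbol_mul_bessel_isBddMeas j).mul
    (besselSymbol_isBddMeas (t := -1) (by norm_num))).besselSymbol_mul hζ
  refine cast (congrArg IsBddMeas (funext fun ξ => ?_)) h
  linear_combination (momSymbol j ξ * besselSymbol 2 ξ * resSymbol ζ ξ) * besselSymbol_neg_one_mul ξ
    + (momSymbol j ξ * resSymbol ζ ξ) * besselSymbol_neg_mul 2 ξ

theorem besselSymbol_one (ξ : R3) : besselSymbol 1 ξ = besselSymbol (-1) ξ * besselSymbol 2 ξ := by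
  have := congrFun (besselSymbol_mul (-1) 2) ξ
  norm_num at this
  exact this.symm

theorem besselSymbol_one_mul_resSymbol_isBddMeas {ζ : ℂ} (hζ : ¬ ∃ r : ℝ, 0 ≤ r ∧ ζ = r) :
    IsBddMeas (fun ξ => besselSymbol 1 ξ * resSymbol ζ ξ) := by
  refine cast (congrArg IsBddMeas (funext fun ξ => ?_))
    ((besselSymbol_isBddMeas (t := -1) (by norm_num)).besselSymbol_mul hζ)
  rw [besselSymbol_one]
  ring

theorem besselSymbol_one_mul_momSymbol_mul_resSymbol_isBddMeas (j : Fin 3) {ζ : ℂ}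
    (hζ : ¬ ∃ r : ℝ, 0 ≤ r ∧ ζ = r) :
    IsBddMeas (fun ξ => besselSymbol 1 ξ * (momSymbol j ξ * resSymbol ζ ξ)) := by
  refine cast (congrArg IsBddMeas (funext fun ξ => ?_))
    ((momSymbol_mul_bessel_isBddMeas j).besselSymbol_mul hζ)
  rw [besselSymbol_one]
  ring

theorem bessel_alphaDistr (μ : ℝ) (j : Fin 3) (u : Distr) :
    bessel μ (alphaDistr j u) = alphaDistr j (bessel μ u) := by
  ext1 φ
  rfl

theorem diracDistr_multOp {b : R3 → ℂ} (hb : IsBddMeas b)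
    (hab : ∀ j, IsBddMeas (fun ξ => momSymbol j ξ * b ξ)) (f : L2) :
    diracDistr (ofL2 (multOp b f))
      = ofL2 (∑ j, alphaL2 j (multOp (fun ξ => momSymbol j ξ * b ξ) f)) := by
  rw [diracDistr_apply, map_sum]
  refine Finset.sum_congr rfl fun j _ => ?_
  rw [momentum_eq, fourierMultiplierCLM_ofL2 (momSymbol_hasTemperateGrowth j) hb (hab j),
    alphaDistr_ofL2]

/-- The operator `(H₀ + z)(-Δ - z²)⁻¹` on `L²`. -/
def diracRes (z : ℂ) : L2 →L[ℂ] L2 :=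
  ∑ j, alphaL2 j ∘L multOp (fun ξ => momSymbol j ξ * resSymbol (z ^ 2) ξ)
    + z • multOp (resSymbol (z ^ 2))

theorem ofL2_diracRes {z : ℂ} (hz : z.im ≠ 0) (f : L2) :
    ofL2 (diracRes z f) = diracDistr (ofL2 (multOp (resSymbol (z ^ 2)) f))
      + z • ofL2 (multOp (resSymbol (z ^ 2)) f) := by
  have hζ := sq_not_nonneg hz
  rw [diracDistr_multOp (resSymbol_isBddMeas hζ) (fun j => momSymbol_mul_resSymbol_isBddMeas j hζ),
    diracRes, add_apply, map_add, smul_apply, map_smul, sum_apply]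
  rfl

/-- With G = (-Δ-z²)⁻¹: H₀(H₀+z)G = -ΔG + zH₀G = 1 + z²G + zH₀G = 1 + z(H₀+z)G. -/
theorem diracDistr_diracRes {z : ℂ} (hz : z.im ≠ 0) (f : L2) :
    diracDistr (ofL2 (diracRes z f)) = ofL2 (f + z • diracRes z f) := by
  have hζ := sq_not_nonneg hz
  rw [ofL2_diracRes hz, map_add, diracDistr_diracDistr, negLaplaceDistr_resSymbol hζ, map_smul,
    map_add, map_add, map_smul, map_smul, ofL2_diracRes hz, smul_add, smul_smul, sq, add_assoc,
    add_comm (_ • diracDistr _)]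

theorem diracRes_mem_domain {z : ℂ} (hz : z.im ≠ 0) (f : L2) : diracRes z f ∈ diracOp.domain := by
  have hζ := sq_not_nonneg hz
  refine (mem_domain_diracOp _).2
    ⟨∑ j, alphaL2 j (multOp (fun ξ => besselSymbol 1 ξ * (momSymbol j ξ * resSymbol (z ^ 2) ξ)) f)
      + z • multOp (fun ξ => besselSymbol 1 ξ * resSymbol (z ^ 2) ξ) f, ?_⟩
  rw [diracRes, add_apply, sum_apply, smul_apply, map_add, map_add, map_add, map_smul, map_smul,
    map_smul, bessel_multOp (resSymbol_isBddMeas hζ)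
      (besselSymbol_one_mul_resSymbol_isBddMeas hζ), map_sum, map_sum, map_sum]
  congr 1
  refine Finset.sum_congr rfl fun j _ => ?_
  rw [ContinuousLinearMap.comp_apply, ← alphaDistr_ofL2, ← alphaDistr_ofL2, bessel_alphaDistr,
    bessel_multOp (momSymbol_mul_resSymbol_isBddMeas j hζ)
      (besselSymbol_one_mul_momSymbol_mul_resSymbol_isBddMeas j hζ)]

/-- For the left inverse, the error u satisfies H₀u = zu, hence -Δu = z²u, and z² ∉ [0,∞) forces u =
0. -/
theorem isResolvent_diracOp {z : ℂ} (hz : z.im ≠ 0) : IsResolvent diracOp z (diracRes z) := by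
  have hζ := sq_not_nonneg hz
  refine ⟨fun f => ⟨diracRes_mem_domain hz f, ?_⟩, fun g => ?_⟩
  · apply ofL2_injective
    rw [map_sub, ofL2_diracOp, diracDistr_diracRes hz, ← map_sub, add_sub_cancel_right]
  · set k := diracOp g - z • (g : L2) with hk
    have h1 : diracDistr (ofL2 (g : L2)) = ofL2 (k + z • (g : L2)) := by
      rw [hk, sub_add_cancel, ofL2_diracOp]
    set u : L2 := diracRes z k - g with hu
    have h2 : diracDistr (ofL2 u) = ofL2 (z • u) := by
      rw [hu, map_sub, map_sub, diracDistr_diracRes hz, h1, ← map_sub]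
      congr 1
      module
    have h3 : negLaplaceDistr (ofL2 u) = ofL2 (0 + z ^ 2 • u) := by
      rw [← diracDistr_diracDistr, h2, map_smul, map_smul, h2, map_smul, map_add, map_zero,
        map_smul, zero_add, smul_smul, sq]
    have h4 := eq_multOp_resSymbol hζ h3
    rw [map_zero] at h4
    exact sub_eq_zero.1 h4.symm

theorem diracResolvent_eq {z : ℂ} (hz : z.im ≠ 0) : diracResolvent z = diracRes z :=
  (isResolvent_diracOp hz).resolventOp_eq

section

variable {s s' : ℝ}

/-! ### Continuous families up to the real line -/

theorem upper_subset_closure : {z : ℂ | 0 ≤ z.im} ⊆ closure {z : ℂ | 0 < z.im} := by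
  rw [Complex.closure_setOfPred_lt_im]

/-- The continuous extension to the closed upper half plane of the family of operators
`⟨x⟩^{-s'} m(D) (1 - Δ) (-Δ - z²)⁻¹ ⟨x⟩^{-s}` in `L²`. -/
def resFamily (s s' : ℝ) (m : R3 → ℂ) : ℂ → L2 →L[ℂ] L2 :=
  extendFrom {z : ℂ | 0 < z.im}
    (fun z => weightedMult s s' (fun ξ => m ξ * (besselSymbol 2 ξ * resSymbol (z ^ 2) ξ)))

theorem weightedMult_bessel_resSymbol {m : R3 → ℂ} (hmb : IsBddMeas m) {z : ℂ} (hz : 0 < z.im) :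
    weightedMult s s' (fun ξ => m ξ * (besselSymbol 2 ξ * resSymbol (z ^ 2) ξ))
      = weightedMult s s' m
        + (1 + z ^ 2) • weightedMult s s' (fun ξ => m ξ * resSymbol (z ^ 2) ξ) := by
  have hζ := sq_not_nonneg hz.ne'
  have hb := hmb.mul (resSymbol_isBddMeas hζ)
  rw [← weightedMult_const_mul _ hb, ← weightedMult_add hmb (hb.const_mul _)]
  congr 1
  ext ξ
  rw [besselSymbol_two_eq ξ hζ]
  ring

theorem exists_tendsto_resFamily (hs : 1 / 2 < s) (hs' : 1 / 2 < s')
    (hss' : 2 < s + s') {m : R3 → ℂ} (hm : m.HasTemperateGrowth) (hmb : IsBddMeas m)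
    {z₀ : ℂ} (hz₀ : 0 ≤ z₀.im) :
    ∃ L, Tendsto (fun z : ℂ => weightedMult s s'
      (fun ξ => m ξ * (besselSymbol 2 ξ * resSymbol (z ^ 2) ξ))) (𝓝[{z | 0 < z.im}] z₀) (𝓝 L) := by
  obtain ⟨L, hL⟩ := exists_tendsto_weightedMult_mul_resSymbol hs hs' hss' hm hmb hz₀
  have hp : Tendsto (fun z : ℂ => 1 + z ^ 2) (𝓝[{z | 0 < z.im}] z₀) (𝓝 (1 + z₀ ^ 2)) :=
    (Continuous.tendsto (by fun_prop) z₀).mono_left nhdsWithin_le_nhds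
  refine ⟨_, ((tendsto_const_nhds (x := weightedMult s s' m)).add (hp.smul hL)).congr' ?_⟩
  filter_upwards [eventually_upper z₀] with z hz
  exact (weightedMult_bessel_resSymbol hmb hz).symm

theorem continuousOn_resFamily (hs : 1 / 2 < s) (hs' : 1 / 2 < s')
    (hss' : 2 < s + s') {m : R3 → ℂ} (hm : m.HasTemperateGrowth) (hmb : IsBddMeas m) :
    ContinuousOn (resFamily s s' m) {z | 0 ≤ z.im} :=
  continuousOn_extendFrom upper_subset_closure
    fun _ hz => exists_tendsto_resFamily hs hs' hss' hm hmb hz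

theorem resFamily_eq (hs : 1 / 2 < s) (hs' : 1 / 2 < s')
    (hss' : 2 < s + s') {m : R3 → ℂ} (hm : m.HasTemperateGrowth) (hmb : IsBddMeas m)
    {z : ℂ} (hz : 0 < z.im) : resFamily s s' m z
      = weightedMult s s' (fun ξ => m ξ * (besselSymbol 2 ξ * resSymbol (z ^ 2) ξ)) := by
  obtain ⟨L, hL⟩ := exists_tendsto_resFamily hs hs' hss' hm hmb hz.le
  -- The filter of the limit contains the point z itself, so the limit can only be the value there.
  have h1 := tendsto_nhds_unique (hL.mono_left (pure_le_nhdsWithin hz)) (tendsto_pure_nhds _ _)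
  exact extendFrom_eq (upper_subset_closure hz.le) (h1 ▸ hL)

theorem HSob.toDistr_conj_weightedMult (hs' : 0 ≤ s') {μ ν : ℝ} (b : R3 → ℂ)
    (u : HSob μ s) : (HSob.conj μ s ν (-s') (weightedMult s s' b) u).toDistr
      = bessel (-ν) (ofL2 (multOp b (mulOp (weight (-s)) u.toL2))) := by
  have h : ofL2 (weightedMult s s' b u.toL2)
      = mulWeight (-s') (ofL2 (multOp b (mulOp (weight (-s)) u.toL2))) :=
    (mulWeight_ofL2_of_nonpos (by linarith) _).symm
  rw [HSob.toDistr_conj, h, mulWeight_mulWeight, add_neg_cancel, mulWeight_zero]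

/-- The extended resolvent of `-Δ` at `z²`, as an operator from `H^{-1,s}` to `H^{1,-s'}`. -/
def laplaceExt (s s' : ℝ) (z : ℂ) : HSob (-1) s →L[ℂ] HSob 1 (-s') :=
  -- The factors ⟨D⟩ from source and target combine to ⟨D⟩², already built into `resFamily`, so m =
  -- 1.
  HSob.conj (-1) s 1 (-s') (resFamily s s' (fun _ => 1) z)

/-- The extended resolvent of `-Δ` at `z²`, as an operator from `H^{-1,s}` to `L^{2,-s'}`. -/
def laplaceExtIncl (s s' : ℝ) (z : ℂ) : HSob (-1) s →L[ℂ] HSob 0 (-s') :=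
  -- The target has no factor ⟨D⟩, so one of the two built-in factors is undone by m = ⟨D⟩⁻¹.
  HSob.conj (-1) s 0 (-s') (resFamily s s' (besselSymbol (-1)) z)

/-- The product of the Dirac operator and the extended resolvent of `-Δ` at `z²`. -/
def diracLaplaceExt (s s' : ℝ) (z : ℂ) : HSob (-1) s →L[ℂ] HSob 0 (-s') :=
  HSob.conj (-1) s 0 (-s')
    -- One power of ⟨D⟩ is traded for the momentum; the αⱼ are constant matrices and commute with
    -- the scalar weights.
    (∑ j, alphaL2 j ∘L resFamily s s' (fun ξ => momSymbol j ξ * besselSymbol (-1) ξ) z)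

theorem besselSymbol_neg_one_isBddMeas : IsBddMeas (besselSymbol (-1)) :=
  besselSymbol_isBddMeas (by norm_num)

theorem momSymbol_mul_bessel_hasTemperateGrowth (j : Fin 3) :
    (fun ξ => momSymbol j ξ * besselSymbol (-1) ξ).HasTemperateGrowth :=
  (momSymbol_hasTemperateGrowth j).mul (besselSymbol_hasTemperateGrowth (-1))

theorem continuousOn_laplaceExt (hs : 1 / 2 < s) (hs' : 1 / 2 < s') (hss' : 2 < s + s') :
    ContinuousOn (laplaceExt s s') {z | 0 ≤ z.im} :=
  (HSob.continuous_conj _ _ _ _).comp_continuousOn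
    (continuousOn_resFamily hs hs' hss' (Function.HasTemperateGrowth.const 1) (IsBddMeas.const 1))

theorem continuousOn_laplaceExtIncl (hs : 1 / 2 < s) (hs' : 1 / 2 < s') (hss' : 2 < s + s') :
    ContinuousOn (laplaceExtIncl s s') {z | 0 ≤ z.im} :=
  (HSob.continuous_conj _ _ _ _).comp_continuousOn
    (continuousOn_resFamily hs hs' hss' (besselSymbol_hasTemperateGrowth (-1))
      besselSymbol_neg_one_isBddMeas)

theorem continuousOn_diracLaplaceExt (hs : 1 / 2 < s) (hs' : 1 / 2 < s') (hss' : 2 < s + s') :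
    ContinuousOn (diracLaplaceExt s s') {z | 0 ≤ z.im} := by
  refine (HSob.continuous_conj _ _ _ _).comp_continuousOn ?_
  refine continuousOn_finsetSum _ fun j _ => ?_
  exact (ContinuousLinearMap.compL ℂ L2 L2 L2 (alphaL2 j)).continuous.comp_continuousOn
    (continuousOn_resFamily hs hs' hss' (momSymbol_mul_bessel_hasTemperateGrowth j)
      (momSymbol_mul_bessel_isBddMeas j))

/-- The function `⟨D⟩ (-Δ - z²)⁻¹ ⟨x⟩^{-s} f`. -/
def resolventFun (s : ℝ) (z : ℂ) (f : L2) : L2 :=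
  multOp (fun ξ => besselSymbol (-1) ξ * (besselSymbol 2 ξ * resSymbol (z ^ 2) ξ))
    (mulOp (weight (-s)) f)

theorem toDistr_laplaceExt (hs : 1 / 2 < s) (hs' : 1 / 2 < s') (hss' : 2 < s + s') {z : ℂ}
    (hz : 0 < z.im) (u : HSob (-1) s) :
    (laplaceExt s s' z u).toDistr = ofL2 (resolventFun s z u.toL2) := by
  have hb := (besselSymbol_mul_resSymbol_isBddMeas (sq_not_nonneg hz.ne'))
  rw [laplaceExt, resFamily_eq hs hs' hss' (Function.HasTemperateGrowth.const 1)
    (IsBddMeas.const 1) hz, HSob.toDistr_conj_weightedMult (by linarith)]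
  simp only [one_mul]
  rw [bessel_ofL2_of_nonpos (by norm_num), multOp_multOp besselSymbol_neg_one_isBddMeas hb]
  rfl

theorem toDistr_laplaceExtIncl (hs : 1 / 2 < s) (hs' : 1 / 2 < s') (hss' : 2 < s + s') {z : ℂ}
    (hz : 0 < z.im) (u : HSob (-1) s) :
    (laplaceExtIncl s s' z u).toDistr = ofL2 (resolventFun s z u.toL2) := by
  rw [laplaceExtIncl, resFamily_eq hs hs' hss' (besselSymbol_hasTemperateGrowth (-1))
    besselSymbol_neg_one_isBddMeas hz, HSob.toDistr_conj_weightedMult (by linarith), neg_zero,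
    bessel_zero]
  rfl

theorem sum_alphaL2_weightedMult (hs' : 0 ≤ s') (b : Fin 3 → R3 → ℂ) :
    ∑ j, alphaL2 j ∘L weightedMult s s' (b j)
      = mulOp (weight (-s')) ∘L (∑ j, alphaL2 j ∘L multOp (b j)) ∘L mulOp (weight (-s)) := by
  ext1 f
  simp only [sum_apply, ContinuousLinearMap.comp_apply, weightedMult, map_sum]
  refine Finset.sum_congr rfl fun j _ => ?_
  rw [alphaL2_mulOp j (weight_isBddMeas (by linarith))]

theorem toDistr_diracLaplaceExt (hs : 1 / 2 < s) (hs' : 1 / 2 < s') (hss' : 2 < s + s') {z : ℂ}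
    (hz : 0 < z.im) (u : HSob (-1) s) :
    (diracLaplaceExt s s' z u).toDistr = diracDistr (ofL2 (resolventFun s z u.toL2)) := by
  have hζ := sq_not_nonneg hz.ne'
  have h1 : ∀ j, resFamily s s' (fun ξ => momSymbol j ξ * besselSymbol (-1) ξ) z
      = weightedMult s s' (fun ξ => momSymbol j ξ *
        (besselSymbol (-1) ξ * (besselSymbol 2 ξ * resSymbol (z ^ 2) ξ))) := by
    intro j
    rw [resFamily_eq hs hs' hss' (momSymbol_mul_bessel_hasTemperateGrowth j)
      (momSymbol_mul_bessel_isBddMeas j) hz]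
    simp only [mul_assoc]
  have h2 : ∀ j, IsBddMeas (fun ξ => momSymbol j ξ *
      (besselSymbol (-1) ξ * (besselSymbol 2 ξ * resSymbol (z ^ 2) ξ))) := by
    intro j
    simpa only [mul_assoc] using (momSymbol_mul_bessel_isBddMeas j).besselSymbol_mul hζ
  rw [diracLaplaceExt, HSob.toDistr_conj]
  simp only [h1]
  rw [sum_alphaL2_weightedMult (by linarith), ContinuousLinearMap.comp_apply,
    ← mulWeight_ofL2_of_nonpos (by linarith), mulWeight_mulWeight, add_neg_cancel, mulWeight_zero,
    neg_zero, bessel_zero, resolventFun,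
    diracDistr_multOp (besselSymbol_neg_one_isBddMeas.besselSymbol_mul hζ) h2,
    ContinuousLinearMap.comp_apply, sum_apply]
  rfl

theorem continuous_diracDistr : Continuous diracDistr := by
  have h1 : (diracDistr : Distr → Distr) = fun u => ∑ j, alphaDistr j (momentum j u) :=
    funext diracDistr_apply
  rw [h1]
  refine continuous_finsetSum _ fun j _ => ?_
  have h2 : Continuous (momentum j) :=
    (ContinuousLinearMap.continuous (LineDeriv.lineDerivOpCLM ℂ Distr
      (EuclideanSpace.single j (1 : ℝ) : R3))).const_smul (-Complex.I)
  exact (ContinuousLinearMap.continuous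
    (PointwiseConvergenceCLM.postcomp 𝓢(R3, ℂ) (alphaOp j))).comp h2

theorem continuousOn_toDistr_apply {ν t : ℝ} {T : ℂ → (HSob (-1) s →L[ℂ] HSob ν t)} {D : Set ℂ}
    (hT : ContinuousOn T D) (u : HSob (-1) s) : ContinuousOn (fun z => (T z u).toDistr) D :=
  (HSob.continuous_toDistr ν t).comp_continuousOn (hT.clm_apply continuousOn_const)

/-- Both families are continuous into S' up to the real line, and for Im z > 0 both are the same
explicit L² function. -/
theorem laplaceExtIncl_eq (hs : 1 / 2 < s) (hs' : 1 / 2 < s') (hss' : 2 < s + s') {z : ℂ}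
    (hz : 0 ≤ z.im) (u : HSob (-1) s) :
    (laplaceExtIncl s s' z u).toDistr = (laplaceExt s s' z u).toDistr := by
  have h : Set.EqOn (fun z => (laplaceExtIncl s s' z u).toDistr)
      (fun z => (laplaceExt s s' z u).toDistr) {z | 0 < z.im} := fun z hz => by
    beta_reduce
    rw [toDistr_laplaceExtIncl hs hs' hss' hz, toDistr_laplaceExt hs hs' hss' hz]
  exact h.of_subset_closure
    (continuousOn_toDistr_apply (continuousOn_laplaceExtIncl hs hs' hss') u)
    (continuousOn_toDistr_apply (continuousOn_laplaceExt hs hs' hss') u)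
    (fun _ h => le_of_lt (α := ℝ) h) upper_subset_closure hz

theorem diracLaplaceExt_eq (hs : 1 / 2 < s) (hs' : 1 / 2 < s') (hss' : 2 < s + s') {z : ℂ}
    (hz : 0 ≤ z.im) (u : HSob (-1) s) :
    (diracLaplaceExt s s' z u).toDistr = diracDistr (laplaceExt s s' z u).toDistr := by
  have h : Set.EqOn (fun z => (diracLaplaceExt s s' z u).toDistr)
      (fun z => diracDistr (laplaceExt s s' z u).toDistr) {z | 0 < z.im} := fun z hz => by
    beta_reduce
    rw [toDistr_diracLaplaceExt hs hs' hss' hz, toDistr_laplaceExt hs hs' hss' hz]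
  exact h.of_subset_closure
    (continuousOn_toDistr_apply (continuousOn_diracLaplaceExt hs hs' hss') u)
    (continuous_diracDistr.comp_continuousOn
      (continuousOn_toDistr_apply (continuousOn_laplaceExt hs hs' hss') u))
    (fun _ h => le_of_lt (α := ℝ) h) upper_subset_closure hz

/-! ### The extension property -/

/-- For u given by f ∈ L² the weights cancel, ⟨x⟩^{-s}⟨x⟩^s⟨D⟩⁻¹f = ⟨D⟩⁻¹f, and then so do the
Bessel factors. -/
theorem resolventFun_eq {z : ℂ} (hz : z.im ≠ 0) (hs : 0 ≤ s) {f : L2} {u : HSob (-1) s}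
    (h : u.toDistr = ofL2 f) : resolventFun s z u.toL2 = multOp (resSymbol (z ^ 2)) f := by
  have hζ := sq_not_nonneg hz
  have h1 : mulOp (weight (-s)) u.toL2 = multOp (besselSymbol (-1)) f := by
    apply ofL2_injective
    rw [← mulWeight_ofL2_of_nonpos (by linarith), ← bessel_ofL2_of_nonpos (by norm_num), ← h,
      HSob.toDistr_eq, bessel_bessel, neg_neg, add_neg_cancel, bessel_zero]
  rw [resolventFun, h1, multOp_multOp (besselSymbol_neg_one_isBddMeas.besselSymbol_mul hζ)
    besselSymbol_neg_one_isBddMeas]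
  congr 1
  have h2 : (fun ξ => besselSymbol (-1) ξ * (besselSymbol 2 ξ * resSymbol (z ^ 2) ξ)
      * besselSymbol (-1) ξ) = resSymbol (z ^ 2) := by
    funext ξ
    linear_combination (besselSymbol 2 ξ * resSymbol (z ^ 2) ξ) * besselSymbol_neg_one_mul ξ
      + resSymbol (z ^ 2) ξ * besselSymbol_neg_mul 2 ξ
  rw [h2]

theorem Extends.unique {μ ν t : ℝ} {S T : HSob μ s →L[ℂ] HSob ν t} {B : L2 →L[ℂ] L2}
    (hS : Extends S B) (hT : Extends T B) : S = T := by
  refine HSob.clm_ext_schwartz fun f => HSob.toDistr_injective ?_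
  have h : (schwartzToHSob μ s f).toDistr = ofL2 (f.toLp 2) := (ofL2_toLp f).symm
  rw [hS _ _ h, hT _ _ h]

theorem extends_laplaceExt (hs : 1 / 2 < s) (hs' : 1 / 2 < s') (hss' : 2 < s + s') {z : ℂ}
    (hz : 0 < z.im) : Extends (laplaceExt s s' z) (laplaceResolvent (z ^ 2)) := by
  intro f u h
  rw [toDistr_laplaceExt hs hs' hss' hz, resolventFun_eq hz.ne' (by linarith) h,
    laplaceResolvent_eq (sq_not_nonneg hz.ne')]

/-- Two parameters, since Γ₀ depends only on z²: w = z serves the upper half plane and w = -z the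
lower one. -/
theorem extends_dirac {z w : ℂ} (hs : 1 / 2 < s) (hs' : 1 / 2 < s') (hss' : 2 < s + s')
    (hw : 0 < w.im) (hzw : w ^ 2 = z ^ 2) (hz : z.im ≠ 0) :
    Extends (diracLaplaceExt s s' w + z • laplaceExtIncl s s' w) (diracResolvent z) := by
  intro f u h
  rw [diracResolvent_eq hz, ofL2_diracRes hz, add_apply, smul_apply, map_add, map_smul,
    toDistr_diracLaplaceExt hs hs' hss' hw, toDistr_laplaceExtIncl hs hs' hss' hw,
    resolventFun_eq hw.ne' (by linarith) h, hzw]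

theorem toDistr_dirac {z w : ℂ} (hs : 1 / 2 < s) (hs' : 1 / 2 < s') (hss' : 2 < s + s')
    (hw : 0 ≤ w.im) (u : HSob (-1) s) :
    ((diracLaplaceExt s s' w + z • laplaceExtIncl s s' w) u).toDistr
      = diracDistr (laplaceExt s s' w u).toDistr + z • (laplaceExt s s' w u).toDistr := by
  rw [add_apply, smul_apply, map_add, map_smul, diracLaplaceExt_eq hs hs' hss' hw,
    laplaceExtIncl_eq hs hs' hss' hw]

end

section

variable {s s' : ℝ}

/-! ### Weakly singular kernels -/

theorem exists_integrable_inv_norm_pow_le {p : ℕ} (hp : p ≤ 2) :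
    ∃ K : R3 → ℝ, Integrable K ∧ Measurable K ∧ (∀ w, 0 ≤ K w) ∧
      ∀ w, (‖w‖ ^ p)⁻¹ ≤ K w + 1 := by
  -- The factor 2 compensates (1+|w|²)⁻¹ ≥ 1/2 on the unit ball; outside it the summand 1 suffices.
  refine ⟨fun w => 2 * ((‖w‖ ^ 2)⁻¹ * (1 + ‖w‖ ^ 2) ^ (-1 : ℝ)),
    (integrable_inv_norm_sq_mul_rpow (by norm_num)).const_mul 2, by fun_prop,
    fun w => by positivity, fun w => ?_⟩
  rcases le_total 1 ‖w‖ with h | h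
  · have h1 : (‖w‖ ^ p)⁻¹ ≤ 1 := inv_le_one_of_one_le₀ (one_le_pow₀ h)
    have h2 : 0 ≤ 2 * ((‖w‖ ^ 2)⁻¹ * (1 + ‖w‖ ^ 2) ^ (-1 : ℝ)) := by positivity
    linarith
  · rcases (norm_nonneg w).eq_or_lt with h0 | h0
    · rw [← h0]
      rcases p.eq_zero_or_pos with rfl | hp0
      · rw [pow_zero, inv_one]
        exact le_add_of_nonneg_left (by positivity)
      · rw [zero_pow hp0.ne', inv_zero]
        positivity
    · have h1 : (‖w‖ ^ p)⁻¹ ≤ (‖w‖ ^ 2)⁻¹ :=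
        inv_anti₀ (by positivity) (pow_le_pow_of_le_one h0.le h hp)
      have h2 : 1 / 2 ≤ (1 + ‖w‖ ^ 2) ^ (-1 : ℝ) := by
        rw [Real.rpow_neg_one, ← one_div]
        apply one_div_le_one_div_of_le (by positivity)
        nlinarith
      have h3 : 0 ≤ (‖w‖ ^ 2)⁻¹ := by positivity
      nlinarith [mul_le_mul_of_nonneg_left h2 h3]

theorem integrable_mul_inv_norm_pow {g : R3 → ℝ} (hgi : Integrable g) {C : ℝ} (hC : ∀ x, ‖g x‖ ≤ C)
    {p : ℕ} (hp : p ≤ 2) (x : R3) : Integrable (fun y => g y * (‖x - y‖ ^ p)⁻¹) := by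
  obtain ⟨K, hK, hKm, hK0, hle⟩ := exists_integrable_inv_norm_pow_le hp
  have hb : Integrable (fun y => C * K (x - y) + ‖g y‖) :=
    ((hK.comp_sub_left x).const_mul C).add hgi.norm
  refine hb.mono' (hgi.1.mul (by fun_prop)) (.of_forall fun y => ?_)
  rw [norm_mul, Real.norm_of_nonneg (by positivity : 0 ≤ (‖x - y‖ ^ p)⁻¹)]
  nlinarith [mul_le_mul_of_nonneg_left (hle (x - y)) (norm_nonneg (g y)),
    mul_le_mul_of_nonneg_right (hC y) (hK0 (x - y))]

/-- The integrable part of |x-y|^{-p} is paired with the sup norm of g and the bounded part with its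
L¹ norm. -/
theorem integrable_prod_mul_inv_norm_pow {g h : R3 → ℝ} (hgi : Integrable g) (hhi : Integrable h)
    {C : ℝ} (hC : ∀ x, ‖g x‖ ≤ C) {p : ℕ} (hp : p ≤ 2) :
    Integrable (fun q : R3 × R3 => (g q.1 * h q.2) * (‖q.1 - q.2‖ ^ p)⁻¹)
      (volume.prod volume) := by
  obtain ⟨K, hK, hKm, hK0, hle⟩ := exists_integrable_inv_norm_pow_le hp
  have hA := hgi.mul_prod hhi
  have hB : Integrable (fun q : R3 × R3 => h q.2 * K (q.1 - q.2)) (volume.prod volume) :=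
    hhi.convolution_integrand (ContinuousLinearMap.mul ℝ ℝ) hK
  refine ((hB.norm.const_mul C).add hA.norm).mono' (hA.1.mul (by fun_prop))
    (.of_forall fun q => ?_)
  rw [Pi.add_apply, norm_mul, norm_mul, norm_mul, Real.norm_of_nonneg (hK0 _),
    Real.norm_of_nonneg (by positivity : 0 ≤ (‖q.1 - q.2‖ ^ p)⁻¹)]
  nlinarith [mul_le_mul_of_nonneg_left (hle (q.1 - q.2))
      (mul_nonneg (norm_nonneg (g q.1)) (norm_nonneg (h q.2))),
    mul_le_mul_of_nonneg_right (hC q.1) (mul_nonneg (norm_nonneg (h q.2)) (hK0 (q.1 - q.2)))]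

theorem exists_norm_le {E : Type*} [NormedAddCommGroup E] [NormedSpace ℝ E] (f : 𝓢(R3, E)) :
    ∃ C, ∀ x, ‖f x‖ ≤ C :=
  ⟨_, f.toBoundedContinuousFunction.norm_coe_le_norm⟩

/-- The kernel `k` applied to a Schwartz function is bounded by `c |x-y|^{-p} |f(y)|`. -/
def WeaklySingular (c : ℝ) (p : ℕ) (f : 𝓢(R3, C4)) (k : R3 → R3 → C4) : Prop :=
  Measurable (Function.uncurry k) ∧ ∀ x y, ‖k x y‖ ≤ c * (‖f y‖ * (‖x - y‖ ^ p)⁻¹)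

theorem WeaklySingular.integrable {c : ℝ} {p : ℕ} {f : 𝓢(R3, C4)} {k : R3 → R3 → C4}
    (hk : WeaklySingular c p f k) (hp : p ≤ 2) (x : R3) : Integrable (k x) := by
  obtain ⟨C, hC⟩ := exists_norm_le f
  exact ((integrable_mul_inv_norm_pow f.integrable.norm (C := C) (fun y => by simpa using hC y)
    hp x).const_mul c).mono' (hk.1.comp (measurable_prodMk_left (x := x))).aestronglyMeasurable
      (.of_forall fun y => hk.2 x y)

theorem integrable_weaklySingular_bound (c : ℝ) {p : ℕ} (f : 𝓢(R3, C4)) (hp : p ≤ 2)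
    (φ : 𝓢(R3, ℂ)) :
    Integrable (fun q : R3 × R3 => c * (‖φ q.1‖ * ‖f q.2‖ * (‖q.1 - q.2‖ ^ p)⁻¹))
      (volume.prod volume) := by
  obtain ⟨C, hC⟩ := exists_norm_le φ
  exact (integrable_prod_mul_inv_norm_pow φ.integrable.norm f.integrable.norm (C := C)
    (fun x => by simpa using hC x) hp).const_mul c

theorem WeaklySingular.aestronglyMeasurable {c : ℝ} {p : ℕ} {f : 𝓢(R3, C4)} {k : R3 → R3 → C4}
    (hk : WeaklySingular c p f k) (φ : 𝓢(R3, ℂ)) :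
    AEStronglyMeasurable (fun q : R3 × R3 => φ q.1 • k q.1 q.2) (volume.prod volume) :=
  ((φ.continuous.measurable.comp measurable_fst).smul hk.1).aestronglyMeasurable

theorem WeaklySingular.norm_smul_le {c : ℝ} {p : ℕ} {f : 𝓢(R3, C4)} {k : R3 → R3 → C4}
    (hk : WeaklySingular c p f k) (φ : 𝓢(R3, ℂ)) (q : R3 × R3) :
    ‖φ q.1 • k q.1 q.2‖ ≤ c * (‖φ q.1‖ * ‖f q.2‖ * (‖q.1 - q.2‖ ^ p)⁻¹) := by
  rw [norm_smul]
  nlinarith [mul_le_mul_of_nonneg_left (hk.2 q.1 q.2) (norm_nonneg (φ q.1))]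

theorem WeaklySingular.integrable_prod {c : ℝ} {p : ℕ} {f : 𝓢(R3, C4)} {k : R3 → R3 → C4}
    (hk : WeaklySingular c p f k) (hp : p ≤ 2) (φ : 𝓢(R3, ℂ)) :
    Integrable (fun q : R3 × R3 => φ q.1 • k q.1 q.2) (volume.prod volume) :=
  (integrable_weaklySingular_bound c f hp φ).mono' (hk.aestronglyMeasurable φ)
    (.of_forall fun q => hk.norm_smul_le φ q)

theorem WeaklySingular.representedBy {c : ℝ} {p : ℕ} {f : 𝓢(R3, C4)} {k : R3 → R3 → C4}
    (hk : WeaklySingular c p f k) (hp : p ≤ 2) {T : Distr}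
    (hT : ∀ φ : 𝓢(R3, ℂ), T φ = ∫ q : R3 × R3, φ q.1 • k q.1 q.2 ∂(volume.prod volume)) :
    RepresentedBy T (fun x => ∫ y, k x y) := by
  intro φ
  have h := hk.integrable_prod hp φ
  constructor
  · refine h.integral_prod_left.congr (.of_forall fun x => ?_)
    exact integral_smul (φ x) (k x)
  · rw [hT, integral_prod _ h]
    exact integral_congr_ae (.of_forall fun x => integral_smul (φ x) (k x))

/-! ### The kernel of the resolvent of the Laplacian -/

theorem helmholtzIntegrand_eq (z : ℂ) (f : R3 → C4) (x y : R3) :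
    helmholtzIntegrand z f x y = helmholtzRadial z ‖x - y‖ • f y := rfl

theorem weaklySingular_helmholtzIntegrand {z : ℂ} (hz : 0 ≤ z.im) (f : 𝓢(R3, C4)) :
    WeaklySingular (1 / 2) 1 f (helmholtzIntegrand z f) := by
  constructor
  · have h1 : Measurable (fun q : R3 × R3 => helmholtzRadial z ‖q.1 - q.2‖) :=
      (helmholtzRadial_measurable z).comp (by fun_prop)
    exact h1.smul (f.continuous.measurable.comp measurable_snd)
  · intro x y
    rw [helmholtzIntegrand_eq, norm_smul, pow_one]
    nlinarith [mul_le_mul_of_nonneg_right (norm_helmholtzRadial_le hz (norm_nonneg (x - y)))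
      (norm_nonneg (f y))]

theorem continuousOn_integral_helmholtzIntegrand (f : 𝓢(R3, C4)) (φ : 𝓢(R3, ℂ)) :
    ContinuousOn (fun z => ∫ q : R3 × R3, φ q.1 • helmholtzIntegrand z f q.1 q.2
      ∂(volume.prod volume)) {z | 0 ≤ z.im} := by
  refine continuousOn_of_dominated
    (fun z hz => (weaklySingular_helmholtzIntegrand hz f).aestronglyMeasurable φ)
    (fun z hz => .of_forall fun q => (weaklySingular_helmholtzIntegrand hz f).norm_smul_le φ q)
    (integrable_weaklySingular_bound _ f one_le_two φ) (.of_forall fun q => ?_)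
  simp only [helmholtzIntegrand_eq]
  exact (((continuous_helmholtzRadial_left ‖q.1 - q.2‖).smul
    (continuous_const (y := f q.2))).const_smul (φ q.1)).continuousOn

/-- For Im z > 0 this is the convolution formula. Tested against φ, both sides are continuous on the
closed half plane, so the formula reaches real z. -/
theorem laplaceExt_schwartz_apply (hs : 1 / 2 < s) (hs' : 1 / 2 < s') (hss' : 2 < s + s') {z : ℂ}
    (hz : 0 ≤ z.im) (f : 𝓢(R3, C4)) (φ : 𝓢(R3, ℂ)) :
    (laplaceExt s s' z (schwartzToHSob (-1) s f)).toDistr φ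
      = ∫ q : R3 × R3, φ q.1 • helmholtzIntegrand z f q.1 q.2 ∂(volume.prod volume) := by
  have h : Set.EqOn (fun z => (laplaceExt s s' z (schwartzToHSob (-1) s f)).toDistr φ)
      (fun z => ∫ q : R3 × R3, φ q.1 • helmholtzIntegrand z f q.1 q.2 ∂(volume.prod volume))
      {z | 0 < z.im} := fun z hz => by
    beta_reduce
    have h1 : (schwartzToHSob (-1) s f).toDistr = ofL2 (f.toLp 2) := (ofL2_toLp f).symm
    rw [toDistr_laplaceExt hs hs' hss' hz, resolventFun_eq (ne_of_gt hz) (by linarith) h1,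
      ofL2_apply, ← fourier_helmholtz hz,
      integral_prod _ ((weaklySingular_helmholtzIntegrand (le_of_lt hz) f).integrable_prod
        one_le_two φ)]
    apply integral_congr_ae
    filter_upwards [multOp_fourier_toLp (integrable_helmholtz hz) f] with x hx
    rw [hx, integral_smul]
    rfl
  exact h.of_subset_closure
    ((PointwiseConvergenceCLM.evalCLM (RingHom.id ℂ) C4 φ).continuous.comp_continuousOn
      (continuousOn_toDistr_apply (continuousOn_laplaceExt hs hs' hss') _))
    (continuousOn_integral_helmholtzIntegrand f φ)
    (fun _ h => le_of_lt (α := ℝ) h) upper_subset_closure hz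

end

section

variable {s s' : ℝ}

/-! ### The singular integral operator -/

/-- The `j`-th standard basis vector of `ℝ³`. -/
abbrev basisVec (j : Fin 3) : R3 := EuclideanSpace.single j (1 : ℝ)

theorem abs_coord_le_norm (w : R3) (j : Fin 3) : |w j| ≤ ‖w‖ := PiLp.norm_apply_le w j

theorem sq_norm_rpow_neg_half (w : R3) : (‖w‖ ^ 2) ^ (-1 / 2 : ℝ) = (‖w‖ ^ 1)⁻¹ := by
  rw [← Real.rpow_natCast, ← Real.rpow_mul (norm_nonneg w), pow_one, ← Real.rpow_neg_one]
  norm_num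

theorem sq_norm_rpow_neg_three_half (w : R3) : (‖w‖ ^ 2) ^ (-3 / 2 : ℝ) = (‖w‖ ^ 3)⁻¹ := by
  rw [← Real.rpow_natCast, ← Real.rpow_mul (norm_nonneg w), ← Real.rpow_natCast,
    ← Real.rpow_neg (norm_nonneg w)]
  norm_num

theorem abs_coord_mul_inv_norm_le (w : R3) (j : Fin 3) :
    |w j| * (‖w‖ ^ 3)⁻¹ ≤ (‖w‖ ^ 2)⁻¹ := by
  rcases eq_or_ne w 0 with rfl | hw
  · simp
  · have h0 : 0 < ‖w‖ := norm_pos_iff.2 hw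
    calc |w j| * (‖w‖ ^ 3)⁻¹ ≤ ‖w‖ * (‖w‖ ^ 3)⁻¹ := by gcongr; exact abs_coord_le_norm w j
      _ = (‖w‖ ^ 2)⁻¹ := by field_simp

/-! ### Regularisation of the Newton kernel and integration by parts -/

theorem regularized_norm_le {w : R3} (hw : w ≠ 0) {ε : ℝ} (hε : 0 ≤ ε) :
    (‖w‖ ^ 2 + ε) ^ (-1 / 2 : ℝ) ≤ (‖w‖ ^ 1)⁻¹ := by
  have h0 : 0 < ‖w‖ := norm_pos_iff.2 hw
  rw [← sq_norm_rpow_neg_half]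
  exact Real.rpow_le_rpow_of_nonpos (by positivity) (by linarith) (by norm_num)

theorem regularized_deriv_le {w : R3} (hw : w ≠ 0) (j : Fin 3) {ε : ℝ} (hε : 0 ≤ ε) :
    |w j| * (‖w‖ ^ 2 + ε) ^ (-3 / 2 : ℝ) ≤ (‖w‖ ^ 2)⁻¹ := by
  have h0 : 0 < ‖w‖ := norm_pos_iff.2 hw
  refine le_trans ?_ (abs_coord_mul_inv_norm_le w j)
  rw [← sq_norm_rpow_neg_three_half]
  exact mul_le_mul_of_nonneg_left
    (Real.rpow_le_rpow_of_nonpos (by positivity) (by linarith) (by norm_num)) (abs_nonneg _)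

theorem hasLineDerivAt_regularized (y x : R3) (j : Fin 3) {ε : ℝ} (hε : 0 < ε) :
    HasLineDerivAt ℝ (fun x : R3 => (‖x - y‖ ^ 2 + ε) ^ (-1 / 2 : ℝ))
      (-((x - y) j * (‖x - y‖ ^ 2 + ε) ^ (-3 / 2 : ℝ))) x (basisVec j) := by
  have h1 : HasFDerivAt (fun x : R3 => ‖x - y‖ ^ 2 + ε) (2 • (innerSL ℝ (x - y))) x := by
    have := (((hasFDerivAt_id x).sub_const y).norm_sq).add_const ε
    exact this
  have h2 := (h1.rpow_const (p := -1 / 2) (Or.inl (by positivity))).hasLineDerivAt (basisVec j)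
  convert! h2 using 1
  norm_num [EuclideanSpace.inner_single_right]
  ring

theorem ae_sub_ne_zero (y : R3) : ∀ᵐ x : R3, x - y ≠ 0 := by
  filter_upwards [compl_mem_ae_iff.2 (measure_singleton (μ := (volume : Measure R3)) y)] with x hx
  exact sub_ne_zero.2 hx

theorem integrable_schwartz_mul_inv_norm_pow (φ : 𝓢(R3, ℂ)) (y : R3) {p : ℕ} (hp : p ≤ 2) :
    Integrable (fun x => ‖φ x‖ * (‖x - y‖ ^ p)⁻¹) := by
  obtain ⟨C, hC⟩ := exists_norm_le φ
  simpa only [norm_sub_rev y] using integrable_mul_inv_norm_pow φ.integrable.norm (C := C)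
    (fun x => by simpa using hC x) hp y

theorem norm_regularized_smul_le (φ : 𝓢(R3, ℂ)) (y : R3) {ε : ℝ} (hε : 0 ≤ ε) :
    ∀ᵐ x : R3, ‖(‖x - y‖ ^ 2 + ε) ^ (-1 / 2 : ℝ) • φ x‖ ≤ ‖φ x‖ * (‖x - y‖ ^ 1)⁻¹ := by
  filter_upwards [ae_sub_ne_zero y] with x hx
  rw [norm_smul, Real.norm_of_nonneg (by positivity), mul_comm]
  exact mul_le_mul_of_nonneg_left (regularized_norm_le hx hε) (norm_nonneg _)

theorem norm_regularized_deriv_smul_le (φ : 𝓢(R3, ℂ)) (y : R3) (j : Fin 3) {ε : ℝ} (hε : 0 ≤ ε) :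
    ∀ᵐ x : R3, ‖((x - y) j * (‖x - y‖ ^ 2 + ε) ^ (-3 / 2 : ℝ)) • φ x‖
      ≤ ‖φ x‖ * (‖x - y‖ ^ 2)⁻¹ := by
  filter_upwards [ae_sub_ne_zero y] with x hx
  rw [norm_smul, norm_mul, Real.norm_eq_abs,
    Real.norm_of_nonneg (by positivity : 0 ≤ (‖x - y‖ ^ 2 + ε) ^ (-3 / 2 : ℝ)), mul_comm]
  exact mul_le_mul_of_nonneg_left (regularized_deriv_le hx j hε) (norm_nonneg _)

theorem aestronglyMeasurable_regularized_smul (φ : 𝓢(R3, ℂ)) (y : R3) (ε : ℝ) :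
    AEStronglyMeasurable (fun x : R3 => (‖x - y‖ ^ 2 + ε) ^ (-1 / 2 : ℝ) • φ x) := by
  have : Measurable (fun x : R3 => (‖x - y‖ ^ 2 + ε) ^ (-1 / 2 : ℝ)) := by fun_prop
  exact (this.smul φ.continuous.measurable).aestronglyMeasurable

theorem aestronglyMeasurable_regularized_deriv_smul (φ : 𝓢(R3, ℂ)) (y : R3) (j : Fin 3) (ε : ℝ) :
    AEStronglyMeasurable
      (fun x : R3 => ((x - y) j * (‖x - y‖ ^ 2 + ε) ^ (-3 / 2 : ℝ)) • φ x) := by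
  have : Measurable (fun x : R3 => (x - y) j * (‖x - y‖ ^ 2 + ε) ^ (-3 / 2 : ℝ)) := by fun_prop
  exact (this.smul φ.continuous.measurable).aestronglyMeasurable

/-- For ε > 0 the kernel is smooth, so integration by parts has no boundary term at x = y; the
bounds by |x-y|⁻¹ and |x-y|⁻² are uniform in ε and survive the limit ε → 0. -/
theorem integral_regularized_smul_lineDeriv (φ : 𝓢(R3, ℂ)) (j : Fin 3) (y : R3) {ε : ℝ}
    (hε : 0 < ε) :
    ∫ x : R3, (‖x - y‖ ^ 2 + ε) ^ (-1 / 2 : ℝ) • (∂_{basisVec j} φ) x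
      = ∫ x : R3, ((x - y) j * (‖x - y‖ ^ 2 + ε) ^ (-3 / 2 : ℝ)) • φ x := by
  have hi1 : ∀ ψ : 𝓢(R3, ℂ), Integrable (fun x : R3 => (‖x - y‖ ^ 2 + ε) ^ (-1 / 2 : ℝ) • ψ x) :=
    fun ψ => (integrable_schwartz_mul_inv_norm_pow ψ y one_le_two).mono'
      (aestronglyMeasurable_regularized_smul ψ y ε) (norm_regularized_smul_le ψ y hε.le)
  have hi2 : Integrable
      (fun x : R3 => (-((x - y) j * (‖x - y‖ ^ 2 + ε) ^ (-3 / 2 : ℝ))) • φ x) := by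
    simp only [neg_smul]
    exact ((integrable_schwartz_mul_inv_norm_pow φ y le_rfl).mono'
      (aestronglyMeasurable_regularized_deriv_smul φ y j ε)
      (norm_regularized_deriv_smul_le φ y j hε.le)).neg
  have h := integral_bilinear_hasLineDerivAt_right_eq_neg_left_of_integrable
    (μ := (volume : Measure R3)) (v := basisVec j)
    (f := φ) (f' := (∂_{basisVec j} φ : 𝓢(R3, ℂ)))
    (g := fun x : R3 => (‖x - y‖ ^ 2 + ε) ^ (-1 / 2 : ℝ))
    (g' := fun x => -((x - y) j * (‖x - y‖ ^ 2 + ε) ^ (-3 / 2 : ℝ)))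
    (B := (ContinuousLinearMap.lsmul ℝ ℝ).flip) (hi1 _) hi2 (hi1 _)
    (fun x _ => by
      rw [SchwartzMap.lineDerivOp_apply_eq_fderiv]
      exact φ.differentiableAt.hasFDerivAt.hasLineDerivAt _)
    (fun x _ => hasLineDerivAt_regularized y x j hε)
  simp only [ContinuousLinearMap.flip_apply, ContinuousLinearMap.lsmul_apply, neg_smul,
    integral_neg, neg_inj] at h
  exact h.symm

theorem tendsto_regularized {w : R3} (hw : w ≠ 0) (p : ℝ) :
    Tendsto (fun ε : ℝ => (‖w‖ ^ 2 + ε) ^ p) (𝓝[>] 0) (𝓝 ((‖w‖ ^ 2) ^ p)) := by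
  have h0 : 0 < ‖w‖ := norm_pos_iff.2 hw
  have h1 : Tendsto (fun ε : ℝ => ‖w‖ ^ 2 + ε) (𝓝[>] 0) (𝓝 (‖w‖ ^ 2)) := by
    have h2 : Tendsto (fun ε : ℝ => ‖w‖ ^ 2 + ε) (𝓝 0) (𝓝 (‖w‖ ^ 2 + 0)) :=
      Continuous.tendsto (by fun_prop) 0
    rw [add_zero] at h2
    exact h2.mono_left nhdsWithin_le_nhds
  exact h1.rpow_const (Or.inl (by positivity))

/-- Integration by parts against the Newton kernel. -/
theorem integral_inv_norm_smul_lineDeriv (φ : 𝓢(R3, ℂ)) (j : Fin 3) (y : R3) :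
    ∫ x : R3, ‖x - y‖⁻¹ • (∂_{basisVec j} φ) x
      = ∫ x : R3, ((x - y) j * (‖x - y‖ ^ 3)⁻¹) • φ x := by
  have h1 : Tendsto (fun ε : ℝ => ∫ x : R3, (‖x - y‖ ^ 2 + ε) ^ (-1 / 2 : ℝ) •
      (∂_{basisVec j} φ) x) (𝓝[>] 0) (𝓝 (∫ x : R3, ‖x - y‖⁻¹ • (∂_{basisVec j} φ) x)) := by
    refine tendsto_integral_filter_of_dominated_convergence _
      (.of_forall fun ε => aestronglyMeasurable_regularized_smul _ y ε) ?_
      (integrable_schwartz_mul_inv_norm_pow (∂_{basisVec j} φ) y one_le_two) ?_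
    · filter_upwards [self_mem_nhdsWithin] with ε hε
      exact norm_regularized_smul_le _ y (le_of_lt hε)
    · filter_upwards [ae_sub_ne_zero y] with x hx
      have := tendsto_regularized hx (-1 / 2)
      rw [sq_norm_rpow_neg_half, pow_one] at this
      exact this.smul_const _
  have h2 : Tendsto (fun ε : ℝ => ∫ x : R3, ((x - y) j * (‖x - y‖ ^ 2 + ε) ^ (-3 / 2 : ℝ)) • φ x)
      (𝓝[>] 0) (𝓝 (∫ x : R3, ((x - y) j * (‖x - y‖ ^ 3)⁻¹) • φ x)) := by
    refine tendsto_integral_filter_of_dominated_convergence _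
      (.of_forall fun ε => aestronglyMeasurable_regularized_deriv_smul _ y j ε) ?_
      (integrable_schwartz_mul_inv_norm_pow φ y le_rfl) ?_
    · filter_upwards [self_mem_nhdsWithin] with ε hε
      exact norm_regularized_deriv_smul_le _ y j (le_of_lt hε)
    · filter_upwards [ae_sub_ne_zero y] with x hx
      have := tendsto_regularized hx (-3 / 2)
      rw [sq_norm_rpow_neg_three_half] at this
      exact (this.const_mul _).smul_const _
  refine tendsto_nhds_unique h1 (h2.congr' ?_)
  filter_upwards [self_mem_nhdsWithin] with ε hε
  exact (integral_regularized_smul_lineDeriv φ j y hε).symm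

/-- The integrand `(x-y)ⱼ / (4π|x-y|³) f(y)`. -/
def rieszIntegrand (j : Fin 3) (f : R3 → C4) (x y : R3) : C4 :=
  (((x - y) j * (‖x - y‖ ^ 3)⁻¹ / (4 * Real.pi) : ℝ) : ℂ) • f y

theorem weaklySingular_rieszIntegrand (j : Fin 3) (f : 𝓢(R3, C4)) :
    WeaklySingular 1 2 f (rieszIntegrand j f) := by
  constructor
  · have h1 : Measurable (fun q : R3 × R3 =>
        (((q.1 - q.2) j * (‖q.1 - q.2‖ ^ 3)⁻¹ / (4 * Real.pi) : ℝ) : ℂ)) := by fun_prop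
    exact h1.smul (f.continuous.measurable.comp measurable_snd)
  · intro x y
    rw [rieszIntegrand, norm_smul, Complex.norm_real, norm_div, norm_mul, Real.norm_eq_abs,
      Real.norm_of_nonneg (by positivity : 0 ≤ (‖x - y‖ ^ 3)⁻¹),
      Real.norm_of_nonneg (by positivity : 0 ≤ 4 * Real.pi), one_mul, mul_comm]
    refine mul_le_mul_of_nonneg_left ?_ (norm_nonneg _)
    refine (div_le_self (by positivity) ?_).trans (abs_coord_mul_inv_norm_le _ j)
    linarith [Real.pi_gt_three]

theorem singularIntegrand_eq (f : R3 → C4) (x y : R3) :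
    singularIntegrand f x y = ∑ j, alphaOp j (Complex.I • rieszIntegrand j f x y) := by
  rw [singularIntegrand, Finset.smul_sum]
  refine Finset.sum_congr rfl fun j _ => ?_
  rw [rieszIntegrand, ← map_smul, smul_smul, smul_smul]
  congr 2
  push_cast
  simp only [div_eq_mul_inv, mul_inv]
  ring

theorem weaklySingular_singularIntegrand (f : 𝓢(R3, C4)) :
    WeaklySingular (∑ j, ‖alphaOp j‖) 2 f (singularIntegrand f) := by
  have h : singularIntegrand f
      = fun x y => ∑ j, alphaOp j (Complex.I • rieszIntegrand j f x y) := by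
    funext x y
    exact singularIntegrand_eq f x y
  rw [h]
  constructor
  · refine Finset.measurable_fun_sum _ fun j _ => ?_
    exact (alphaOp j).continuous.measurable.comp
      ((weaklySingular_rieszIntegrand j f).1.const_smul Complex.I)
  · intro x y
    rw [Finset.sum_mul]
    refine norm_sum_le_of_le _ fun j _ => ?_
    refine ((alphaOp j).le_opNorm _).trans (mul_le_mul_of_nonneg_left ?_ (norm_nonneg _))
    rw [norm_smul, Complex.norm_I, one_mul]
    simpa using (weaklySingular_rieszIntegrand j f).2 x y

theorem momentum_apply_apply (j : Fin 3) (u : Distr) (φ : 𝓢(R3, ℂ)) :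
    momentum j u φ = Complex.I • u (∂_{basisVec j} φ) := by
  have h : momentum j u φ = (-Complex.I) • (∂_{basisVec j} u) φ := rfl
  rw [h, TemperedDistribution.lineDerivOp_apply_apply, map_neg, smul_neg, neg_smul, neg_neg]

theorem diracDistr_apply_apply (u : Distr) (φ : 𝓢(R3, ℂ)) :
    diracDistr u φ = ∑ j, alphaOp j (Complex.I • u (∂_{basisVec j} φ)) := by
  have h : diracDistr u φ = ∑ j, alphaOp j (momentum j u φ) := by
    rw [diracDistr_apply, sum_apply]
    rfl
  rw [h]
  simp only [momentum_apply_apply]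

/-- Fubini with the x-integral inside: for each fixed y this is integration by parts against
|x-y|⁻¹. -/
theorem integral_lineDeriv_helmholtzIntegrand_zero (f : 𝓢(R3, C4)) (φ : 𝓢(R3, ℂ)) (j : Fin 3) :
    ∫ q : R3 × R3, (∂_{basisVec j} φ) q.1 • helmholtzIntegrand 0 f q.1 q.2
        ∂(volume.prod volume)
      = ∫ q : R3 × R3, φ q.1 • rieszIntegrand j f q.1 q.2 ∂(volume.prod volume) := by
  rw [integral_prod_symm _ ((weaklySingular_helmholtzIntegrand (z := 0) (by simp) f).integrable_prod
      one_le_two _), integral_prod_symm _ ((weaklySingular_rieszIntegrand j f).integrable_prod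
      le_rfl _)]
  refine integral_congr_ae (.of_forall fun y => ?_)
  have h1 : ∀ x, (∂_{basisVec j} φ) x • helmholtzIntegrand 0 f x y
      = (‖x - y‖⁻¹ • (∂_{basisVec j} φ) x) • ((4 * Real.pi : ℂ)⁻¹ • f y) := by
    intro x
    rw [helmholtzIntegrand, smul_smul, smul_smul, Complex.real_smul]
    congr 1
    simp only [mul_zero, zero_mul, Complex.exp_zero, one_div, mul_inv, Complex.ofReal_inv]
    ring
  have h2 : ∀ x, φ x • rieszIntegrand j f x y
      = (((x - y) j * (‖x - y‖ ^ 3)⁻¹) • φ x) • ((4 * Real.pi : ℂ)⁻¹ • f y) := by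
    intro x
    rw [rieszIntegrand, smul_smul, smul_smul, Complex.real_smul]
    congr 1
    push_cast
    ring
  simp only [h1, h2]
  rw [integral_smul_const, integral_smul_const, integral_inv_norm_smul_lineDeriv]

theorem diracLaplaceExt_zero_schwartz_apply (hs : 1 / 2 < s) (hs' : 1 / 2 < s')
    (hss' : 2 < s + s') (f : 𝓢(R3, C4)) (φ : 𝓢(R3, ℂ)) :
    (diracLaplaceExt s s' 0 (schwartzToHSob (-1) s f)).toDistr φ
      = ∫ q : R3 × R3, φ q.1 • singularIntegrand f q.1 q.2 ∂(volume.prod volume) := by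
  have h0 : (0 : ℝ) ≤ (0 : ℂ).im := le_of_eq Complex.zero_im.symm
  rw [diracLaplaceExt_eq hs hs' hss' h0, diracDistr_apply_apply]
  simp only [laplaceExt_schwartz_apply hs hs' hss' h0, integral_lineDeriv_helmholtzIntegrand_zero]
  have hi : ∀ j, Integrable (fun q : R3 × R3 => Complex.I • φ q.1 • rieszIntegrand j f q.1 q.2)
      (volume.prod volume) := fun j =>
    ((weaklySingular_rieszIntegrand j f).integrable_prod le_rfl φ).smul Complex.I
  have h1 : ∀ q : R3 × R3, φ q.1 • singularIntegrand f q.1 q.2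
      = ∑ j, alphaOp j (Complex.I • φ q.1 • rieszIntegrand j f q.1 q.2) := by
    intro q
    rw [singularIntegrand_eq, Finset.smul_sum]
    refine Finset.sum_congr rfl fun j _ => ?_
    rw [← map_smul, smul_comm]
  simp only [h1]
  rw [integral_finsetSum _ fun j _ => (alphaOp j).integrable_comp (hi j)]
  refine Finset.sum_congr rfl fun j _ => ?_
  rw [← integral_smul]
  exact ((alphaOp j).integral_comp_comm (hi j)).symm

theorem RepresentedBy.unique {S T : Distr} {g : R3 → C4} (hS : RepresentedBy S g)
    (hT : RepresentedBy T g) : S = T := by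
  ext1 φ
  rw [(hS φ).2, (hT φ).2]

end

end MasslessDirac

end

/-! ### Boundary values on both half planes and the threshold z = 0 -/

theorem mainTheorem4 (s s' : ℝ) (hs : 1 / 2 < s) (hs' : 1 / 2 < s') (hss' : 2 < s + s') :
    -- the resolvents of `H₀` and `-Δ` in `L²` exist off the spectra
    (∀ z : ℂ, z.im ≠ 0 → IsResolvent diracOp z (diracResolvent z)) ∧
    (∀ z : ℂ, (¬ ∃ r : ℝ, 0 ≤ r ∧ z = r) →
      IsResolvent negLaplaceOp z (laplaceResolvent z)) ∧
    -- `Ωp`, `Ωm` are the extensions of `z ↦ Γ₀(z²)`, and `Rp`, `Rm` those of `R₀`, to the closed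
    -- upper and to the closed lower half plane
    ∃ (Ωp Ωm : ℂ → (HSob (-1) s →L[ℂ] HSob 1 (-s')))
      (Rp Rm : ℂ → (HSob (-1) s →L[ℂ] HSob 0 (-s'))),
      -- continuity in the operator norm up to the real line
      ContinuousOn Ωp {z | 0 ≤ z.im} ∧ ContinuousOn Ωm {z | z.im ≤ 0} ∧
      ContinuousOn Rp {z | 0 ≤ z.im} ∧ ContinuousOn Rm {z | z.im ≤ 0} ∧
      -- in the open half planes they are the unique bounded extensions of the resolvents
      (∀ z : ℂ, 0 < z.im → ∀ T : HSob (-1) s →L[ℂ] HSob 1 (-s'),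
        Extends T (laplaceResolvent (z ^ 2)) ↔ T = Ωp z) ∧
      (∀ z : ℂ, z.im < 0 → ∀ T : HSob (-1) s →L[ℂ] HSob 1 (-s'),
        Extends T (laplaceResolvent (z ^ 2)) ↔ T = Ωm z) ∧
      (∀ z : ℂ, 0 < z.im → ∀ T : HSob (-1) s →L[ℂ] HSob 0 (-s'),
        Extends T (diracResolvent z) ↔ T = Rp z) ∧
      (∀ z : ℂ, z.im < 0 → ∀ T : HSob (-1) s →L[ℂ] HSob 0 (-s'),
        Extends T (diracResolvent z) ↔ T = Rm z) ∧
      -- the integral kernels of `Γ₀(z²)` on Schwartz functions, up to the real line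
      (∀ z : ℂ, 0 ≤ z.im → ∀ f : 𝓢(R3, C4),
        (∀ x, Integrable (helmholtzIntegrand z f x)) ∧
        RepresentedBy (Ωp z (schwartzToHSob (-1) s f)).toDistr
          (fun x => ∫ y, helmholtzIntegrand z f x y)) ∧
      (∀ z : ℂ, z.im ≤ 0 → ∀ f : 𝓢(R3, C4),
        (∀ x, Integrable (helmholtzIntegrand (-z) f x)) ∧
        RepresentedBy (Ωm z (schwartzToHSob (-1) s f)).toDistr
          (fun x => ∫ y, helmholtzIntegrand (-z) f x y)) ∧
      -- `R₀^±(z) = (H₀ + z) Ω₀^±(z)` on the closed half planes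
      (∀ z : ℂ, 0 ≤ z.im → ∀ u : HSob (-1) s,
        (Rp z u).toDistr = diracDistr (Ωp z u).toDistr + z • (Ωp z u).toDistr) ∧
      (∀ z : ℂ, z.im ≤ 0 → ∀ u : HSob (-1) s,
        (Rm z u).toDistr = diracDistr (Ωm z u).toDistr + z • (Ωm z u).toDistr) ∧
      -- at the threshold `z = 0` both limits coincide, with `H₀ Γ₀(0)`
      Ωp 0 = Ωm 0 ∧ Rp 0 = Rm 0 ∧
      (∀ u : HSob (-1) s,
        (Rp 0 u).toDistr = diracDistr (Ωp 0 u).toDistr) ∧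
      -- and with the singular integral operator `A` on Schwartz functions
      (∀ f : 𝓢(R3, C4),
        (∀ x, Integrable (singularIntegrand f x)) ∧
        RepresentedBy (Rp 0 (schwartzToHSob (-1) s f)).toDistr
          (singularOp f)) ∧
      -- whose unique bounded extension they are
      (∀ T : HSob (-1) s →L[ℂ] HSob 0 (-s'),
        (∀ f : 𝓢(R3, C4),
          RepresentedBy (T (schwartzToHSob (-1) s f)).toDistr
            (singularOp f)) ↔ T = Rp 0) := by
  have hu : ∀ {z : ℂ}, z.im ≤ 0 → 0 ≤ (-z).im := fun h => by
    rw [Complex.neg_im]; linarith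
  have hu' : ∀ {z : ℂ}, z.im < 0 → 0 < (-z).im := fun h => by
    rw [Complex.neg_im]; linarith
  have hmaps : Set.MapsTo (fun z : ℂ => -z) {z | z.im ≤ 0} {z | 0 ≤ z.im} := fun _ h => hu h
  have hneg : ContinuousOn (fun z : ℂ => -z) {z | z.im ≤ 0} := continuous_neg.continuousOn
  have h0 : (0 : ℝ) ≤ (0 : ℂ).im := le_of_eq Complex.zero_im.symm
  have hΩ := continuousOn_laplaceExt hs hs' hss'
  have hP := continuousOn_diracLaplaceExt hs hs' hss'
  have hQ := continuousOn_laplaceExtIncl hs hs' hss'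
  have hR0 : diracLaplaceExt s s' 0 + (0 : ℂ) • laplaceExtIncl s s' 0 = diracLaplaceExt s s' 0 :=
    (congrArg (diracLaplaceExt s s' 0 + ·) (zero_smul ℂ (laplaceExtIncl s s' 0))).trans
      (add_zero _)
  have hA : ∀ f : 𝓢(R3, C4), RepresentedBy
      ((diracLaplaceExt s s' 0 + (0 : ℂ) • laplaceExtIncl s s' 0)
        (schwartzToHSob (-1) s f)).toDistr (singularOp f) := fun f => by
    rw [hR0]
    exact (weaklySingular_singularIntegrand f).representedBy le_rfl
      (diracLaplaceExt_zero_schwartz_apply hs hs' hss' f)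
  -- The lower families are the upper ones at -z, but the scalar factor in H₀ + z remains z.
  refine ⟨fun z hz => ?_, fun z hz => ?_, laplaceExt s s', fun z => laplaceExt s s' (-z),
    fun z => diracLaplaceExt s s' z + z • laplaceExtIncl s s' z,
    fun z => diracLaplaceExt s s' (-z) + z • laplaceExtIncl s s' (-z),
    hΩ, hΩ.comp hneg hmaps, hP.add (continuousOn_id.smul hQ),
    (hP.comp hneg hmaps).add (continuousOn_id.smul (hQ.comp hneg hmaps)),
    fun z hz T => ?_, fun z hz T => ?_, fun z hz T => ?_, fun z hz T => ?_,
    fun z hz f => ⟨(weaklySingular_helmholtzIntegrand hz f).integrable one_le_two,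
      (weaklySingular_helmholtzIntegrand hz f).representedBy one_le_two
        (laplaceExt_schwartz_apply hs hs' hss' hz f)⟩,
    fun z hz f => ⟨(weaklySingular_helmholtzIntegrand (hu hz) f).integrable one_le_two,
      (weaklySingular_helmholtzIntegrand (hu hz) f).representedBy one_le_two
        (laplaceExt_schwartz_apply hs hs' hss' (hu hz) f)⟩,
    fun z hz u => toDistr_dirac hs hs' hss' hz u,
    fun z hz u => toDistr_dirac hs hs' hss' (hu hz) u, ?_, ?_, fun u => ?_,
    fun f => ⟨(weaklySingular_singularIntegrand f).integrable le_rfl, hA f⟩,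
    fun T => ⟨fun hT => ?_, ?_⟩⟩
  · rw [diracResolvent_eq hz]
    exact isResolvent_diracOp hz
  · rw [laplaceResolvent_eq hz]
    exact isResolvent_negLaplaceOp hz
  · have h := extends_laplaceExt hs hs' hss' hz
    exact ⟨fun hT => hT.unique h, fun hT => hT ▸ h⟩
  · have h := extends_laplaceExt hs hs' hss' (hu' hz)
    rw [neg_sq] at h
    exact ⟨fun hT => hT.unique h, fun hT => hT ▸ h⟩
  · have h := extends_dirac hs hs' hss' hz rfl (ne_of_gt hz)
    exact ⟨fun hT => hT.unique h, fun hT => hT ▸ h⟩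
  · have h := extends_dirac hs hs' hss' (hu' hz) (neg_sq z) (ne_of_lt hz)
    exact ⟨fun hT => hT.unique h, fun hT => hT ▸ h⟩
  · simp only [neg_zero]
  · simp only [neg_zero]
  · exact (congrArg (fun T => (T u).toDistr) hR0).trans (diracLaplaceExt_eq hs hs' hss' h0 u)
  -- A representing function determines the distribution, so T and the limit operator agree on the
  -- dense set of Schwartz functions.
  · exact HSob.clm_ext_schwartz fun f => HSob.toDistr_injective ((hT f).unique (hA f))
  · rintro rfl
    exact hA
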